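/- \textbf{Potentials.} A potential is a piecewise continuous function $u:\mathbb R\to\mathbb R$ that attains its maximum at a unique point $S(u)$; write $\mathcal M(u)=u(S(u))$. It is unimodal if it is nondecreasing on $(-\infty,S(u))$ and nonincreasing on $(S(u),\infty)$. Fix a finite speed $v>0$. For $w=(T,E,U)$ with $T\ge 0$, $E>0$, $0\le U\le 1$, and a potential $u$ with $x_*=S(u)$ and $\mathcal M=\mathcal M(u)$, let $z>0$ be the number with $\int_{x_*-z}^{x_*+z}(\mathcal M+T-u)\,dx=E$, put $a=\mathcal M+T-u(x_*-z)$, $b=\mathcal M+T-u(x_*+z)$, let $x^*=x_*-z$ if $U\le \frac a{a+b}$ and $x^*=x_*+z$ otherwise, and define $$(\mathcal H_w u)(x)=\begin{cases}\mathcal M+T+\frac zv, & x=x^*,\\ \mathcal M+T, & x\in[x_*-z,x_*+z],\ x\ne x^*,\\ u(x), &\text{otherwise.}\end{cases}$$ \textbf{The sequence of potentials.} Let $u_0$ be a unimodal potential with $S(u_0)=0$ and $\mathcal M(u_0)=0$, and let $\tau$ be a probability law on $[0,\infty)$ (the law of a service time). Let $w_n=(T_n,E_n,U_n)$, $n\ge1$,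 be i.i.d. with independent coordinates, where $T_n$ has law $\tau$, $E_n$ is standard exponential and $U_n$ is uniform on $[0,1]$. Put $u_n=\mathcal H_{w_n}(u_{n-1})$ for $n\ge 1$. \textbf{The greedy server.} At time $0$ the server starts serving a customer at $x=0$. The other customers present at time $0$ form a Poisson point process on $\mathbb R$ with intensity $-u_0(x)\,dx$, later customers arrive as a Poisson point process on $\mathbb R\times(0,\infty)$ with unit intensity $dx\,dt$, the service times are i.i.d. with law $\tau$, and these three objects are independent. A served customer leaves the system. At the end of each service the server chooses the nearest waiting customer, travels to it at speed $v$, ignoring new arrivals while in transit, and starts its service upon arrival. Let $\mathcal S_t$ be the position of the server at time $t$, and let $t_n$ be the time at which the $n$-th service after the initial one begins, $n\ge1$. \textbf{Lemma 2.} Almost surely the process $(\mathcal S_t)$ and the times $(t_n)$ exist, and the sequences $$\bigl(\mathcal M(u_n),S(u_n)\bigr)_{n=1,2,\dots}\qquad\text{and}\qquad \bigl(t_n,\mathcal S_{t_n}\bigr)_{n=1,2,\dots}$$ have the same distribution. -/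

import Mathlib

open MeasureTheory ProbabilityTheory Set Filter Topology
open scoped ENNReal NNReal

namespace GreedyServer

noncomputable section

/-! ### Potentials and the operators acting on them -/

/-- Piecewise continuity on the line: finitely many discontinuities in every bounded interval, and
finite one-sided limits everywhere. -/
def PiecewiseContinuous (u : ℝ → ℝ) : Prop :=
  (∀ a b : ℝ, {x ∈ Icc a b | ¬ ContinuousAt u x}.Finite) ∧
  (∀ x : ℝ, ∃ l : ℝ, Tendsto u (𝓝[<] x) (𝓝 l)) ∧
  (∀ x : ℝ, ∃ l : ℝ, Tendsto u (𝓝[>] x) (𝓝 l))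

/-- A potential: a piecewise continuous function that attains its maximum at exactly one point. -/
structure IsPotential (u : ℝ → ℝ) : Prop where
  piecewiseContinuous : PiecewiseContinuous u
  unique_max : ∃! x : ℝ, ∀ y : ℝ, u y ≤ u x

/-- `S(u)`, the point at which the potential `u` attains its maximum. -/
def peak (u : ℝ → ℝ) : ℝ := Classical.epsilon fun x : ℝ => ∀ y : ℝ, u y ≤ u x

/-- `M(u) = u(S(u))`, the maximal value of the potential `u`. -/
def height (u : ℝ → ℝ) : ℝ := u (peak u)

/-- A potential is unimodal if it is nondecreasing to the left and nonincreasing to the right of the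
point where it attains its maximum. -/
def IsUnimodal (u : ℝ → ℝ) : Prop :=
  MonotoneOn u (Iio (peak u)) ∧ AntitoneOn u (Ioi (peak u))

/-- A potential is centered if its maximum is attained at `0` and equals `0`. -/
def IsCentered (u : ℝ → ℝ) : Prop := peak u = 0 ∧ height u = 0

/-- The positive number `z` such that the integral of `M(u) + T - u` over
`[S(u) - z, S(u) + z]` equals `E`. -/
def radius (T E : ℝ) (u : ℝ → ℝ) : ℝ :=
  Classical.epsilon fun z : ℝ =>
    0 < z ∧ ∫ x in (peak u - z)..(peak u + z), (height u + T - u x) = E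

open Classical in
/-- The new position `x^*`: with `a = M(u) + T - u(S(u) - z)` and `b = M(u) + T - u(S(u) + z)` it is
`S(u) - z` if `U ≤ a / (a + b)` and `S(u) + z` otherwise. The triple is `w = (T, E, U)`. -/
def newPoint (w : ℝ × ℝ × ℝ) (u : ℝ → ℝ) : ℝ :=
  let z := radius w.1 w.2.1 u
  let a := height u + w.1 - u (peak u - z)
  let b := height u + w.1 - u (peak u + z)
  if w.2.2 ≤ a / (a + b) then peak u - z else peak u + z

open Classical in
/-- The operator `H_w`, `w = (T, E, U)`, for a server travelling at speed `v`. -/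
def step (v : ℝ) (w : ℝ × ℝ × ℝ) (u : ℝ → ℝ) : ℝ → ℝ := fun x =>
  let z := radius w.1 w.2.1 u
  if x = newPoint w u then height u + w.1 + z / v
  else if x ∈ Icc (peak u - z) (peak u + z) then height u + w.1
  else u x

/-- The sequence of potentials `u_0 = u₀`, `u_{n+1} = H_{w_n}(u_n)`. -/
def potentialSeq (v : ℝ) (u₀ : ℝ → ℝ) (w : ℕ → ℝ × ℝ × ℝ) : ℕ → ℝ → ℝ
  | 0 => u₀
  | n + 1 => step v (w n) (potentialSeq v u₀ w n)

/-! ### Poisson point processes, as random sets of points -/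

section Poisson

variable {Ω E : Type*} [MeasurableSpace E]

/-- The number of points of the random set `ξ` in `B`. -/
def count (ξ : Ω → Set E) (B : Set E) (ω : Ω) : ℕ∞ := (ξ ω ∩ B).encard

/-- The σ-algebra on `Ω` generated by the random set of points `ξ`, that is, by the numbers of its
points in measurable sets. -/
@[reducible] def pointSigma (ξ : Ω → Set E) : MeasurableSpace Ω :=
  ⨆ B : {B : Set E // MeasurableSet B}, MeasurableSpace.comap (count ξ B.1) ⊤

/-- `ξ` is a Poisson point process with intensity measure `μ` (the measure `μ` is meant to have no
atoms, so that the points are distinct): the number of points in a set of finite measure `μ B` is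
Poisson distributed with mean `μ B`, and the numbers of points in disjoint sets are independent. -/
structure IsPoissonProcess [MeasurableSpace Ω] (ξ : Ω → Set E) (μ : Measure E) (P : Measure Ω) :
    Prop where
  measurable_count : ∀ B : Set E, MeasurableSet B → Measurable (count ξ B)
  law_count : ∀ B : Set E, MeasurableSet B → μ B < ∞ →
    P.map (count ξ B) = (poissonMeasure (μ B).toNNReal).map (fun n : ℕ => (n : ℕ∞))
  indep_count : ∀ (n : ℕ) (B : Fin n → Set E), (∀ i, MeasurableSet (B i)) →
    Pairwise (fun i j => Disjoint (B i) (B j)) → iIndepFun (fun i => count ξ (B i)) P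

end Poisson

/-! ### The greedy server -/

/-- All customers, as pairs (position, arrival time). A customer who is waiting at time `0` gets
arrival time `0`. -/
def customers (init : Set ℝ) (arr : Set (ℝ × ℝ)) : Set (ℝ × ℝ) :=
  (fun x : ℝ => (x, (0 : ℝ))) '' init ∪ arr

/-- Customers waiting when the service number `n` ends (service `0` starts at time `0`): they have
arrived by that time, `t n + T n`, and are not among the customers `c 0, …, c (n - 1)`, who have
received services `1, …, n`. -/
def waiting (A : Set (ℝ × ℝ)) (T t : ℕ → ℝ) (c : ℕ → ℝ × ℝ) (n : ℕ) : Set (ℝ × ℝ) :=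
  {p ∈ A | p.2 ≤ t n + T n ∧ ∀ k < n, c k ≠ p}

/-- `𝒮 : [0, ∞) → ℝ` is the position of a greedy server of speed `v` facing the customers `A`.
Service number `n` starts at time `t n` and lasts `T n`; service `0` is that of a customer at the
origin. The customer chosen at the end of service `n`, to receive service `n + 1`, is `c n`. -/
structure IsGreedyServer (v : ℝ) (A : Set (ℝ × ℝ)) (T : ℕ → ℝ)
    (t : ℕ → ℝ) (c : ℕ → ℝ × ℝ) (𝒮 : ℝ → ℝ) : Prop where
  time_zero : t 0 = 0
  pos_zero : 𝒮 0 = 0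
  /-- the server does not move during a service -/
  serve : ∀ n, ∀ s ∈ Icc (t n) (t n + T n), 𝒮 s = 𝒮 (t n)
  /-- the customer to be served next is waiting -/
  next_waiting : ∀ n, c n ∈ waiting A T t c n
  /-- no waiting customer is nearer -/
  next_nearest : ∀ n, ∀ p ∈ waiting A T t c n, |(c n).1 - 𝒮 (t n)| ≤ |p.1 - 𝒮 (t n)|
  /-- the next service starts upon arrival at the chosen customer -/
  next_time : ∀ n, t (n + 1) = t n + T n + |(c n).1 - 𝒮 (t n)| / v
  /-- in between, the server travels toward the chosen customer at speed `v` -/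
  travel : ∀ n, ∀ s ∈ Icc (t n + T n) (t (n + 1)),
    𝒮 s = 𝒮 (t n) + (SignType.sign ((c n).1 - 𝒮 (t n)) : ℝ) * (v * (s - (t n + T n)))

end

end GreedyServer

/-!
Record a trajectory by its history `σ`: the service time and the new position at every step. Running
the update along `σ` gives a unimodal function `u` peaked at the current position, with the current
time as its height, and at each time `c` the customers at `s` that the server cannot know about have
intensity `c - u s`. Searching outwards from the server, the unexplored customers within distance
`z` have mean `∫ (M + T - u)` over `[S - z, S + z]`, so the explored area is exponential, and the
side is chosen with odds `a : b`: this is the operator `H_w`. The law of the history of `(u_n)`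
therefore has the density `∏ (M + T - u) * exp (- explored area)`.

For the server only an upper bound is needed. Covering histories by small cells and using void
probabilities, the probability that the greedy history lies in a closed set `F` is at most the law
of the histories of `(u_n)` evaluated at `F` (an inequality of Mecke type). A map whose outer law is
dominated on closed sets by a probability measure is almost everywhere measurable and has that law,
so neither a matching lower bound nor the measurability of the server is needed.
-/

namespace GreedyServer

/-! ### Outer laws and measurable codes -/

theorem nullMeasurableSet_of_measure_add_measure_compl_le {Ω : Type*} [MeasurableSpace Ω]
    {P : Measure Ω} [IsFiniteMeasure P] {s : Set Ω} (h : P s + P sᶜ ≤ P univ) :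
    NullMeasurableSet s P := by
  have hm : MeasurableSet (toMeasurable P sᶜ) := measurableSet_toMeasurable P sᶜ
  refine hm.compl.nullMeasurableSet.congr (ae_eq_of_subset_of_measure_ge
    (compl_subset_comm.2 (subset_toMeasurable P sᶜ)) ?_ hm.compl.nullMeasurableSet
    (measure_ne_top P s))
  rw [measure_compl hm (measure_ne_top _ _), measure_toMeasurable]
  exact ENNReal.le_sub_of_add_le_right (measure_ne_top P sᶜ) h

section OuterLaw

variable {Ω S : Type*} [MeasurableSpace Ω] {P : Measure Ω} [TopologicalSpace S]
  [TopologicalSpace.PseudoMetrizableSpace S] [MeasurableSpace S] {W : Measure S}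
  {X : Ω → S}

theorem measure_preimage_le_of_forall_isClosed_le [W.OuterRegular]
    (h : ∀ F : Set S, IsClosed F → P (X ⁻¹' F) ≤ W F) (B : Set S) : P (X ⁻¹' B) ≤ W B := by
  let := TopologicalSpace.pseudoMetrizableSpacePseudoMetric S
  have hopen : ∀ U : Set S, IsOpen U → P (X ⁻¹' U) ≤ W U := by
    intro U hU
    obtain ⟨F, hF, hFU, hUn, hmono⟩ := hU.exists_iUnion_isClosed
    rw [← hUn, preimage_iUnion,
      Monotone.measure_iUnion fun i j hij => preimage_mono (hmono hij), hUn]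
    exact iSup_le fun n => (h _ (hF n)).trans (measure_mono (hFU n))
  rw [B.measure_eq_iInf_isOpen W]
  exact le_iInf₂ fun U hBU => le_iInf fun hU =>
    (measure_mono (preimage_mono hBU)).trans (hopen U hU)

theorem hasLaw_of_forall_isClosed_le [BorelSpace S] [MeasurableSpace.CountablyGenerated S]
    [IsProbabilityMeasure P] [IsProbabilityMeasure W]
    (h : ∀ F : Set S, IsClosed F → P (X ⁻¹' F) ≤ W F) :
    HasLaw X W P := by
  have hle := measure_preimage_le_of_forall_isClosed_le h
  have hX : AEMeasurable X P := by
    refine NullMeasurable.aemeasurable fun B hB =>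
      nullMeasurableSet_of_measure_add_measure_compl_le ?_
    calc P (X ⁻¹' B) + P (X ⁻¹' Bᶜ) ≤ W B + W Bᶜ := add_le_add (hle B) (hle Bᶜ)
      _ = P univ := by rw [measure_add_measure_compl hB, measure_univ, measure_univ]
  have : IsProbabilityMeasure (P.map X) := Measure.isProbabilityMeasure_map hX
  refine ⟨hX, Measure.eq_of_le_of_isProbabilityMeasure (Measure.le_iff.2 fun B hB => ?_)⟩
  rw [Measure.map_apply_of_aemeasurable hX hB]
  exact hle B

end OuterLaw

/-- A code `d` on a metric space whose cells `d ⁻¹' {j}` have diameter at most `ε`, with strict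
inequality for the distance of any two points. -/
def HasMesh {X : Type*} [PseudoMetricSpace X] (d : X → ℕ) (ε : ℝ) : Prop :=
  ∀ x y, d x = d y → dist x y < ε

theorem exists_measurable_hasMesh (X : Type*) [PseudoMetricSpace X] [SecondCountableTopology X]
    [Nonempty X] [MeasurableSpace X] [OpensMeasurableSpace X] {ε : ℝ} (hε : 0 < ε) :
    ∃ d : X → ℕ, Measurable d ∧ HasMesh d ε := by
  classical
  have hex : ∀ x : X, ∃ n, dist x (TopologicalSpace.denseSeq X n) < ε / 2 := fun x =>
    (TopologicalSpace.denseRange_denseSeq X).exists_dist_lt x (half_pos hε)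
  refine ⟨fun x => Nat.find (hex x), measurable_find _ fun n => ?_, fun x y hxy => ?_⟩
  · exact (isOpen_lt (continuous_id.dist continuous_const) continuous_const).measurableSet
  · have hx := Nat.find_spec (hex x)
    have hy := Nat.find_spec (hex y)
    simp only at hxy
    rw [← hxy] at hy
    linarith [dist_triangle_right x y (TopologicalSpace.denseSeq X (Nat.find (hex x)))]

theorem HasMesh.measure_preimage_singleton_lt_top {X : Type*} [PseudoMetricSpace X]
    [ProperSpace X] [MeasurableSpace X] {μ : Measure X} [IsLocallyFiniteMeasure μ] {d : X → ℕ}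
    {ε : ℝ} (hd : HasMesh d ε) (j : ℕ) : μ (d ⁻¹' {j}) < ∞ := by
  rcases (d ⁻¹' {j}).eq_empty_or_nonempty with h0 | ⟨x, hx⟩
  · simp [h0]
  · refine (measure_mono fun y hy => ?_).trans_lt
      (Metric.isBounded_closedBall (x := x) (r := ε)).measure_lt_top
    exact (hd y x (Eq.trans hy (Eq.symm hx))).le

theorem eventually_one_div_add_one_lt {ε : ℝ} (hε : 0 < ε) :
    ∀ᶠ m : ℕ in atTop, 1 / ((m : ℝ) + 1) < ε :=
  tendsto_one_div_add_atTop_nhds_zero_nat.eventually_lt_const hε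

/-! ### An upper bound of Mecke type -/

section Mecke

variable {Ω E M ι : Type*}

/-- The event that a finite path of customers in `A` is realised: there are distinct points `p i` of
`A` that, together with the marks `T i`, form an element of `K`, and `A` has no other points in the
section of `R` at that element. -/
def pathEvent (A : Ω → Set E) (T : ι → Ω → M) (K : Set (ι → M × E)) (R : Set ((ι → M × E) × E)) :
    Set Ω :=
  {ω | ∃ p : ι → E, (∀ i, p i ∈ A ω) ∧ Function.Injective p ∧ (fun i => (T i ω, p i)) ∈ K ∧
    ∀ q ∈ A ω, ((fun i => (T i ω, p i)), q) ∈ R → ∃ i, q = p i}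

/-- The cell of a marked path: the codes, under `d₁` and `d₂`, of its marks and of its points. -/
def gridCode (d₁ : M → ℕ) (d₂ : E → ℕ) (h : ι → M × E) : ι → ℕ × ℕ :=
  fun i => Prod.map d₁ d₂ (h i)

/-- The largest union of cells in `s` that avoids the points of all paths in the cell `c`, and lies
in the section of `R` at each of these paths. -/
def cellRegion (d₁ : M → ℕ) (d₂ : E → ℕ) (R : Set ((ι → M × E) × E)) (s : Set E)
    (c : ι → ℕ × ℕ) : Set E :=
  s ∩ d₂ ⁻¹' {j | (∀ i, j ≠ (c i).2) ∧
    ∀ h : ι → M × E, gridCode d₁ d₂ h = c → ∀ q, d₂ q = j → (h, q) ∈ R}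

/-- The event that every mark and some point of `A` is found in the respective part of the cell `c`,
while `A` has no points in `D`. -/
def cellEvent (A : Ω → Set E) (T : ι → Ω → M) (d₁ : M → ℕ) (d₂ : E → ℕ) (c : ι → ℕ × ℕ)
    (D : Set E) : Set Ω :=
  {ω | (∀ i, T i ω ∈ d₁ ⁻¹' {(c i).1}) ∧ (∀ i, (A ω ∩ d₂ ⁻¹' {(c i).2}).Nonempty) ∧
    A ω ∩ D = ∅}

variable {A : Ω → Set E} {T : ι → Ω → M} {d₁ : M → ℕ} {d₂ : E → ℕ} {K : Set (ι → M × E)}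
  {R : Set ((ι → M × E) × E)} {s : Set E} {c : ι → ℕ × ℕ} {h : ι → M × E} {q : E} {ε : ℝ}

theorem pathEvent_mono {K' : Set (ι → M × E)} (hK : K ⊆ K') :
    pathEvent A T K R ⊆ pathEvent A T K' R := by
  rintro ω ⟨p, hpA, hinj, hpK, hpR⟩
  exact ⟨p, hpA, hinj, hK hpK, hpR⟩

theorem gridCode_preimage_singleton (d₁ : M → ℕ) (d₂ : E → ℕ) (c : ι → ℕ × ℕ) :
    gridCode d₁ d₂ ⁻¹' {c} = univ.pi fun i => (d₁ ⁻¹' {(c i).1}) ×ˢ (d₂ ⁻¹' {(c i).2}) := by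
  ext h
  simp [gridCode, funext_iff, Prod.ext_iff, Set.mem_pi]

theorem mem_of_mem_cellRegion (hq : q ∈ cellRegion d₁ d₂ R s (gridCode d₁ d₂ h)) : (h, q) ∈ R :=
  hq.2.2 h rfl q rfl

theorem pathEvent_subset_iUnion_cellEvent (A : Ω → Set E) (T : ι → Ω → M) (d₁ : M → ℕ)
    (d₂ : E → ℕ) (K : Set (ι → M × E)) (R : Set ((ι → M × E) × E)) (s : Set E) :
    pathEvent A T K R ⊆
      ⋃ c ∈ gridCode d₁ d₂ '' K, cellEvent A T d₁ d₂ c (cellRegion d₁ d₂ R s c) := by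
  rintro ω ⟨p, hpA, -, hpK, hpR⟩
  refine mem_iUnion₂.2 ⟨_, mem_image_of_mem _ hpK, fun i => rfl, fun i => ⟨p i, hpA i, rfl⟩,
    eq_empty_of_forall_notMem fun q hq => ?_⟩
  obtain ⟨i, rfl⟩ := hpR q hq.1 (mem_of_mem_cellRegion hq.2)
  exact hq.2.2.1 i rfl

section Metric

variable [Fintype ι] [PseudoMetricSpace M] [PseudoMetricSpace E]

theorem dist_lt_of_gridCode_eq (hε : 0 < ε) (hd₁ : HasMesh d₁ ε) (hd₂ : HasMesh d₂ ε)
    {h h' : ι → M × E} (hh : gridCode d₁ d₂ h = gridCode d₁ d₂ h') : dist h h' < ε := by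
  refine (dist_pi_lt_iff hε).2 fun i => ?_
  obtain ⟨h₁, h₂⟩ := Prod.ext_iff.1 (congrFun hh i)
  rw [Prod.dist_eq]
  exact max_lt (hd₁ _ _ h₁) (hd₂ _ _ h₂)

theorem mem_cellRegion_of_ball_subset (hε : 0 < ε) (hd₁ : HasMesh d₁ ε) (hd₂ : HasMesh d₂ ε)
    (hball : Metric.ball (h, q) ε ⊆ R) (hqs : q ∈ s) (hsep : ∀ i, ε ≤ dist q (h i).2) :
    q ∈ cellRegion d₁ d₂ R s (gridCode d₁ d₂ h) := by
  refine ⟨hqs, fun i hi => (hd₂ _ _ hi).not_ge (hsep i), fun h' hh' q' hq' => hball ?_⟩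
  rw [Metric.mem_ball, Prod.dist_eq]
  exact max_lt (dist_lt_of_gridCode_eq hε hd₁ hd₂ hh') (hd₂ _ _ hq')

end Metric

variable [MeasurableSpace E]

/-- `e^{-x}` as a function on `[0, ∞]`, with the junk value `1` at `∞`. -/
noncomputable def expNeg (x : ℝ≥0∞) : ℝ≥0∞ := ENNReal.ofReal (Real.exp (-x.toReal))

theorem expNeg_le_one (x : ℝ≥0∞) : expNeg x ≤ 1 := by
  rw [expNeg, ENNReal.ofReal_le_one, Real.exp_le_one_iff]
  simp

theorem expNeg_le_inv {x : ℝ≥0∞} (hx : x ≠ ∞) : expNeg x ≤ x⁻¹ := by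
  rw [expNeg, Real.exp_neg, ENNReal.ofReal_inv_of_pos (Real.exp_pos _), ENNReal.inv_le_inv]
  refine (ENNReal.le_ofReal_iff_toReal_le hx (Real.exp_pos _).le).2 ?_
  linarith [Real.add_one_le_exp x.toReal]

theorem expNeg_add {x y : ℝ≥0∞} (hx : x ≠ ∞) (hy : y ≠ ∞) :
    expNeg (x + y) = expNeg x * expNeg y := by
  rw [expNeg, expNeg, expNeg, ← ENNReal.ofReal_mul (Real.exp_pos _).le, ← Real.exp_add,
    ENNReal.toReal_add hx hy, neg_add]

theorem one_sub_expNeg_le (x : ℝ≥0∞) : 1 - expNeg x ≤ x := by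
  induction x with
  | top => exact le_top
  | coe x =>
    rw [tsub_le_iff_right, expNeg, ENNReal.coe_toReal, ← ENNReal.ofReal_coe_nnreal,
      ← ENNReal.ofReal_add x.coe_nonneg (Real.exp_pos _).le, ENNReal.one_le_ofReal]
    linarith [Real.one_sub_le_exp_neg x]

theorem measurable_expNeg : Measurable expNeg := by
  unfold expNeg; fun_prop

theorem continuousAt_expNeg {x : ℝ≥0∞} (hx : x ≠ ∞) : ContinuousAt expNeg x :=
  (ENNReal.continuous_ofReal.comp Real.continuous_exp).continuousAt.comp
    (ENNReal.continuousAt_toReal hx).neg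

theorem measurableSet_cellRegion (hd₂ : Measurable d₂) (hs : MeasurableSet s) :
    MeasurableSet (cellRegion d₁ d₂ R s c) :=
  hs.inter (hd₂ .of_discrete)

/-- The cellwise approximation of `h ↦ e^{-μ (R_h)}`, where `R_h` is the section of `R` at `h`,
restricted to the cells that meet `K`. -/
noncomputable def cellBound (μ : Measure E) (d₁ : M → ℕ) (d₂ : E → ℕ) (K : Set (ι → M × E))
    (R : Set ((ι → M × E) × E)) (s : Set E) : (ι → ℕ × ℕ) → ℝ≥0∞ :=
  (gridCode d₁ d₂ '' K).indicator fun c => expNeg (μ (cellRegion d₁ d₂ R s c))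

theorem cellBound_le (μ : Measure E) :
    cellBound μ d₁ d₂ K R s (gridCode d₁ d₂ h) ≤ expNeg (μ (cellRegion d₁ d₂ R s
      (gridCode d₁ d₂ h))) :=
  indicator_le_self _ _ _

theorem cellBound_ne_zero [Fintype ι] [PseudoMetricSpace M] [PseudoMetricSpace E] (hε : 0 < ε)
    (hd₁ : HasMesh d₁ ε) (hd₂ : HasMesh d₂ ε) {μ : Measure E}
    (hh : cellBound μ d₁ d₂ K R s (gridCode d₁ d₂ h) ≠ 0) : ∃ h' ∈ K, dist h h' < ε := by
  obtain ⟨h', hh', heq⟩ := mem_of_indicator_ne_zero hh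
  exact ⟨h', hh', dist_lt_of_gridCode_eq hε hd₁ hd₂ heq.symm⟩

section Limit

variable [Finite ι] [PseudoMetricSpace M] [MetricSpace E] [BorelSpace E] {μ : Measure E}
  {d₁ : ℕ → M → ℕ} {d₂ : ℕ → E → ℕ}

theorem tendsto_measure_cellRegion [NullSingletonClass μ] (hd₂ : ∀ m, Measurable (d₂ m))
    (hd₁' : ∀ m, HasMesh (d₁ m) (1 / ((m : ℝ) + 1)))
    (hd₂' : ∀ m, HasMesh (d₂ m) (1 / ((m : ℝ) + 1)))
    (hR : IsOpen R) (hfin : μ {q | (h, q) ∈ R} ≠ ∞) (o : E) :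
    Tendsto (fun m : ℕ => μ (cellRegion (d₁ m) (d₂ m) R (Metric.closedBall o m)
      (gridCode (d₁ m) (d₂ m) h))) atTop (𝓝 (μ {q | (h, q) ∈ R})) := by
  cases nonempty_fintype ι
  have hRm : MeasurableSet {q | (h, q) ∈ R} :=
    (hR.preimage (by fun_prop : Continuous fun q : E => (h, q))).measurableSet
  refine tendsto_measure_of_ae_tendsto_indicator atTop hRm
    (fun m => measurableSet_cellRegion (hd₂ m) measurableSet_closedBall) hRm hfin
    (Eventually.of_forall fun m q hq => mem_of_mem_cellRegion hq) ?_
  have hne : ∀ᵐ q ∂μ, ∀ i, q ≠ (h i).2 := ae_all_iff.2 fun i => by simp [ae_iff]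
  filter_upwards [hne] with q hq
  by_cases hqR : (h, q) ∈ R
  · obtain ⟨ε, hε, hball⟩ := Metric.isOpen_iff.1 hR _ hqR
    have hfar : ∀ᶠ m : ℕ in atTop, ∀ i, 1 / ((m : ℝ) + 1) < dist q (h i).2 :=
      eventually_all.2 fun i => eventually_one_div_add_one_lt (dist_pos.2 (hq i))
    filter_upwards [eventually_one_div_add_one_lt hε, hfar,
      (tendsto_natCast_atTop_atTop (R := ℝ)).eventually_ge_atTop (dist q o)] with m hmε hmq hmo
    exact iff_of_true (mem_cellRegion_of_ball_subset (by positivity) (hd₁' m) (hd₂' m)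
      ((Metric.ball_subset_ball hmε.le).trans hball) hmo fun i => (hmq i).le) hqR
  · exact Eventually.of_forall fun m => iff_of_false (hqR ∘ mem_of_mem_cellRegion) hqR

theorem limsup_cellBound_le [NullSingletonClass μ] (hd₂ : ∀ m, Measurable (d₂ m))
    (hd₁' : ∀ m, HasMesh (d₁ m) (1 / ((m : ℝ) + 1)))
    (hd₂' : ∀ m, HasMesh (d₂ m) (1 / ((m : ℝ) + 1)))
    (hK : IsClosed K) (hR : IsOpen R) (hfin : ∀ h ∈ K, μ {q | (h, q) ∈ R} ≠ ∞) (o : E)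
    (h : ι → M × E) :
    limsup (fun m : ℕ => cellBound μ (d₁ m) (d₂ m) K R (Metric.closedBall o m)
      (gridCode (d₁ m) (d₂ m) h)) atTop ≤ K.indicator (fun h => expNeg (μ {q | (h, q) ∈ R})) h := by
  cases nonempty_fintype ι
  by_cases hh : h ∈ K
  · rw [indicator_of_mem hh]
    have ht := (continuousAt_expNeg (hfin h hh)).tendsto.comp
      (tendsto_measure_cellRegion hd₂ hd₁' hd₂' hR (hfin h hh) o)
    rw [← ht.limsup_eq]
    exact limsup_le_limsup (Eventually.of_forall fun m => cellBound_le μ)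
  · rw [indicator_of_notMem hh]
    obtain ⟨ε, hε, hball⟩ := Metric.isOpen_iff.1 hK.isOpen_compl h hh
    have hzero : (fun m : ℕ => cellBound μ (d₁ m) (d₂ m) K R (Metric.closedBall o m)
        (gridCode (d₁ m) (d₂ m) h)) =ᶠ[atTop] fun _ => 0 := by
      filter_upwards [eventually_one_div_add_one_lt hε] with m hm
      by_contra hne
      obtain ⟨h', hK', hd⟩ := cellBound_ne_zero (by positivity) (hd₁' m) (hd₂' m) hne
      exact hball (Metric.mem_ball'.2 (hd.trans hm)) hK'
    rw [limsup_congr hzero, limsup_const]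

end Limit

variable [MeasurableSpace Ω] [MeasurableSpace M]

theorem measurable_gridCode (hd₁ : Measurable d₁) (hd₂ : Measurable d₂) :
    Measurable (gridCode (ι := ι) d₁ d₂) :=
  measurable_pi_lambda _ fun i => (hd₁.prodMap hd₂).comp (measurable_pi_apply i)

/-- The property of a Poisson process `A` with intensity `μ`, and of independent marks `T i` with
law `τ`, on which the bound of Mecke type rests: the probability that all the disjoint sets `C i`
are hit and `D` is not, while the marks lie in `J i`, is at most `∏ τ (J i) μ (C i) * e^{-μ D}`. -/
def HasHitBound (A : Ω → Set E) (T : ι → Ω → M) [Fintype ι] (τ : Measure M) (μ : Measure E)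
    (P : Measure Ω) : Prop :=
  ∀ (J : ι → Set M) (C : ι → Set E) (D : Set E), (∀ i, MeasurableSet (J i)) →
    (∀ i, MeasurableSet (C i)) → MeasurableSet D → (∀ i, μ (C i) ≠ ∞) → μ D ≠ ∞ →
    Pairwise (fun i j => Disjoint (C i) (C j)) → (∀ i, Disjoint (C i) D) →
    P {ω | (∀ i, T i ω ∈ J i) ∧ (∀ i, (A ω ∩ C i).Nonempty) ∧ A ω ∩ D = ∅} ≤
      (∏ i, τ (J i) * μ (C i)) * expNeg (μ D)

section FiniteMesh

variable [Fintype ι] [PseudoMetricSpace M] [PseudoMetricSpace E]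

theorem HasHitBound.measure_cellEvent_le [ProperSpace M] [ProperSpace E]
    {τ : Measure M} [IsLocallyFiniteMeasure τ] {μ : Measure E} [IsLocallyFiniteMeasure μ]
    {P : Measure Ω} (hA : HasHitBound A T τ μ P) (hd₁ : Measurable d₁) (hd₂ : Measurable d₂)
    (hmesh : HasMesh d₂ ε) (hsep : Pairwise fun i j => ε ≤ dist (h i).2 (h j).2)
    (hs : MeasurableSet s) (hsμ : μ s ≠ ∞) :
    P (cellEvent A T d₁ d₂ (gridCode d₁ d₂ h) (cellRegion d₁ d₂ R s (gridCode d₁ d₂ h))) ≤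
      expNeg (μ (cellRegion d₁ d₂ R s (gridCode d₁ d₂ h))) *
        (Measure.pi fun _ : ι => τ.prod μ) (gridCode d₁ d₂ ⁻¹' {gridCode d₁ d₂ h}) := by
  rw [gridCode_preimage_singleton, Measure.pi_pi, mul_comm]
  simp_rw [Measure.prod_prod]
  refine hA _ _ _ (fun i => hd₁ (measurableSet_singleton _))
    (fun i => hd₂ (measurableSet_singleton _)) (measurableSet_cellRegion hd₂ hs)
    (fun i => (hmesh.measure_preimage_singleton_lt_top _).ne)
    (measure_ne_top_of_subset inter_subset_left hsμ) (fun i j hij => ?_) fun i => ?_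
  · refine disjoint_left.2 fun x hx hx' => (hmesh _ _ ?_).not_ge (hsep hij)
    exact Eq.trans (Eq.symm hx) hx'
  · exact disjoint_left.2 fun x hx hx' => hx'.2.1 i hx

theorem HasHitBound.measure_pathEvent_le_lintegral_cellBound [ProperSpace M] [ProperSpace E]
    {τ : Measure M} [IsLocallyFiniteMeasure τ] {μ : Measure E} [IsLocallyFiniteMeasure μ]
    {P : Measure Ω} (hA : HasHitBound A T τ μ P) (hd₁ : Measurable d₁) (hd₂ : Measurable d₂)
    (hmesh : HasMesh d₂ ε)
    (hK : ∀ h ∈ K, Pairwise fun i j => ε ≤ dist (h i).2 (h j).2) (R : Set ((ι → M × E) × E))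
    (hs : MeasurableSet s) (hsμ : μ s ≠ ∞) :
    P (pathEvent A T K R) ≤
      ∫⁻ h, cellBound μ d₁ d₂ K R s (gridCode d₁ d₂ h) ∂(Measure.pi fun _ : ι => τ.prod μ) := by
  classical
  let G := gridCode d₁ d₂ '' K
  let D := cellRegion d₁ d₂ R s
  let ϑ := Measure.pi fun _ : ι => τ.prod μ
  have hcode := measurable_gridCode (ι := ι) hd₁ hd₂
  calc P (pathEvent A T K R) ≤ P (⋃ c ∈ G, cellEvent A T d₁ d₂ c (D c)) :=
        measure_mono (pathEvent_subset_iUnion_cellEvent A T d₁ d₂ K R s)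
    _ ≤ ∑' c : G, P (cellEvent A T d₁ d₂ c (D c)) := measure_biUnion_le _ (to_countable G) _
    _ = ∑' c, G.indicator (fun c => P (cellEvent A T d₁ d₂ c (D c))) c :=
        tsum_subtype G fun c => P (cellEvent A T d₁ d₂ c (D c))
    _ ≤ ∑' c, cellBound μ d₁ d₂ K R s c * ϑ (gridCode d₁ d₂ ⁻¹' {c}) := by
        refine ENNReal.tsum_le_tsum fun c => indicator_apply_le' ?_ fun _ => zero_le
        rintro ⟨h, hh, rfl⟩
        rw [cellBound, indicator_of_mem (mem_image_of_mem _ hh)]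
        exact hA.measure_cellEvent_le hd₁ hd₂ hmesh (hK h hh) hs hsμ
    _ = ∫⁻ c, cellBound μ d₁ d₂ K R s c ∂(ϑ.map (gridCode d₁ d₂)) := by
        rw [lintegral_countable']
        exact tsum_congr fun c => by rw [Measure.map_apply hcode (measurableSet_singleton c)]
    _ = ∫⁻ h, cellBound μ d₁ d₂ K R s (gridCode d₁ d₂ h) ∂ϑ := lintegral_map .of_discrete hcode

end FiniteMesh

variable [Fintype ι] [PseudoMetricSpace M] [BorelSpace M] [ProperSpace M] [Nonempty M]
  [MetricSpace E] [BorelSpace E] [ProperSpace E] [Nonempty E] {P : Measure Ω} {τ : Measure M}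
  [IsLocallyFiniteMeasure τ] {μ : Measure E} [IsLocallyFiniteMeasure μ] [NullSingletonClass μ]

theorem HasHitBound.measure_pathEvent_le_of_isBounded (hA : HasHitBound A T τ μ P)
    (hKc : IsClosed K) (hKb : Bornology.IsBounded K) {δ : ℝ} (hδ : 0 < δ)
    (hK : ∀ h ∈ K, Pairwise fun i j => δ ≤ dist (h i).2 (h j).2)
    (hR : IsOpen R) (hfin : ∀ h ∈ K, μ {q | (h, q) ∈ R} ≠ ∞) :
    P (pathEvent A T K R) ≤
      ∫⁻ h in K, expNeg (μ {q | (h, q) ∈ R}) ∂(Measure.pi fun _ : ι => τ.prod μ) := by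
  have hpos : ∀ m : ℕ, (0 : ℝ) < 1 / ((m : ℝ) + 1) := fun m => by positivity
  choose d₁ hd₁ hd₁' using fun m : ℕ => exists_measurable_hasMesh M (hpos m)
  choose d₂ hd₂ hd₂' using fun m : ℕ => exists_measurable_hasMesh E (hpos m)
  obtain ⟨o⟩ := id ‹Nonempty E›
  let ϑ := Measure.pi fun _ : ι => τ.prod μ
  let g : ℕ → (ι → M × E) → ℝ≥0∞ := fun m h =>
    cellBound μ (d₁ m) (d₂ m) K R (Metric.closedBall o m) (gridCode (d₁ m) (d₂ m) h)
  have hev : ∀ᶠ m : ℕ in atTop, P (pathEvent A T K R) ≤ ∫⁻ h, g m h ∂ϑ := by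
    filter_upwards [eventually_one_div_add_one_lt hδ] with m hm
    exact hA.measure_pathEvent_le_lintegral_cellBound (hd₁ m) (hd₂ m) (hd₂' m)
      (fun h hh i j hij => hm.le.trans (hK h hh hij)) R measurableSet_closedBall
      Metric.isBounded_closedBall.measure_lt_top.ne
  have hmeas : ∀ m, Measurable (g m) := fun m =>
    Measurable.of_discrete.comp (measurable_gridCode (hd₁ m) (hd₂ m))
  have hdom : ∀ m, g m ≤ᵐ[ϑ] (Metric.cthickening 1 K).indicator 1 := fun m =>
    Eventually.of_forall fun h => by
      by_cases hh : g m h = 0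
      · exact hh.trans_le zero_le
      · obtain ⟨h', hK', hd⟩ := cellBound_ne_zero (hpos m) (hd₁' m) (hd₂' m) hh
        have hm : 1 / ((m : ℝ) + 1) ≤ 1 :=
          div_le_one_of_le₀ (by linarith [m.cast_nonneg (α := ℝ)]) (by positivity)
        rw [indicator_of_mem (Metric.mem_cthickening_of_dist_le h h' 1 K hK' (hd.le.trans hm))]
        exact (cellBound_le μ).trans (expNeg_le_one _)
  have hfinite : ∫⁻ h, (Metric.cthickening 1 K).indicator 1 h ∂ϑ ≠ ∞ := by
    rw [lintegral_indicator_one Metric.isClosed_cthickening.measurableSet]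
    exact hKb.cthickening.measure_lt_top.ne
  calc P (pathEvent A T K R) ≤ limsup (fun m => ∫⁻ h, g m h ∂ϑ) atTop :=
        le_limsup_of_frequently_le hev.frequently
    _ ≤ ∫⁻ h, limsup (fun m => g m h) atTop ∂ϑ := limsup_lintegral_le _ hmeas hdom hfinite
    _ ≤ ∫⁻ h, K.indicator (fun h => expNeg (μ {q | (h, q) ∈ R})) h ∂ϑ :=
        lintegral_mono fun h => limsup_cellBound_le hd₂ hd₁' hd₂' hKc hR hfin o h
    _ = ∫⁻ h in K, expNeg (μ {q | (h, q) ∈ R}) ∂ϑ := lintegral_indicator hKc.measurableSet _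

theorem HasHitBound.measure_pathEvent_le (hA : HasHitBound A T τ μ P) (hKc : IsClosed K)
    (hR : IsOpen R) (hfin : ∀ h ∈ K, μ {q | (h, q) ∈ R} ≠ ∞) :
    P (pathEvent A T K R) ≤
      ∫⁻ h in K, expNeg (μ {q | (h, q) ∈ R}) ∂(Measure.pi fun _ : ι => τ.prod μ) := by
  obtain ⟨o⟩ : Nonempty (ι → M × E) := inferInstance
  let K' : ℕ → Set (ι → M × E) := fun m => K ∩ Metric.closedBall o m ∩
    {h | Pairwise fun i j => 1 / ((m : ℝ) + 1) ≤ dist (h i).2 (h j).2}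
  have hmono : Monotone K' := by
    intro m m' hm h hh
    have hm' : (m : ℝ) ≤ m' := Nat.cast_le.2 hm
    refine ⟨⟨hh.1.1, Metric.closedBall_subset_closedBall hm' hh.1.2⟩, fun i j hij => ?_⟩
    exact (one_div_le_one_div_of_le (by positivity) (by linarith)).trans (hh.2 hij)
  have hclosed : ∀ m, IsClosed (K' m) := fun m => by
    refine (hKc.inter Metric.isClosed_closedBall).inter ?_
    simp only [Pairwise, ofPred_forall]
    refine isClosed_iInter fun i => isClosed_iInter fun j => isClosed_iInter fun _ => ?_
    exact isClosed_le continuous_const (by fun_prop)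
  have hcover : pathEvent A T K R ⊆ ⋃ m, pathEvent A T (K' m) R := by
    rintro ω ⟨p, hpA, hinj, hpK, hpR⟩
    have hsep : ∀ᶠ m : ℕ in atTop, ∀ i j, i ≠ j → 1 / ((m : ℝ) + 1) ≤ dist (p i) (p j) := by
      refine eventually_all.2 fun i => eventually_all.2 fun j => eventually_imp_distrib_left.2 ?_
      exact fun hij => (eventually_one_div_add_one_lt (dist_pos.2 (hinj.ne hij))).mono
        fun m hm => hm.le
    obtain ⟨m, hm₁, hm₂⟩ := (((tendsto_natCast_atTop_atTop (R := ℝ)).eventually_ge_atTop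
      (dist (fun i => (T i ω, p i)) o)).and hsep).exists
    exact mem_iUnion.2 ⟨m, p, hpA, hinj, ⟨⟨hpK, hm₁⟩, hm₂⟩, hpR⟩
  refine (measure_mono hcover).trans ?_
  rw [Monotone.measure_iUnion fun m m' hm => pathEvent_mono (hmono hm)]
  refine iSup_le fun m => (hA.measure_pathEvent_le_of_isBounded (hclosed m)
    (Metric.isBounded_closedBall.subset (inter_subset_left.trans inter_subset_right))
    (δ := 1 / ((m : ℝ) + 1)) (by positivity) (fun h hh => hh.2) hR
    fun h hh => hfin h hh.1.1).trans ?_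
  exact lintegral_mono_set (inter_subset_left.trans inter_subset_left)

end Mecke

/-! ### Poisson processes -/

section Independence

theorem iIndepFun_prodMk {Ω ι α β : Type*} [Finite ι] [MeasurableSpace Ω] [MeasurableSpace α]
    [MeasurableSpace β] {P : Measure Ω} {X : ι → Ω → α} {Y : ι → Ω → β}
    (hXm : ∀ i, Measurable (X i)) (hYm : ∀ i, Measurable (Y i))
    (hX : iIndepFun X P) (hY : iIndepFun Y P)
    (hXY : IndepFun (fun ω i => X i ω) (fun ω i => Y i ω) P) :
    iIndepFun (fun i ω => (X i ω, Y i ω)) P := by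
  have := Fintype.ofFinite ι
  have := hX.isProbabilityMeasure
  have _ (i : ι) : IsProbabilityMeasure (P.map (X i)) :=
    Measure.isProbabilityMeasure_map (hXm i).aemeasurable
  have _ (i : ι) : IsProbabilityMeasure (P.map (Y i)) :=
    Measure.isProbabilityMeasure_map (hYm i).aemeasurable
  have hpair (i : ι) : P.map (fun ω => (X i ω, Y i ω)) = (P.map (X i)).prod (P.map (Y i)) :=
    (hXY.comp (measurable_pi_apply i) (measurable_pi_apply i)).map_prod_eq_prod_map_map
      (hXm i).aemeasurable (hYm i).aemeasurable
  have hequiv := measurePreserving_arrowProdEquivProdArrow α β ι (fun i => P.map (X i))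
    (fun i => P.map (Y i))
  rw [iIndepFun_iff_map_fun_eq_pi_map (fun i => ((hXm i).prodMk (hYm i)).aemeasurable)]
  simp_rw [hpair]
  rw [← (MeasurableEquiv.arrowProdEquivProdArrow α β ι).map_measurableEquiv_injective.eq_iff,
    hequiv.map_eq, ← hX.map_fun_eq_pi_map fun i => (hXm i).aemeasurable,
    ← hY.map_fun_eq_pi_map fun i => (hYm i).aemeasurable,
    ← hXY.map_prod_eq_prod_map_map (measurable_pi_lambda _ hXm).aemeasurable
      (measurable_pi_lambda _ hYm).aemeasurable,
    Measure.map_map (MeasurableEquiv.measurable _)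
      (measurable_pi_lambda _ fun i => (hXm i).prodMk (hYm i))]
  rfl

theorem indep_sup_of_iIndep {Ω : Type*} {m₁ m₂ m₃ : MeasurableSpace Ω} [MeasurableSpace Ω]
    {P : Measure Ω} (h₁ : m₁ ≤ ‹_›) (h₂ : m₂ ≤ ‹_›) (h₃ : m₃ ≤ ‹_›)
    (h : iIndep ![m₁, m₂, m₃] P) : Indep (m₁ ⊔ m₂) m₃ P := by
  have hle : ∀ i, ![m₁, m₂, m₃] i ≤ ‹MeasurableSpace Ω› := fun i => by
    fin_cases i
    exacts [h₁, h₂, h₃]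
  have hsup := indep_iSup_of_disjoint hle h (S := {0, 1}) (T := {2}) (by simp)
  rwa [iSup_pair, iSup_singleton] at hsup

end Independence

section Counts

variable {Ω E : Type*} {ξ : Ω → Set E}

theorem count_eq_zero_iff {B : Set E} {ω : Ω} : count ξ B ω = 0 ↔ ξ ω ∩ B = ∅ := by
  rw [count, encard_eq_zero]

variable [MeasurableSpace E]

theorem measurable_count_pointSigma {B : Set E} (hB : MeasurableSet B) :
    Measurable[pointSigma ξ] (count ξ B) := by
  intro s _
  exact (le_iSup (fun B : {B : Set E // MeasurableSet B} =>
    MeasurableSpace.comap (count ξ B.1) ⊤) ⟨B, hB⟩) _ ⟨s, trivial, rfl⟩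

theorem measurable_pi_count_pointSigma {ι : Type*} {B : ι → Set E}
    (hB : ∀ i, MeasurableSet (B i)) : Measurable[pointSigma ξ] fun ω i => count ξ (B i) ω :=
  @measurable_pi_lambda _ _ _ (pointSigma ξ) _ _ fun i => measurable_count_pointSigma (hB i)

namespace IsPoissonProcess

variable [MeasurableSpace Ω] {μ : Measure E} {P : Measure Ω}

theorem pointSigma_le (h : IsPoissonProcess ξ μ P) : pointSigma ξ ≤ ‹MeasurableSpace Ω› := by
  refine iSup_le fun B => ?_
  rintro _ ⟨s, -, rfl⟩
  exact h.measurable_count B.1 B.2 .of_discrete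

variable {B : Set E}

theorem measure_count_eq_zero (h : IsPoissonProcess ξ μ P) (hB : MeasurableSet B)
    (hfin : μ B ≠ ∞) : P {ω | count ξ B ω = 0} = expNeg (μ B) := by
  have hzero : (fun n : ℕ => (n : ℕ∞)) ⁻¹' {0} = {0} := by ext n; simp
  calc P {ω | count ξ B ω = 0} = P.map (count ξ B) {0} :=
        (Measure.map_apply (h.measurable_count B hB) (measurableSet_singleton _)).symm
    _ = expNeg (μ B) := by
        rw [h.law_count B hB hfin.lt_top,
          Measure.map_apply .of_discrete (measurableSet_singleton _), hzero,
          poissonMeasure_singleton, expNeg]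
        simp [ENNReal.coe_toNNReal_eq_toReal]

theorem ae_inter_eq_empty [IsProbabilityMeasure P] (h : IsPoissonProcess ξ μ P)
    (hB : MeasurableSet B) (h0 : μ B = 0) : ∀ᵐ ω ∂P, ξ ω ∩ B = ∅ := by
  have hm : MeasurableSet {ω | count ξ B ω = 0} :=
    h.measurable_count B hB (measurableSet_singleton 0)
  simp_rw [← count_eq_zero_iff]
  refine (prob_compl_eq_zero_iff hm).2 ?_
  rw [h.measure_count_eq_zero hB (by simp [h0]), h0]
  simp [expNeg]

theorem ae_finite_inter (h : IsPoissonProcess ξ μ P) (hB : MeasurableSet B) (hfin : μ B ≠ ∞) :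
    ∀ᵐ ω ∂P, (ξ ω ∩ B).Finite := by
  have htop : P (count ξ B ⁻¹' {⊤}) = 0 := by
    rw [← Measure.map_apply (h.measurable_count B hB) (measurableSet_singleton _),
      h.law_count B hB hfin.lt_top, Measure.map_apply .of_discrete (measurableSet_singleton _)]
    have hempty : (fun n : ℕ => (n : ℕ∞)) ⁻¹' {⊤} = ∅ := by ext n; simp
    rw [hempty, measure_empty]
  filter_upwards [measure_eq_zero_iff_ae_notMem.1 htop] with ω hω
  rwa [mem_preimage, mem_singleton_iff, count, encard_eq_top_iff, not_infinite] at hω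

theorem ae_inter_nonempty [SigmaFinite μ] (h : IsPoissonProcess ξ μ P) (hB : MeasurableSet B)
    (htop : μ B = ∞) : ∀ᵐ ω ∂P, (ξ ω ∩ B).Nonempty := by
  have hmeas (n : ℕ) : MeasurableSet (B ∩ spanningSets μ n) :=
    hB.inter (measurableSet_spanningSets μ n)
  have hfin (n : ℕ) : μ (B ∩ spanningSets μ n) ≠ ∞ :=
    measure_ne_top_of_subset inter_subset_right (measure_spanningSets_lt_top μ n).ne
  have hbound (n : ℕ) : P {ω | ¬ (ξ ω ∩ B).Nonempty} ≤ (μ (B ∩ spanningSets μ n))⁻¹ :=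
    calc P {ω | ¬ (ξ ω ∩ B).Nonempty} ≤ P {ω | count ξ (B ∩ spanningSets μ n) ω = 0} := by
          refine measure_mono fun ω hω => count_eq_zero_iff.2 ?_
          rw [← inter_assoc, not_nonempty_iff_eq_empty.1 hω, empty_inter]
      _ = expNeg (μ (B ∩ spanningSets μ n)) := h.measure_count_eq_zero (hmeas n) (hfin n)
      _ ≤ (μ (B ∩ spanningSets μ n))⁻¹ := expNeg_le_inv (hfin n)
  have hlim : Tendsto (fun n => (μ (B ∩ spanningSets μ n))⁻¹) atTop (𝓝 0) := by
    have hmono : Monotone fun n => B ∩ spanningSets μ n := fun m n hmn =>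
      inter_subset_inter_right B (monotone_spanningSets μ hmn)
    have h := (tendsto_measure_iUnion_atTop (μ := μ) hmono).inv
    rwa [← inter_iUnion, iUnion_spanningSets, inter_univ, htop, ENNReal.inv_top] at h
  exact le_antisymm (ge_of_tendsto' hlim hbound) bot_le

variable {F : Type*} [MeasurableSpace F] {η : Ω → Set F}

theorem indepFun_count (h : Indep (pointSigma ξ) (pointSigma η) P) {ι : Type*} {B : ι → Set E}
    {C : ι → Set F} (hB : ∀ i, MeasurableSet (B i)) (hC : ∀ i, MeasurableSet (C i)) :
    IndepFun (fun ω i => count ξ (B i) ω) (fun ω i => count η (C i) ω) P :=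
  (IndepFun_iff_Indep _ _ _).2 <|
    indep_of_indep_of_le_left
      (indep_of_indep_of_le_right h (measurable_pi_count_pointSigma hC).comap_le)
      (measurable_pi_count_pointSigma hB).comap_le

end IsPoissonProcess

end Counts

/-! ### The customers as a Poisson process -/

section Customers

/-- The customers, with the arrival time of those present at time `0` replaced by `-1`: this keeps
them apart from the later arrivals, whose times are positive. -/
def flaggedCustomers (init : Set ℝ) (arr : Set (ℝ × ℝ)) : Set (ℝ × ℝ) :=
  (fun x : ℝ => (x, (-1 : ℝ))) '' init ∪ (arr ∩ {p | 0 < p.2})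

/-- The intensity measure of the flagged customers: `μ₀` at height `-1`, and Lebesgue measure on
the upper half plane. -/
noncomputable def intensity (μ₀ : Measure ℝ) : Measure (ℝ × ℝ) :=
  μ₀.map (fun x => (x, (-1 : ℝ))) + (volume : Measure (ℝ × ℝ)).restrict {p | 0 < p.2}

theorem measurableSet_snd_pos : MeasurableSet {p : ℝ × ℝ | 0 < p.2} :=
  measurableSet_lt measurable_const measurable_snd

theorem measurableSet_preimage_prodMk_neg_one {B : Set (ℝ × ℝ)} (hB : MeasurableSet B) :
    MeasurableSet ((fun x : ℝ => (x, (-1 : ℝ))) ⁻¹' B) :=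
  (by fun_prop : Measurable fun x : ℝ => (x, (-1 : ℝ))) hB

theorem intensity_apply (μ₀ : Measure ℝ) {B : Set (ℝ × ℝ)} (hB : MeasurableSet B) :
    intensity μ₀ B = μ₀ ((fun x => (x, (-1 : ℝ))) ⁻¹' B) + volume (B ∩ {p | 0 < p.2}) := by
  rw [intensity, Measure.add_apply, Measure.map_apply (by fun_prop) hB, Measure.restrict_apply hB]

theorem flaggedCustomers_inter_eq_empty_iff {init : Set ℝ} {arr B : Set (ℝ × ℝ)} :
    flaggedCustomers init arr ∩ B = ∅ ↔ init ∩ (fun x => (x, (-1 : ℝ))) ⁻¹' B = ∅ ∧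
      arr ∩ (B ∩ {p | 0 < p.2}) = ∅ := by
  rw [flaggedCustomers, union_inter_distrib_right, union_empty_iff, ← image_inter_preimage,
    image_eq_empty, inter_assoc, inter_comm {p : ℝ × ℝ | 0 < p.2}]

variable {Ω : Type*} {init : Ω → Set ℝ} {arr : Ω → Set (ℝ × ℝ)} {μ₀ : Measure ℝ}
  {B : Set (ℝ × ℝ)}

theorem setOf_flaggedCustomers_inter_eq_empty (init : Ω → Set ℝ) (arr : Ω → Set (ℝ × ℝ))
    (B : Set (ℝ × ℝ)) :
    {ω | flaggedCustomers (init ω) (arr ω) ∩ B = ∅} =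
      {ω | count init ((fun x : ℝ => (x, (-1 : ℝ))) ⁻¹' B) ω = 0} ∩
        {ω | count arr (B ∩ {p | 0 < p.2}) ω = 0} := by
  ext ω
  simp only [flaggedCustomers_inter_eq_empty_iff, mem_inter_iff, mem_ofPred_eq, count_eq_zero_iff]

theorem measurableSet_flaggedCustomers_inter_eq_empty (init : Ω → Set ℝ)
    (arr : Ω → Set (ℝ × ℝ)) (hB : MeasurableSet B) :
    MeasurableSet[pointSigma init ⊔ pointSigma arr]
      {ω | flaggedCustomers (init ω) (arr ω) ∩ B = ∅} := by
  rw [setOf_flaggedCustomers_inter_eq_empty]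
  exact (le_sup_left (a := pointSigma init) _
      (measurable_count_pointSigma (measurableSet_preimage_prodMk_neg_one hB)
        (measurableSet_singleton 0))).inter
    (le_sup_right (b := pointSigma arr) _
      (measurable_count_pointSigma (hB.inter measurableSet_snd_pos) (measurableSet_singleton 0)))

variable [MeasurableSpace Ω] {P : Measure Ω}

theorem measure_flaggedCustomers_inter_eq_empty (h_init : IsPoissonProcess init μ₀ P)
    (h_arr : IsPoissonProcess arr ((volume : Measure (ℝ × ℝ)).restrict {p | 0 < p.2}) P)
    (h_ia : Indep (pointSigma init) (pointSigma arr) P) (hB : MeasurableSet B)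
    (hfin : intensity μ₀ B ≠ ∞) :
    P {ω | flaggedCustomers (init ω) (arr ω) ∩ B = ∅} = expNeg (intensity μ₀ B) := by
  have hB₁ := measurableSet_preimage_prodMk_neg_one hB
  have hB₂ := hB.inter measurableSet_snd_pos
  have hvol : (volume : Measure (ℝ × ℝ)).restrict {p | 0 < p.2} (B ∩ {p | 0 < p.2}) =
      volume (B ∩ {p | 0 < p.2}) := by rw [Measure.restrict_apply hB₂, inter_assoc, inter_self]
  rw [intensity_apply _ hB] at hfin ⊢
  obtain ⟨hfin₁, hfin₂⟩ := ENNReal.add_ne_top.1 hfin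
  rw [setOf_flaggedCustomers_inter_eq_empty, (Indep_iff _ _ P).1 h_ia {ω | _ = 0} {ω | _ = 0}
      (measurable_count_pointSigma hB₁ (measurableSet_singleton 0))
      (measurable_count_pointSigma hB₂ (measurableSet_singleton 0)),
    expNeg_add hfin₁ hfin₂, h_init.measure_count_eq_zero hB₁ hfin₁,
    h_arr.measure_count_eq_zero hB₂ (hvol.trans_ne hfin₂), hvol]

theorem measure_flaggedCustomers_inter_nonempty_le [IsProbabilityMeasure P]
    (h_init : IsPoissonProcess init μ₀ P)
    (h_arr : IsPoissonProcess arr ((volume : Measure (ℝ × ℝ)).restrict {p | 0 < p.2}) P)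
    (h_ia : Indep (pointSigma init) (pointSigma arr) P) (hB : MeasurableSet B) :
    P {ω | flaggedCustomers (init ω) (arr ω) ∩ B = ∅}ᶜ ≤ intensity μ₀ B := by
  by_cases hfin : intensity μ₀ B = ∞
  · exact hfin ▸ le_top
  have hm := sup_le h_init.pointSigma_le h_arr.pointSigma_le _
    (measurableSet_flaggedCustomers_inter_eq_empty init arr hB)
  rw [prob_compl_eq_one_sub hm, measure_flaggedCustomers_inter_eq_empty h_init h_arr h_ia hB hfin]
  exact one_sub_expNeg_le _

theorem iIndepSet_flaggedCustomers_inter_eq_empty (h_init : IsPoissonProcess init μ₀ P)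
    (h_arr : IsPoissonProcess arr ((volume : Measure (ℝ × ℝ)).restrict {p | 0 < p.2}) P)
    (h_ia : Indep (pointSigma init) (pointSigma arr) P) {n : ℕ} {B : Fin n → Set (ℝ × ℝ)}
    (hB : ∀ i, MeasurableSet (B i)) (hBB : Pairwise fun i j => Disjoint (B i) (B j)) :
    iIndepSet (fun i => {ω | flaggedCustomers (init ω) (arr ω) ∩ B i = ∅}) P := by
  have hB₁ := fun i => measurableSet_preimage_prodMk_neg_one (hB i)
  have hB₂ := fun i => (hB i).inter measurableSet_snd_pos
  have hpair := iIndepFun_prodMk (fun i => h_init.measurable_count _ (hB₁ i))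
    (fun i => h_arr.measurable_count _ (hB₂ i))
    (h_init.indep_count _ _ hB₁ fun i j hij => (hBB hij).preimage _)
    (h_arr.indep_count _ _ hB₂ fun i j hij => (hBB hij).mono inter_subset_left inter_subset_left)
    (IsPoissonProcess.indepFun_count h_ia hB₁ hB₂)
  refine (iIndepSet_iff_iIndep _ _).2 (iIndep_of_iIndep_of_le hpair fun i =>
    MeasurableSpace.generateFrom_le ?_)
  rintro _ rfl
  refine ⟨{(0, 0)}, .of_discrete, ?_⟩
  rw [setOf_flaggedCustomers_inter_eq_empty]
  ext ω
  simp

theorem measure_flaggedCustomers_hit_le [IsProbabilityMeasure P]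
    (h_init : IsPoissonProcess init μ₀ P)
    (h_arr : IsPoissonProcess arr ((volume : Measure (ℝ × ℝ)).restrict {p | 0 < p.2}) P)
    (h_ia : Indep (pointSigma init) (pointSigma arr) P) {n : ℕ} {C : Fin n → Set (ℝ × ℝ)}
    {D : Set (ℝ × ℝ)} (hC : ∀ i, MeasurableSet (C i)) (hD : MeasurableSet D)
    (hDfin : intensity μ₀ D ≠ ∞) (hCC : Pairwise fun i j => Disjoint (C i) (C j))
    (hCD : ∀ i, Disjoint (C i) D) :
    P ((⋂ i, {ω | flaggedCustomers (init ω) (arr ω) ∩ C i = ∅}ᶜ) ∩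
        {ω | flaggedCustomers (init ω) (arr ω) ∩ D = ∅}) ≤
      (∏ i, intensity μ₀ (C i)) * expNeg (intensity μ₀ D) := by
  let V : Set (ℝ × ℝ) → Set Ω := fun B => {ω | flaggedCustomers (init ω) (arr ω) ∩ B = ∅}
  let B : Fin (n + 1) → Set (ℝ × ℝ) := Fin.cons D C
  have hBB : Pairwise fun i j => Disjoint (B i) (B j) := by
    intro i j hij
    cases i using Fin.cases with
    | zero =>
      obtain ⟨j, rfl⟩ := Fin.exists_succ_eq.2 hij.symm
      exact (hCD j).symm
    | succ i =>
      cases j using Fin.cases with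
      | zero => exact hCD i
      | succ j => exact hCC fun h => hij (congrArg _ h)
  have hind := iIndepSet_flaggedCustomers_inter_eq_empty h_init h_arr h_ia
    (fun i => Fin.cases hD hC i) hBB
  let W : Fin (n + 1) → Set Ω := Fin.cons (V D) fun i => (V (C i))ᶜ
  have hW (i : Fin (n + 1)) :
      MeasurableSet[MeasurableSpace.generateFrom {V (B i)}] (W i) := by
    cases i using Fin.cases with
    | zero => exact .basic _ rfl
    | succ i => exact (MeasurableSpace.measurableSet_generateFrom (mem_singleton (V (C i)))).compl
  calc P ((⋂ i, (V (C i))ᶜ) ∩ V D) = P (⋂ i, W i) := by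
        congr 1
        ext ω
        simp only [mem_inter_iff, mem_iInter, Fin.forall_fin_succ, W, Fin.cons_zero, Fin.cons_succ]
        exact and_comm
    _ = P (V D) * ∏ i, P (V (C i))ᶜ := by
        rw [((iIndepSet_iff_iIndep _ _).1 hind).meas_iInter hW, Fin.prod_univ_succ]
        rfl
    _ ≤ expNeg (intensity μ₀ D) * ∏ i, intensity μ₀ (C i) := by
        refine mul_le_mul' (measure_flaggedCustomers_inter_eq_empty h_init h_arr h_ia hD hDfin).le
          (Finset.prod_le_prod' fun i _ => ?_)
        exact measure_flaggedCustomers_inter_nonempty_le h_init h_arr h_ia (hC i)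
    _ = (∏ i, intensity μ₀ (C i)) * expNeg (intensity μ₀ D) := mul_comm _ _

theorem hasHitBound_flaggedCustomers [IsProbabilityMeasure P] {T : ℕ → Ω → ℝ} {τ : Measure ℝ}
    (h_init : IsPoissonProcess init μ₀ P)
    (h_arr : IsPoissonProcess arr ((volume : Measure (ℝ × ℝ)).restrict {p | 0 < p.2}) P)
    (hT_meas : ∀ n, Measurable (T n)) (hT_law : ∀ n, HasLaw (T n) τ P) (hT_indep : iIndepFun T P)
    (h_indep : iIndep ![pointSigma init, pointSigma arr,
      ⨆ n, MeasurableSpace.comap (T n) inferInstance] P) (n : ℕ) :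
    HasHitBound (fun ω => flaggedCustomers (init ω) (arr ω)) (fun i : Fin n => T i) τ
      (intensity μ₀) P := by
  intro J C D hJ hC hD _ hDfin hCC hCD
  let V : Set (ℝ × ℝ) → Set Ω := fun B => {ω | flaggedCustomers (init ω) (arr ω) ∩ B = ∅}
  have h_iaT := indep_sup_of_iIndep h_init.pointSigma_le h_arr.pointSigma_le
    (iSup_le fun n => (hT_meas n).comap_le) h_indep
  have hV {B : Set (ℝ × ℝ)} (hB : MeasurableSet B) :=
    measurableSet_flaggedCustomers_inter_eq_empty init arr hB
  have hcustomers : MeasurableSet[pointSigma init ⊔ pointSigma arr]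
      ((⋂ i, (V (C i))ᶜ) ∩ V D) := (MeasurableSet.iInter fun i => (hV (hC i)).compl).inter (hV hD)
  have hmarks : MeasurableSet[⨆ n, MeasurableSpace.comap (T n) inferInstance]
      (⋂ i : Fin n, T i ⁻¹' J i) := MeasurableSet.iInter fun i =>
    le_iSup (fun n => MeasurableSpace.comap (T n) inferInstance) (i : ℕ) _ ⟨J i, hJ i, rfl⟩
  have hmarks_law : P (⋂ i : Fin n, T i ⁻¹' J i) = ∏ i, τ (J i) := by
    rw [(hT_indep.precomp Fin.val_injective).meas_iInter fun i => ⟨J i, hJ i, rfl⟩]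
    exact Finset.prod_congr rfl fun i _ => (hT_law i).measure_eq (hJ i)
  calc P {ω | (∀ i : Fin n, T i ω ∈ J i) ∧
          (∀ i, (flaggedCustomers (init ω) (arr ω) ∩ C i).Nonempty) ∧
          flaggedCustomers (init ω) (arr ω) ∩ D = ∅}
      = P (((⋂ i, (V (C i))ᶜ) ∩ V D) ∩ ⋂ i : Fin n, T i ⁻¹' J i) := by
        congr 1
        ext ω
        simp [V, nonempty_iff_ne_empty, and_comm]
    _ = P ((⋂ i, (V (C i))ᶜ) ∩ V D) * ∏ i, τ (J i) := by
        rw [(Indep_iff _ _ P).1 h_iaT _ _ hcustomers hmarks, hmarks_law]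
    _ ≤ (∏ i, intensity μ₀ (C i)) * expNeg (intensity μ₀ D) * ∏ i, τ (J i) :=
        mul_le_mul_left (measure_flaggedCustomers_hit_le h_init h_arr
          (h_indep.indep (i := 0) (j := 1) (by decide)) hC hD hDfin hCC hCD) _
    _ = (∏ i, τ (J i) * intensity μ₀ (C i)) * expNeg (intensity μ₀ D) := by
        rw [Finset.prod_mul_distrib]
        ring

end Customers

/-! ### Peaked potentials -/

/-- `u` is unimodal and attains its maximum `M` exactly at `x`. Unlike a potential, `u` need not be
piecewise continuous; this is the property that is carried along the operators `H_w`. -/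
structure IsPeaked (u : ℝ → ℝ) (x M : ℝ) : Prop where
  eq : u x = M
  lt : ∀ y, y ≠ x → u y < M
  mono : MonotoneOn u (Iio x)
  anti : AntitoneOn u (Ioi x)

/-- The area between the level `M + T` and the graph of `u` over the interval of radius `r` around
`x`. For a potential peaked at `x` with height `M`, the radius of `H_w` is where it equals `E`. -/
noncomputable def area (u : ℝ → ℝ) (x M T r : ℝ) : ℝ :=
  ∫ s in (x - r)..(x + r), (M + T - u s)

theorem area_zero {u : ℝ → ℝ} {x M T : ℝ} : area u x M T 0 = 0 := by
  rw [area, sub_zero, add_zero, intervalIntegral.integral_same]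

namespace IsPeaked

variable {u : ℝ → ℝ} {x M T : ℝ}

theorem le (h : IsPeaked u x M) (y : ℝ) : u y ≤ M := by
  rcases eq_or_ne y x with rfl | hy
  · exact h.eq.le
  · exact (h.lt y hy).le

theorem peak_eq (h : IsPeaked u x M) : peak u = x := by
  have hmax : ∃ x : ℝ, ∀ y : ℝ, u y ≤ u x := ⟨x, fun y => h.eq ▸ h.le y⟩
  by_contra hne
  exact (h.lt _ hne).not_ge (h.eq ▸ Classical.epsilon_spec hmax x)

theorem height_eq (h : IsPeaked u x M) : height u = M := by
  rw [height, h.peak_eq, h.eq]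

theorem min_le (h : IsPeaked u x M) {a y b : ℝ} (hay : a ≤ y) (hyb : y ≤ b) :
    min (u a) (u b) ≤ u y := by
  rcases lt_trichotomy y x with hy | rfl | hy
  · exact (min_le_left _ _).trans (h.mono (hay.trans_lt hy) hy hay)
  · exact h.eq.symm ▸ (min_le_left _ _).trans (h.le a)
  · exact (min_le_right _ _).trans (h.anti hy (hy.trans_le hyb) hyb)

theorem measurable (h : IsPeaked u x M) : Measurable u := by
  refine measurable_of_Ioi fun c => OrdConnected.measurableSet (ordConnected_def.2 ?_)
  intro a ha b hb y hy
  exact (lt_min ha hb).trans_le (h.min_le hy.1 hy.2)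

theorem countable_not_continuousAt (h : IsPeaked u x M) : {y | ¬ ContinuousAt u y}.Countable := by
  refine ((h.mono.countable_not_continuousWithinAt.union
    h.anti.countable_not_continuousWithinAt).union (countable_singleton x)).mono ?_
  intro y hy
  rcases lt_trichotomy y x with hlt | rfl | hlt
  · exact Or.inl (Or.inl ⟨hlt, fun hc => hy (hc.continuousAt (Iio_mem_nhds hlt))⟩)
  · exact Or.inr rfl
  · exact Or.inl (Or.inr ⟨hlt, fun hc => hy (hc.continuousAt (Ioi_mem_nhds hlt))⟩)

theorem sub_pos (h : IsPeaked u x M) (hT : 0 ≤ T) {y : ℝ} (hy : y ≠ x) : 0 < M + T - u y := by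
  linarith [h.lt y hy]

theorem sub_nonneg (h : IsPeaked u x M) (hT : 0 ≤ T) (y : ℝ) : 0 ≤ M + T - u y := by
  linarith [h.le y]

theorem intervalIntegrable (h : IsPeaked u x M) (a b : ℝ) : IntervalIntegrable u volume a b := by
  wlog hab : a ≤ b generalizing a b
  · exact (this b a (le_of_not_ge hab)).symm
  rw [intervalIntegrable_iff_integrableOn_Ioc_of_le hab]
  refine Measure.integrableOn_of_bounded (M := max |M| |min (u a) (u b)|)
    measure_Ioc_lt_top.ne h.measurable.aestronglyMeasurable ?_
  filter_upwards [ae_restrict_mem measurableSet_Ioc] with y hy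
  rw [Real.norm_eq_abs, max_comm]
  exact abs_le_max_abs_abs (h.min_le hy.1.le hy.2) (h.le y)

theorem intervalIntegrable_sub (h : IsPeaked u x M) (T a b : ℝ) :
    IntervalIntegrable (fun s => M + T - u s) volume a b :=
  intervalIntegrable_const.sub (h.intervalIntegrable a b)

theorem area_eq_sub (h : IsPeaked u x M) (T : ℝ) : area u x M T = fun r =>
    (∫ s in x..(x + r), (M + T - u s)) - ∫ s in x..(x - r), (M + T - u s) :=
  funext fun _ => (intervalIntegral.integral_interval_sub_left (h.intervalIntegrable_sub T _ _)
    (h.intervalIntegrable_sub T _ _)).symm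

theorem continuous_area (h : IsPeaked u x M) (T : ℝ) : Continuous (area u x M T) := by
  have hprim := intervalIntegral.continuous_primitive (h.intervalIntegrable_sub T) x
  rw [h.area_eq_sub]
  exact (hprim.comp (continuous_const.add continuous_id)).sub
    (hprim.comp (continuous_const.sub continuous_id))

theorem hasDerivAt_area (h : IsPeaked u x M) (T : ℝ) {r : ℝ} (hadd : ContinuousAt u (x + r))
    (hsub : ContinuousAt u (x - r)) :
    HasDerivAt (area u x M T) ((M + T - u (x - r)) + (M + T - u (x + r))) r := by
  have hprim {y : ℝ} (hy : ContinuousAt u y) :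
      HasDerivAt (fun y => ∫ s in x..y, (M + T - u s)) (M + T - u y) y :=
    intervalIntegral.integral_hasDerivAt_right (h.intervalIntegrable_sub T x y)
      (measurable_const.sub h.measurable).stronglyMeasurable.stronglyMeasurableAtFilter
      (continuousAt_const.sub hy)
  rw [h.area_eq_sub]
  refine (((hprim hadd).comp r ((hasDerivAt_id r).const_add x)).sub
    ((hprim hsub).comp r ((hasDerivAt_id r).const_sub x))).congr_deriv ?_
  ring

theorem area_eq_add_area_add (h : IsPeaked u x M) (T r r' : ℝ) : area u x M T r' =
    (∫ s in (x - r')..(x - r), (M + T - u s)) + area u x M T r +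
      ∫ s in (x + r)..(x + r'), (M + T - u s) := by
  have hi := h.intervalIntegrable_sub T
  rw [area, area, intervalIntegral.integral_add_adjacent_intervals (hi _ _) (hi _ _),
    intervalIntegral.integral_add_adjacent_intervals (hi _ _) (hi _ _)]

theorem area_add_integral_le (h : IsPeaked u x M) (hT : 0 ≤ T) {r r' : ℝ} (hr : r ≤ r') :
    area u x M T r + ∫ s in (x + r)..(x + r'), (M + T - u s) ≤ area u x M T r' := by
  have hleft : 0 ≤ ∫ s in (x - r')..(x - r), (M + T - u s) :=
    intervalIntegral.integral_nonneg (by linarith) fun s _ => h.sub_nonneg hT s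
  linarith [h.area_eq_add_area_add T r r']

theorem strictMonoOn_area (h : IsPeaked u x M) (hT : 0 ≤ T) :
    StrictMonoOn (area u x M T) (Ici 0) := by
  intro r (hr : 0 ≤ r) r' _ hlt
  have hright : 0 < ∫ s in (x + r)..(x + r'), (M + T - u s) :=
    intervalIntegral.intervalIntegral_pos_of_pos_on (h.intervalIntegrable_sub T _ _)
      (fun s hs => h.sub_pos hT (by linarith [hs.1] : x < s).ne') (by linarith)
  linarith [h.area_add_integral_le hT hlt.le]

theorem area_pos (h : IsPeaked u x M) (hT : 0 ≤ T) {z : ℝ} (hz : 0 < z) : 0 < area u x M T z := by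
  rw [← area_zero (u := u) (x := x) (M := M) (T := T)]
  exact h.strictMonoOn_area hT self_mem_Ici hz.le hz

theorem area_nonneg (h : IsPeaked u x M) (hT : 0 ≤ T) {z : ℝ} (hz : 0 ≤ z) :
    0 ≤ area u x M T z :=
  intervalIntegral.integral_nonneg (by linarith) fun s _ => h.sub_nonneg hT s

theorem tendsto_area (h : IsPeaked u x M) (hT : 0 ≤ T) :
    Tendsto (area u x M T) atTop atTop := by
  set c := M + T - u (x + 1)
  have hc : 0 < c := h.sub_pos hT (by linarith : x < x + 1).ne'
  have hlinear : ∀ r, 1 ≤ r → c * (r - 1) ≤ area u x M T r := by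
    intro r hr
    have hright : ∫ _ in (x + 1)..(x + r), c ≤ ∫ s in (x + 1)..(x + r), (M + T - u s) :=
      intervalIntegral.integral_mono_on (by linarith) intervalIntegrable_const
        (h.intervalIntegrable_sub T _ _) fun s hs => sub_le_sub_left
          (h.anti (by simp) ((lt_add_one x).trans_le hs.1) hs.1) _
    rw [intervalIntegral.integral_const, smul_eq_mul] at hright
    linarith [h.area_add_integral_le hT hr, h.area_pos hT one_pos]
  refine tendsto_atTop_mono' atTop ((eventually_ge_atTop 1).mono hlinear) ?_
  exact (tendsto_atTop_add_const_right _ (-1) tendsto_id).const_mul_atTop hc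

theorem exists_area_eq (h : IsPeaked u x M) (hT : 0 ≤ T) {E : ℝ} (hE : 0 < E) :
    ∃ z, 0 < z ∧ area u x M T z = E := by
  obtain ⟨r, hr, hr0⟩ := ((h.tendsto_area hT).eventually_ge_atTop E |>.and
    (eventually_ge_atTop 0)).exists
  obtain ⟨z, hz, hzE⟩ := intermediate_value_Icc hr0 (h.continuous_area T).continuousOn
    (show E ∈ Icc (area u x M T 0) (area u x M T r) from ⟨area_zero.trans_le hE.le, hr⟩)
  refine ⟨z, hz.1.lt_of_ne ?_, hzE⟩
  rintro rfl
  exact hE.ne (area_zero.symm.trans hzE)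

theorem radius_spec (h : IsPeaked u x M) (hT : 0 ≤ T) {E : ℝ} (hE : 0 < E) :
    0 < radius T E u ∧ area u x M T (radius T E u) = E := by
  unfold radius
  rw [h.peak_eq, h.height_eq]
  exact Classical.epsilon_spec (h.exists_area_eq hT hE)

theorem radius_area (h : IsPeaked u x M) (hT : 0 ≤ T) {z : ℝ} (hz : 0 < z) :
    radius T (area u x M T z) u = z := by
  obtain ⟨hpos, harea⟩ := h.radius_spec hT (h.area_pos hT hz)
  exact (h.strictMonoOn_area hT).injOn (mem_Ici.2 hpos.le) (mem_Ici.2 hz.le) harea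

theorem radius_le_iff (h : IsPeaked u x M) (hT : 0 ≤ T) {E : ℝ} (hE : 0 < E) {r : ℝ}
    (hr : 0 ≤ r) : radius T E u ≤ r ↔ E ≤ area u x M T r := by
  obtain ⟨hpos, harea⟩ := h.radius_spec hT hE
  rw [← (h.strictMonoOn_area hT).le_iff_le hpos.le hr, harea]

theorem newPoint_eq (h : IsPeaked u x M) (w : ℝ × ℝ × ℝ) : newPoint w u =
    if w.2.2 ≤ (M + w.1 - u (x - radius w.1 w.2.1 u)) / ((M + w.1 - u (x - radius w.1 w.2.1 u)) +
      (M + w.1 - u (x + radius w.1 w.2.1 u))) then x - radius w.1 w.2.1 u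
    else x + radius w.1 w.2.1 u := by
  rw [newPoint, h.peak_eq, h.height_eq]

theorem abs_newPoint_sub (h : IsPeaked u x M) {w : ℝ × ℝ × ℝ} (hT : 0 ≤ w.1) (hE : 0 < w.2.1) :
    |newPoint w u - x| = radius w.1 w.2.1 u := by
  have hpos := (h.radius_spec hT hE).1
  rw [h.newPoint_eq]
  split_ifs
  · rw [abs_sub_comm, sub_sub_cancel, abs_of_pos hpos]
  · rw [add_sub_cancel_left, abs_of_pos hpos]

end IsPeaked

/-! ### The law of the new point -/

theorem lintegral_uniform_ite {p : ℝ} (hp0 : 0 ≤ p) (hp1 : p ≤ 1) (a b : ℝ≥0∞) :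
    ∫⁻ U in Icc (0 : ℝ) 1, (if U ≤ p then a else b) =
      ENNReal.ofReal p * a + ENNReal.ofReal (1 - p) * b := by
  have hdiff : Icc (0 : ℝ) 1 \ Iic p = Ioc p 1 := by
    ext U
    simp only [Set.mem_sdiff, mem_Icc, mem_Iic, not_le, mem_Ioc]
    exact ⟨fun h => ⟨h.2, h.1.2⟩, fun h => ⟨⟨hp0.trans h.1.le, h.2⟩, h.1⟩⟩
  have hinter : Icc (0 : ℝ) 1 ∩ Iic p = Icc 0 p := by
    rw [← Ici_inter_Iic, inter_assoc, Iic_inter_Iic, min_eq_right hp1, Ici_inter_Iic]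
  rw [← lintegral_inter_add_sdiff _ _ measurableSet_Iic, hinter, hdiff,
    setLIntegral_congr_fun measurableSet_Icc fun U hU => if_pos hU.2,
    setLIntegral_congr_fun measurableSet_Ioc fun U hU => if_neg hU.1.not_ge,
    setLIntegral_const, setLIntegral_const, Real.volume_Icc, Real.volume_Ioc, sub_zero, mul_comm a,
    mul_comm b]

theorem lintegral_expMeasure (f : ℝ → ℝ≥0∞) :
    ∫⁻ E, f E ∂(expMeasure 1) = ∫⁻ E in Ioi (0 : ℝ), ENNReal.ofReal (Real.exp (-E)) * f E := by
  have hdensity : expMeasure 1 = volume.withDensity (exponentialPDF 1) := rfl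
  rw [hdensity, lintegral_withDensity_eq_lintegral_mul_non_measurable _
    (f := exponentialPDF 1) (measurable_exponentialPDFReal 1).ennreal_ofReal
    (Eventually.of_forall fun E => ENNReal.ofReal_lt_top), setLIntegral_congr Ioi_ae_eq_Ici,
    ← lintegral_indicator measurableSet_Ici]
  refine lintegral_congr fun E => ?_
  by_cases hE : 0 ≤ E
  · rw [indicator_of_mem (mem_Ici.2 hE), Pi.mul_apply, exponentialPDF_of_nonneg hE, one_mul,
      one_mul]
  · rw [indicator_of_notMem (notMem_Ici.2 (not_le.1 hE)), Pi.mul_apply,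
      exponentialPDF_of_neg (not_le.1 hE), zero_mul]

theorem lintegral_eq_lintegral_Ioi_sub_add (x : ℝ) {f : ℝ → ℝ≥0∞} (hf : Measurable f) :
    ∫⁻ y, f y = ∫⁻ z in Ioi (0 : ℝ), (f (x - z) + f (x + z)) := by
  have hneg : ∫⁻ z in Iic (0 : ℝ), f (x + z) = ∫⁻ z in Ioi (0 : ℝ), f (x - z) := by
    rw [setLIntegral_congr Ioi_ae_eq_Ici, ← lintegral_indicator measurableSet_Iic,
      ← lintegral_indicator measurableSet_Ici, ← lintegral_neg_eq_self]
    refine lintegral_congr fun z => ?_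
    simp only [indicator_apply, mem_Iic, mem_Ici, Left.neg_nonpos_iff, sub_eq_add_neg]
  rw [← lintegral_add_left_eq_self f x, ← lintegral_add_compl _ (measurableSet_Ioi (a := (0 : ℝ))),
    lintegral_add_right _ (by fun_prop), add_comm, compl_Ioi, hneg]

namespace IsPeaked

variable {u : ℝ → ℝ} {x M T : ℝ}

theorem lintegral_comp_area (h : IsPeaked u x M) (hT : 0 ≤ T) (f : ℝ → ℝ≥0∞) :
    ∫⁻ E in Ioi (0 : ℝ), f E = ∫⁻ z in Ioi (0 : ℝ),
      ENNReal.ofReal ((M + T - u (x - z)) + (M + T - u (x + z))) * f (area u x M T z) := by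
  let N : Set ℝ := {z | ¬ ContinuousAt u (x + z)} ∪ {z | ¬ ContinuousAt u (x - z)}
  have hN : N.Countable :=
    (h.countable_not_continuousAt.preimage (add_right_injective x)).union
      (h.countable_not_continuousAt.preimage sub_right_injective)
  let s : Set ℝ := Ioi 0 \ N
  have hs : s =ᵐ[volume] Ioi (0 : ℝ) := sdiff_null_ae_eq_self (hN.measure_zero _)
  have himg : area u x M T '' s =ᵐ[volume] Ioi (0 : ℝ) := by
    refine EventuallyLE.antisymm (LE.le.eventuallyLE ?_) (ae_le_set.2 ?_)
    · rintro _ ⟨z, hz, rfl⟩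
      exact h.area_pos hT hz.1
    · refine measure_mono_null ?_ ((hN.image (area u x M T)).measure_zero volume)
      rintro E ⟨hE, hEs⟩
      obtain ⟨z, hz, rfl⟩ := h.exists_area_eq hT hE
      exact ⟨z, by_contra fun hzN => hEs ⟨z, ⟨hz, hzN⟩, rfl⟩, rfl⟩
  have hderiv (z : ℝ) (hz : z ∈ s) : HasDerivWithinAt (area u x M T)
      ((M + T - u (x - z)) + (M + T - u (x + z))) s z :=
    (h.hasDerivAt_area T (not_not.1 fun hc => hz.2 (Or.inl hc))
      (not_not.1 fun hc => hz.2 (Or.inr hc))).hasDerivWithinAt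
  rw [← setLIntegral_congr himg, lintegral_image_eq_lintegral_abs_deriv_mul
      (measurableSet_Ioi.diff hN.measurableSet) hderiv
      ((h.strictMonoOn_area hT).injOn.mono fun z hz => mem_Ici.2 (le_of_lt hz.1)),
    setLIntegral_congr hs]
  refine lintegral_congr fun z => ?_
  rw [abs_of_nonneg (add_nonneg (h.sub_nonneg hT _) (h.sub_nonneg hT _))]

/-- The side is chosen with odds `a : b`, so the total rate `a + b` of the change of variables
`E = area z` splits into `a` on the left and `b` on the right. -/
theorem mul_lintegral_uniform_newPoint (h : IsPeaked u x M) (hT : 0 ≤ T) (φ : ℝ → ℝ≥0∞) {z : ℝ}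
    (hz : 0 < z) : ENNReal.ofReal ((M + T - u (x - z)) + (M + T - u (x + z))) *
        ∫⁻ U in Icc (0 : ℝ) 1, φ (newPoint (T, area u x M T z, U) u) =
      ENNReal.ofReal (M + T - u (x - z)) * φ (x - z) +
        ENNReal.ofReal (M + T - u (x + z)) * φ (x + z) := by
  set a := M + T - u (x - z)
  set b := M + T - u (x + z)
  have ha : 0 < a := h.sub_pos hT (by linarith : x - z < x).ne
  have hb : 0 < b := h.sub_pos hT (by linarith : x < x + z).ne'
  have hφ (U : ℝ) : φ (newPoint (T, area u x M T z, U) u) =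
      if U ≤ a / (a + b) then φ (x - z) else φ (x + z) := by
    rw [h.newPoint_eq]
    simp only [h.radius_area hT hz]
    exact apply_ite φ _ _ _
  simp_rw [hφ]
  rw [lintegral_uniform_ite (by positivity) ((div_le_one (by positivity)).2 (by linarith)),
    mul_add, ← mul_assoc, ← mul_assoc, ← ENNReal.ofReal_mul (by positivity),
    ← ENNReal.ofReal_mul (by positivity)]
  congr 3
  · field_simp
  · field_simp
    ring

theorem lintegral_newPoint (h : IsPeaked u x M) (hT : 0 ≤ T) {φ : ℝ → ℝ≥0∞} (hφ : Measurable φ) :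
    ∫⁻ E, (∫⁻ U in Icc (0 : ℝ) 1, φ (newPoint (T, E, U) u)) ∂(expMeasure 1) =
      ∫⁻ y, ENNReal.ofReal (M + T - u y) * ENNReal.ofReal (Real.exp (-area u x M T |y - x|)) *
        φ y := by
  have hmeas : Measurable fun y => ENNReal.ofReal (M + T - u y) *
      ENNReal.ofReal (Real.exp (-area u x M T |y - x|)) * φ y := by
    have harea : Measurable fun y => area u x M T |y - x| :=
      (h.continuous_area T).measurable.comp (by fun_prop)
    have := h.measurable
    fun_prop
  rw [lintegral_expMeasure, h.lintegral_comp_area hT, lintegral_eq_lintegral_Ioi_sub_add x hmeas]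
  refine setLIntegral_congr_fun measurableSet_Ioi fun z (hz : 0 < z) => ?_
  simp only [abs_sub_comm (x - z), sub_sub_cancel, add_sub_cancel_left, abs_of_pos hz]
  rw [mul_left_comm, h.mul_lintegral_uniform_newPoint hT φ hz]
  ring

end IsPeaked

/-! ### Histories -/

/-- The position after `n` moves along a history, that is, along a sequence `σ` of service times and
new positions. -/
def position (σ : ℕ → ℝ × ℝ) : ℕ → ℝ
  | 0 => 0
  | n + 1 => (σ n).2

/-- The time at which service `n` starts along the history `σ`, at speed `v`. -/
noncomputable def startTime (v : ℝ) (σ : ℕ → ℝ × ℝ) : ℕ → ℝ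
  | 0 => 0
  | n + 1 => startTime v σ n + (σ n).1 + |(σ n).2 - position σ n| / v

open Classical in
/-- The potential after `n` moves along the history `σ`: the operator `H_w` with the new point
prescribed, the radius being its distance from the current position. -/
noncomputable def potentialAlong (v : ℝ) (u₀ : ℝ → ℝ) (σ : ℕ → ℝ × ℝ) : ℕ → ℝ → ℝ
  | 0 => u₀
  | n + 1 => fun s =>
    if s = (σ n).2 then startTime v σ (n + 1)
    else if |s - position σ n| ≤ |(σ n).2 - position σ n| then startTime v σ n + (σ n).1
    else potentialAlong v u₀ σ n s

/-- The histories whose first `n` service times are nonnegative. -/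
def nonnegServices (n : ℕ) : Set (ℕ → ℝ × ℝ) := {σ | ∀ k < n, 0 ≤ (σ k).1}

section Histories

variable {v : ℝ} {u₀ : ℝ → ℝ} {σ σ' : ℕ → ℝ × ℝ} {n : ℕ}

theorem position_congr (h : ∀ k < n, σ k = σ' k) : position σ n = position σ' n := by
  cases n with
  | zero => rfl
  | succ n => rw [position, position, h n n.lt_succ_self]

theorem startTime_congr (h : ∀ k < n, σ k = σ' k) : startTime v σ n = startTime v σ' n := by
  induction n with
  | zero => rfl
  | succ n ih =>
    have h' : ∀ k < n, σ k = σ' k := fun k hk => h k (hk.trans n.lt_succ_self)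
    rw [startTime, startTime, h n n.lt_succ_self, ih h', position_congr h']

theorem potentialAlong_congr (h : ∀ k < n, σ k = σ' k) :
    potentialAlong v u₀ σ n = potentialAlong v u₀ σ' n := by
  induction n with
  | zero => rfl
  | succ n ih =>
    have h' : ∀ k < n, σ k = σ' k := fun k hk => h k (hk.trans n.lt_succ_self)
    funext s
    simp only [potentialAlong]
    rw [h n n.lt_succ_self, ih h', position_congr h', startTime_congr h', startTime_congr h]

theorem mem_nonnegServices_congr (h : ∀ k < n, σ k = σ' k) :
    σ ∈ nonnegServices n ↔ σ' ∈ nonnegServices n :=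
  forall₂_congr fun k hk => by rw [h k hk]

theorem mem_nonnegServices_succ :
    σ ∈ nonnegServices (n + 1) ↔ σ ∈ nonnegServices n ∧ 0 ≤ (σ n).1 :=
  Nat.forall_lt_succ_right

theorem update_apply_of_lt (σ : ℕ → ℝ × ℝ) (n : ℕ) (q : ℝ × ℝ) :
    ∀ k < n, Function.update σ n q k = σ k :=
  fun _ hk => Function.update_of_ne hk.ne _ _

theorem continuous_position (n : ℕ) : Continuous fun σ : ℕ → ℝ × ℝ => position σ n := by
  cases n with
  | zero => exact continuous_const
  | succ n => exact (continuous_apply n).snd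

theorem continuous_startTime (v : ℝ) (n : ℕ) :
    Continuous fun σ : ℕ → ℝ × ℝ => startTime v σ n := by
  induction n with
  | zero => exact continuous_const
  | succ n ih =>
    have := continuous_position n
    simp only [startTime]
    fun_prop

theorem measurable_potentialAlong (v : ℝ) (hu₀ : Measurable u₀) (n : ℕ) :
    Measurable fun q : (ℕ → ℝ × ℝ) × ℝ => potentialAlong v u₀ q.1 n q.2 := by
  induction n with
  | zero => exact hu₀.comp measurable_snd
  | succ n ih =>
    have hpos := (continuous_position n).measurable
    have htime := (continuous_startTime v n).measurable
    have htime' := (continuous_startTime v (n + 1)).measurable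
    simp only [potentialAlong]
    refine Measurable.ite (measurableSet_eq_fun ?_ ?_) ?_
      (Measurable.ite (measurableSet_le ?_ ?_) ?_ ih) <;> fun_prop

theorem measurableSet_nonnegServices (n : ℕ) : MeasurableSet (nonnegServices n) := by
  simp only [nonnegServices, ofPred_forall]
  exact MeasurableSet.iInter fun k => MeasurableSet.iInter fun _ =>
    measurableSet_le measurable_const (by fun_prop)

end Histories

namespace IsPeaked

variable {u u' : ℝ → ℝ} {x y M T v : ℝ}

theorem comp_neg (h : IsPeaked u x M) : IsPeaked (fun s => u (-s)) (-x) M where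
  eq := by rw [neg_neg, h.eq]
  lt s hs := h.lt _ fun h' => hs (neg_eq_iff_eq_neg.1 h')
  mono a (ha : a < -x) b (hb : b < -x) hab :=
    h.anti (lt_neg_of_lt_neg hb) (lt_neg_of_lt_neg ha) (neg_le_neg hab)
  anti a (ha : -x < a) b (hb : -x < b) hab :=
    h.mono (neg_lt_of_neg_lt hb) (neg_lt_of_neg_lt ha) (neg_le_neg hab)

theorem le_of_flat (h : IsPeaked u x M) (hT : 0 ≤ T)
    (hflat : ∀ s, s ≠ y → |s - x| ≤ |y - x| → u' s = M + T)
    (hfar : ∀ s, s ≠ y → |y - x| < |s - x| → u' s = u s) {s : ℝ} (hs : s ≠ y) :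
    u' s ≤ M + T := by
  rcases le_or_gt |s - x| |y - x| with hs' | hs'
  · exact (hflat s hs hs').le
  · linarith [hfar s hs hs', h.le s]

theorem monotoneOn_of_flat (h : IsPeaked u x M) (hT : 0 ≤ T)
    (hflat : ∀ s, s ≠ y → |s - x| ≤ |y - x| → u' s = M + T)
    (hfar : ∀ s, s ≠ y → |y - x| < |s - x| → u' s = u s) : MonotoneOn u' (Iio y) := by
  intro a (ha : a < y) b (hb : b < y) hab
  rcases le_or_gt |b - x| |y - x| with hby | hby
  · exact (h.le_of_flat hT hflat hfar ha.ne).trans_eq (hflat b hb.ne hby).symm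
  · have hbx : b < x := by
      by_contra! hxb
      exact hby.not_ge (abs_le_abs_of_nonneg (_root_.sub_nonneg.2 hxb) (by linarith))
    have hax : |y - x| < |a - x| :=
      hby.trans_le (abs_le_abs_of_nonpos (by linarith) (by linarith))
    rw [hfar a ha.ne hax, hfar b hb.ne hby]
    exact h.mono (hab.trans_lt hbx) hbx hab

theorem of_flat (h : IsPeaked u x M) (hv : 0 < v) (hT : 0 ≤ T)
    (hpeak : u' y = M + T + |y - x| / v)
    (hflat : ∀ s, s ≠ y → |s - x| ≤ |y - x| → u' s = M + T)
    (hfar : ∀ s, s ≠ y → |y - x| < |s - x| → u' s = u s) :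
    IsPeaked u' y (M + T + |y - x| / v) where
  eq := hpeak
  lt s hs := by
    rcases eq_or_ne y x with rfl | hy
    · rw [hfar s hs (by simpa [sub_eq_zero] using hs), sub_self, abs_zero, zero_div]
      linarith [h.lt s hs]
    · linarith [h.le_of_flat hT hflat hfar hs, div_pos (abs_pos.2 (sub_ne_zero.2 hy)) hv]
  mono := h.monotoneOn_of_flat hT hflat hfar
  anti := by
    have habs (s z : ℝ) : |-s - z| = |s - -z| := by rw [← abs_neg]; congr 1; ring
    have hmono : MonotoneOn (fun s => u' (-s)) (Iio (-y)) :=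
      h.comp_neg.monotoneOn_of_flat hT
        (fun s hs hsy => hflat _ (fun h' => hs (neg_eq_iff_eq_neg.1 h'))
          (by rwa [habs, abs_sub_comm y, ← neg_sub_neg y x]))
        (fun s hs hsy => hfar _ (fun h' => hs (neg_eq_iff_eq_neg.1 h'))
          (by rwa [habs, abs_sub_comm y, ← neg_sub_neg y x]))
    intro a (ha : y < a) b (hb : y < b) hab
    simpa only [neg_neg] using hmono (neg_lt_neg hb) (neg_lt_neg ha) (neg_le_neg hab)

theorem potentialAlong {u₀ : ℝ → ℝ} {σ : ℕ → ℝ × ℝ} {n : ℕ}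
    (hu₀ : IsPeaked u₀ 0 0) (hv : 0 < v) (hσ : σ ∈ nonnegServices n) :
    IsPeaked (potentialAlong v u₀ σ n) (position σ n) (startTime v σ n) := by
  induction n with
  | zero => exact hu₀
  | succ n ih =>
    rw [mem_nonnegServices_succ] at hσ
    refine (ih hσ.1).of_flat (y := (σ n).2) hv hσ.2 (if_pos rfl) ?_ ?_
    · exact fun s hs hnear => (if_neg hs).trans (if_pos hnear)
    · exact fun s hs hfar => (if_neg hs).trans (if_neg hfar.not_ge)

theorem step_eq (h : IsPeaked u x M) {w : ℝ × ℝ × ℝ} (hT : 0 ≤ w.1) (hE : 0 < w.2.1) (s : ℝ) :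
    step v w u s = if s = newPoint w u then M + w.1 + |newPoint w u - x| / v
      else if |s - x| ≤ |newPoint w u - x| then M + w.1 else u s := by
  have hmem (r : ℝ) : s ∈ Icc (x - r) (x + r) ↔ |s - x| ≤ r := by
    rw [← Real.closedBall_eq_Icc, Metric.mem_closedBall, Real.dist_eq]
  simp only [h.abs_newPoint_sub hT hE, step, h.peak_eq, h.height_eq, hmem]

end IsPeaked

/-! ### The law of the histories -/

section HistoryLaw

variable {v : ℝ} {u₀ : ℝ → ℝ}

theorem measurable_area_potentialAlong (v : ℝ) (hu₀ : Measurable u₀) (n : ℕ) :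
    Measurable fun q : (ℕ → ℝ × ℝ) × ℝ × ℝ =>
      area (potentialAlong v u₀ q.1 n) (position q.1 n) (startTime v q.1 n) q.2.1 |q.2.2| := by
  have hpos := (continuous_position n).measurable
  have htime := (continuous_startTime v n).measurable
  have hpot : Measurable fun p : ((ℕ → ℝ × ℝ) × ℝ × ℝ) × ℝ => potentialAlong v u₀ p.1.1 n p.2 :=
    (measurable_potentialAlong v hu₀ n).comp (by fun_prop :
      Measurable fun p : ((ℕ → ℝ × ℝ) × ℝ × ℝ) × ℝ => (p.1.1, p.2))
  let I : Set (((ℕ → ℝ × ℝ) × ℝ × ℝ) × ℝ) :=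
    {p | position p.1.1 n - |p.1.2.2| < p.2} ∩ {p | p.2 ≤ position p.1.1 n + |p.1.2.2|}
  have hI : MeasurableSet I :=
    (measurableSet_lt (by fun_prop) (by fun_prop)).inter
      (measurableSet_le (by fun_prop) (by fun_prop))
  let f : ((ℕ → ℝ × ℝ) × ℝ × ℝ) × ℝ → ℝ :=
    I.indicator fun p => startTime v p.1.1 n + p.1.2.1 - potentialAlong v u₀ p.1.1 n p.2
  have hf : Measurable f := Measurable.indicator (by fun_prop) hI
  convert (hf.stronglyMeasurable.integral_prod_right' (ν := volume)).measurable using 2 with q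
  rw [area, intervalIntegral.integral_of_le (by linarith [abs_nonneg q.2.2]),
    ← integral_indicator measurableSet_Ioc]
  rfl

/-- The density of the next service time and position, given the history: the rate of customers at
the new position, times the probability that nobody waits nearer. -/
noncomputable def stepDensity (v : ℝ) (u₀ : ℝ → ℝ) (n : ℕ) (q : (ℕ → ℝ × ℝ) × ℝ × ℝ) : ℝ≥0∞ :=
  ENNReal.ofReal (startTime v q.1 n + q.2.1 - potentialAlong v u₀ q.1 n q.2.2) *
    ENNReal.ofReal (Real.exp (-area (potentialAlong v u₀ q.1 n) (position q.1 n)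
      (startTime v q.1 n) q.2.1 |q.2.2 - position q.1 n|))

theorem measurable_stepDensity (v : ℝ) (hu₀ : Measurable u₀) (n : ℕ) :
    Measurable (stepDensity v u₀ n) := by
  have hpos := (continuous_position n).measurable
  have htime := (continuous_startTime v n).measurable
  have hpot : Measurable fun q : (ℕ → ℝ × ℝ) × ℝ × ℝ => potentialAlong v u₀ q.1 n q.2.2 :=
    (measurable_potentialAlong v hu₀ n).comp
      (by fun_prop : Measurable fun q : (ℕ → ℝ × ℝ) × ℝ × ℝ => (q.1, q.2.2))
  have harea : Measurable fun q : (ℕ → ℝ × ℝ) × ℝ × ℝ => area (potentialAlong v u₀ q.1 n)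
      (position q.1 n) (startTime v q.1 n) q.2.1 |q.2.2 - position q.1 n| :=
    (measurable_area_potentialAlong v hu₀ n).comp (by fun_prop :
      Measurable fun q : (ℕ → ℝ × ℝ) × ℝ × ℝ => (q.1, q.2.1, q.2.2 - position q.1 n))
  unfold stepDensity
  fun_prop

/-- The law of the first `n` service times and new positions, continued by zeros. -/
noncomputable def historyLaw (v : ℝ) (u₀ : ℝ → ℝ) (τ : Measure ℝ) : ℕ → Measure (ℕ → ℝ × ℝ)
  | 0 => Measure.dirac 0
  | n + 1 => (((historyLaw v u₀ τ n).prod (τ.prod volume)).withDensity (stepDensity v u₀ n)).map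
      fun q => Function.update q.1 n q.2

theorem measurable_update_history (n : ℕ) :
    Measurable fun q : (ℕ → ℝ × ℝ) × ℝ × ℝ => Function.update q.1 n q.2 := by
  refine measurable_pi_lambda _ fun k => ?_
  rcases eq_or_ne k n with rfl | hk
  · simpa only [Function.update_self] using measurable_snd
  · simp only [Function.update_of_ne hk]
    fun_prop

theorem lintegral_historyLaw_succ {τ : Measure ℝ} [SFinite τ] (v : ℝ) (hu₀ : Measurable u₀) (n : ℕ)
    {f : (ℕ → ℝ × ℝ) → ℝ≥0∞} (hf : Measurable f) :
    ∫⁻ σ, f σ ∂(historyLaw v u₀ τ (n + 1)) = ∫⁻ σ, (∫⁻ T, (∫⁻ y, stepDensity v u₀ n (σ, T, y) *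
      f (Function.update σ n (T, y))) ∂τ) ∂(historyLaw v u₀ τ n) := by
  have hd := measurable_stepDensity v hu₀ n
  have hfu : Measurable fun q : (ℕ → ℝ × ℝ) × ℝ × ℝ => f (Function.update q.1 n q.2) :=
    hf.comp (measurable_update_history n)
  rw [historyLaw, lintegral_map hf (measurable_update_history n),
    lintegral_withDensity_eq_lintegral_mul _ hd hfu, lintegral_prod _ (hd.mul hfu).aemeasurable]
  exact lintegral_congr fun σ =>
    lintegral_prod _ ((hd.mul hfu).comp measurable_prodMk_left).aemeasurable

/-! ### The history of the sequence of potentials -/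

/-- The pairs of a history and a triple `w = (T, E, U)` for which the potential along the history is
peaked and its radius for `w` is the one intended. -/
def admissibleSteps (n : ℕ) : Set ((ℕ → ℝ × ℝ) × ℝ × ℝ × ℝ) :=
  {q | q.1 ∈ nonnegServices n ∧ 0 ≤ q.2.1 ∧ 0 < q.2.2.1}

theorem measurableSet_admissibleSteps (n : ℕ) : MeasurableSet (admissibleSteps n) := by
  have hT : MeasurableSet {q : (ℕ → ℝ × ℝ) × ℝ × ℝ × ℝ | 0 ≤ q.2.1} :=
    measurableSet_le measurable_const (by fun_prop)
  have hE : MeasurableSet {q : (ℕ → ℝ × ℝ) × ℝ × ℝ × ℝ | 0 < q.2.2.1} :=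
    measurableSet_lt measurable_const (by fun_prop)
  exact (measurable_fst (measurableSet_nonnegServices n)).inter (hT.inter hE)

/-- The radius of the next step, made measurable by the value `0` outside the admissible steps. -/
noncomputable def nextRadius (v : ℝ) (u₀ : ℝ → ℝ) (n : ℕ) : (ℕ → ℝ × ℝ) × ℝ × ℝ × ℝ → ℝ :=
  (admissibleSteps n).indicator fun q => radius q.2.1 q.2.2.1 (potentialAlong v u₀ q.1 n)

/-- The new point of the next step, made measurable by the value `0` outside the admissible
steps. -/
noncomputable def nextPoint (v : ℝ) (u₀ : ℝ → ℝ) (n : ℕ) : (ℕ → ℝ × ℝ) × ℝ × ℝ × ℝ → ℝ :=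
  (admissibleSteps n).indicator fun q => newPoint q.2 (potentialAlong v u₀ q.1 n)

theorem nextPoint_eq {n : ℕ} {σ : ℕ → ℝ × ℝ} {w : ℝ × ℝ × ℝ} (hσ : σ ∈ nonnegServices n)
    (hT : 0 ≤ w.1) (hE : 0 < w.2.1) :
    nextPoint v u₀ n (σ, w) = newPoint w (potentialAlong v u₀ σ n) := by
  have hmem : (σ, w) ∈ admissibleSteps n := ⟨hσ, hT, hE⟩
  exact indicator_of_mem hmem _

theorem measurable_nextRadius (hv : 0 < v) (hu₀ : IsPeaked u₀ 0 0) (n : ℕ) :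
    Measurable (nextRadius v u₀ n) := by
  have hG := measurableSet_admissibleSteps n
  refine measurable_of_Iic fun r => ?_
  rcases le_or_gt 0 r with hr | hr
  · have hIic : nextRadius v u₀ n ⁻¹' Iic r = (admissibleSteps n)ᶜ ∪ (admissibleSteps n ∩
        {q | q.2.2.1 ≤ area (potentialAlong v u₀ q.1 n) (position q.1 n) (startTime v q.1 n)
          q.2.1 |r|}) := by
      ext q
      by_cases hq : q ∈ admissibleSteps n
      · have := (hu₀.potentialAlong hv hq.1).radius_le_iff hq.2.1 hq.2.2 hr
        simp [nextRadius, hq, this, abs_of_nonneg hr]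
      · simp [nextRadius, hq, hr]
    rw [hIic]
    refine hG.compl.union (hG.inter (measurableSet_le (by fun_prop) ?_))
    exact (measurable_area_potentialAlong v hu₀.measurable n).comp (by fun_prop :
      Measurable fun q : (ℕ → ℝ × ℝ) × ℝ × ℝ × ℝ => (q.1, q.2.1, r))
  · have hempty : nextRadius v u₀ n ⁻¹' Iic r = ∅ :=
      eq_empty_of_forall_notMem fun q hq => hr.not_ge (le_trans (indicator_nonneg (fun q hq =>
        ((hu₀.potentialAlong hv hq.1).radius_spec hq.2.1 hq.2.2).1.le) q) hq)
    rw [hempty]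
    exact MeasurableSet.empty

theorem measurable_nextPoint (hv : 0 < v) (hu₀ : IsPeaked u₀ 0 0) (n : ℕ) :
    Measurable (nextPoint v u₀ n) := by
  classical
  have hpos := (continuous_position n).measurable
  have htime := (continuous_startTime v n).measurable
  have hρ := measurable_nextRadius hv hu₀ n
  have hpot (g : (ℕ → ℝ × ℝ) × ℝ × ℝ × ℝ → ℝ) (hg : Measurable g) :
      Measurable fun q : (ℕ → ℝ × ℝ) × ℝ × ℝ × ℝ => potentialAlong v u₀ q.1 n (g q) :=
    (measurable_potentialAlong v hu₀.measurable n).comp (measurable_fst.prodMk hg)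
  have hleft := hpot (fun q => position q.1 n - nextRadius v u₀ n q) (by fun_prop)
  have hright := hpot (fun q => position q.1 n + nextRadius v u₀ n q) (by fun_prop)
  let a : (ℕ → ℝ × ℝ) × ℝ × ℝ × ℝ → ℝ := fun q => startTime v q.1 n + q.2.1 -
    potentialAlong v u₀ q.1 n (position q.1 n - nextRadius v u₀ n q)
  let b : (ℕ → ℝ × ℝ) × ℝ × ℝ × ℝ → ℝ := fun q => startTime v q.1 n + q.2.1 -
    potentialAlong v u₀ q.1 n (position q.1 n + nextRadius v u₀ n q)
  have ha : Measurable a := Measurable.sub (by fun_prop) hleft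
  have hb : Measurable b := Measurable.sub (by fun_prop) hright
  have heq : nextPoint v u₀ n = (admissibleSteps n).indicator fun q =>
      if q.2.2.2 ≤ a q / (a q + b q) then position q.1 n - nextRadius v u₀ n q
      else position q.1 n + nextRadius v u₀ n q := by
    refine indicator_congr fun q hq => ?_
    simp only [a, b, nextRadius, indicator_of_mem hq]
    exact (hu₀.potentialAlong hv hq.1).newPoint_eq q.2
  rw [heq]
  exact (Measurable.ite (measurableSet_le (by fun_prop) (ha.div (ha.add hb))) (by fun_prop)
    (by fun_prop)).indicator (measurableSet_admissibleSteps n)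

/-- The history generated by the triples `w`, up to `n` and continued by zeros. -/
noncomputable def history (v : ℝ) (u₀ : ℝ → ℝ) (w : ℕ → ℝ × ℝ × ℝ) : ℕ → (ℕ → ℝ × ℝ)
  | 0 => 0
  | n + 1 => Function.update (history v u₀ w n) n
      ((w n).1, nextPoint v u₀ n (history v u₀ w n, w n))

theorem measurable_history (hv : 0 < v) (hu₀ : IsPeaked u₀ 0 0) (n : ℕ) :
    Measurable fun w : ℕ → ℝ × ℝ × ℝ => history v u₀ w n := by
  induction n with
  | zero => exact measurable_const
  | succ n ih =>
    have := measurable_nextPoint hv hu₀ n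
    exact (measurable_update_history n).comp (by fun_prop : Measurable fun w : ℕ → ℝ × ℝ × ℝ =>
      (history v u₀ w n, (w n).1, nextPoint v u₀ n (history v u₀ w n, w n)))

theorem history_congr {w w' : ℕ → ℝ × ℝ × ℝ} {n : ℕ} (h : ∀ k < n, w k = w' k) :
    history v u₀ w n = history v u₀ w' n := by
  induction n with
  | zero => rfl
  | succ n ih =>
    rw [history, history, ih fun k hk => h k (hk.trans n.lt_succ_self), h n n.lt_succ_self]

theorem history_apply_of_lt (w : ℕ → ℝ × ℝ × ℝ) {n m : ℕ} (hnm : n ≤ m) :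
    ∀ k < n, history v u₀ w m k = history v u₀ w n k := by
  induction m, hnm using Nat.le_induction with
  | base => exact fun _ _ => rfl
  | succ m hm ih => exact fun k hk => (update_apply_of_lt _ m _ k (hk.trans_le hm)).trans (ih k hk)

theorem history_mem_and_potentialSeq_eq (hv : 0 < v) (hu₀ : IsPeaked u₀ 0 0)
    {w : ℕ → ℝ × ℝ × ℝ} (hw : ∀ k, 0 ≤ (w k).1 ∧ 0 < (w k).2.1) (n : ℕ) :
    history v u₀ w n ∈ nonnegServices n ∧
      potentialSeq v u₀ w n = potentialAlong v u₀ (history v u₀ w n) n := by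
  induction n with
  | zero => exact ⟨fun k hk => absurd hk k.not_lt_zero, rfl⟩
  | succ n ih =>
    obtain ⟨hmem, heq⟩ := ih
    set σ := history v u₀ w n
    have hpeaked := hu₀.potentialAlong hv hmem
    have hsucc : history v u₀ w (n + 1) =
        Function.update σ n ((w n).1, newPoint (w n) (potentialAlong v u₀ σ n)) :=
      congrArg (fun y => Function.update σ n ((w n).1, y))
        (nextPoint_eq hmem (hw n).1 (hw n).2)
    have hagree := update_apply_of_lt σ n ((w n).1, newPoint (w n) (potentialAlong v u₀ σ n))
    refine ⟨?_, ?_⟩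
    · rw [hsucc, mem_nonnegServices_succ, mem_nonnegServices_congr hagree, Function.update_self]
      exact ⟨hmem, (hw n).1⟩
    · rw [potentialSeq, heq, hsucc]
      funext s
      rw [hpeaked.step_eq (hw n).1 (hw n).2]
      simp only [potentialAlong, startTime]
      rw [position_congr hagree, startTime_congr hagree, potentialAlong_congr hagree,
        Function.update_self]

theorem ae_expMeasure_pos : ∀ᵐ E ∂(expMeasure 1), 0 < E := by
  have hIic : expMeasure 1 (Iic 0) = 0 := by
    rw [← lintegral_indicator_one measurableSet_Iic, lintegral_expMeasure]
    refine (setLIntegral_congr_fun measurableSet_Ioi fun E hE => ?_).trans lintegral_zero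
    rw [indicator_of_notMem (notMem_Iic.2 hE), mul_zero]
  filter_upwards [measure_eq_zero_iff_ae_notMem.1 hIic] with E hE
  exact not_le.1 hE

/-- The law of a triple `w = (T, E, U)`. -/
noncomputable abbrev tripleLaw (τ : Measure ℝ) : Measure (ℝ × ℝ × ℝ) :=
  τ.prod ((expMeasure 1).prod (volume.restrict (Icc (0 : ℝ) 1)))

theorem lintegral_nextPoint {τ : Measure ℝ} (hv : 0 < v) (hu₀ : IsPeaked u₀ 0 0)
    (hτ : ∀ᵐ s ∂τ, 0 ≤ s) {n : ℕ} {σ : ℕ → ℝ × ℝ} (hσ : σ ∈ nonnegServices n)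
    {f : ℝ × ℝ → ℝ≥0∞} (hf : Measurable f) :
    ∫⁻ q, f (q.1, nextPoint v u₀ n (σ, q)) ∂(tripleLaw τ) =
      ∫⁻ T, (∫⁻ y, stepDensity v u₀ n (σ, T, y) * f (T, y)) ∂τ := by
  have := isProbabilityMeasure_expMeasure one_pos
  have := measurable_nextPoint hv hu₀ n
  rw [lintegral_prod _ (by fun_prop)]
  refine lintegral_congr_ae ?_
  filter_upwards [hτ] with T hT
  rw [lintegral_prod _ (by fun_prop)]
  refine Eq.trans (lintegral_congr_ae ?_)
    ((hu₀.potentialAlong hv hσ).lintegral_newPoint hT (φ := fun y => f (T, y)) (by fun_prop))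
  filter_upwards [ae_expMeasure_pos] with E hE
  refine lintegral_congr fun U => ?_
  rw [nextPoint_eq hσ hT hE]

theorem indepFun_of_forall_lt {Ω α β : Type*} [MeasurableSpace Ω] [MeasurableSpace α] [Nonempty α]
    [MeasurableSpace β] {P : Measure Ω} {X : ℕ → Ω → α} (hX : iIndepFun X P)
    (hXm : ∀ k, AEMeasurable (X k) P) {n : ℕ} {g : (ℕ → α) → β} (hg : Measurable g)
    (hcongr : ∀ w w' : ℕ → α, (∀ k < n, w k = w' k) → g w = g w') :
    IndepFun (fun ω => g fun k => X k ω) (X n) P := by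
  obtain ⟨a₀⟩ := ‹Nonempty α›
  let extend : (Finset.range n → α) → ℕ → α := fun a k =>
    if h : k ∈ Finset.range n then a ⟨k, h⟩ else a₀
  have hextend : Measurable extend := by
    refine measurable_pi_lambda _ fun k => ?_
    by_cases h : k ∈ Finset.range n
    · simpa only [extend, dif_pos h] using measurable_pi_apply _
    · simpa only [extend, dif_neg h] using measurable_const
  refine ((hX.indepFun_finset₀ (Finset.range n) {n} (by simp) hXm).comp (hg.comp hextend)
    (measurable_pi_apply (⟨n, Finset.mem_singleton_self n⟩ : ({n} : Finset ℕ)))).congr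
    (Eventually.of_forall fun ω => hcongr _ _ fun k hk => ?_) (Eventually.of_forall fun ω => rfl)
  exact dif_pos (Finset.mem_range.2 hk)

variable {Ω' : Type*} [MeasurableSpace Ω'] {P' : Measure Ω'} {τ : Measure ℝ}
  {w : ℕ → Ω' → ℝ × ℝ × ℝ}

theorem ae_nonneg_and_pos (hτ : ∀ᵐ s ∂τ, 0 ≤ s)
    (hw_law : ∀ n, HasLaw (w n) (tripleLaw τ) P') :
    ∀ᵐ ω ∂P', ∀ k, 0 ≤ (w k ω).1 ∧ 0 < (w k ω).2.1 := by
  have := isProbabilityMeasure_expMeasure one_pos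
  have hT : ∀ᵐ q ∂(tripleLaw τ), 0 ≤ q.1 := Measure.quasiMeasurePreserving_fst.ae hτ
  have hE : ∀ᵐ q ∂(tripleLaw τ), 0 < q.2.1 :=
    Measure.quasiMeasurePreserving_snd.ae (Measure.quasiMeasurePreserving_fst.ae ae_expMeasure_pos)
  refine ae_all_iff.2 fun k =>
    ae_of_ae_map (p := fun q => 0 ≤ q.1 ∧ 0 < q.2.1) (hw_law k).aemeasurable ?_
  rw [(hw_law k).map_eq]
  exact hT.and hE

theorem hasLaw_history [IsProbabilityMeasure P'] [IsProbabilityMeasure τ] (hv : 0 < v)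
    (hu₀ : IsPeaked u₀ 0 0) (hτ : ∀ᵐ s ∂τ, 0 ≤ s)
    (hw_law : ∀ n, HasLaw (w n) (tripleLaw τ) P') (hw_indep : iIndepFun w P') (n : ℕ) :
    HasLaw (fun ω => history v u₀ (fun k => w k ω) n) (historyLaw v u₀ τ n) P' := by
  have := isProbabilityMeasure_expMeasure one_pos
  have hwm (k : ℕ) : AEMeasurable (w k) P' := (hw_law k).aemeasurable
  have hmeas (n : ℕ) : AEMeasurable (fun ω => history v u₀ (fun k => w k ω) n) P' :=
    (measurable_history hv hu₀ n).comp_aemeasurable (aemeasurable_pi_lambda _ hwm)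
  induction n with
  | zero =>
    refine ⟨hmeas 0, Measure.map_const P' 0 |>.trans ?_⟩
    rw [measure_univ, one_smul, historyLaw]
  | succ n ih =>
    refine ⟨hmeas (n + 1), Measure.ext_of_lintegral _ fun f hf => ?_⟩
    have hind : IndepFun (fun ω => history v u₀ (fun k => w k ω) n) (w n) P' :=
      indepFun_of_forall_lt hw_indep hwm (measurable_history hv hu₀ n) fun _ _ => history_congr
    have hnonneg : ∀ᵐ σ ∂(historyLaw v u₀ τ n), σ ∈ nonnegServices n := by
      rw [← ih.map_eq]
      refine (ae_map_iff (p := (· ∈ nonnegServices n)) (hmeas n)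
        (measurableSet_nonnegServices n)).2 ?_
      filter_upwards [ae_nonneg_and_pos hτ hw_law] with ω hω
      exact (history_mem_and_potentialSeq_eq hv hu₀ hω n).1
    have hfu := hf.comp (measurable_update_history n)
    have hg : Measurable fun q : (ℕ → ℝ × ℝ) × ℝ × ℝ × ℝ =>
        f (Function.update q.1 n (q.2.1, nextPoint v u₀ n q)) := by
      have := measurable_nextPoint hv hu₀ n
      exact hfu.comp (by fun_prop :
        Measurable fun q : (ℕ → ℝ × ℝ) × ℝ × ℝ × ℝ => (q.1, q.2.1, nextPoint v u₀ n q))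
    rw [lintegral_historyLaw_succ v hu₀.measurable n hf]
    calc ∫⁻ σ, f σ ∂(P'.map fun ω => history v u₀ (fun k => w k ω) (n + 1))
        = ∫⁻ q, f (Function.update q.1 n (q.2.1, nextPoint v u₀ n q))
            ∂((historyLaw v u₀ τ n).prod (tripleLaw τ)) := by
          rw [lintegral_map' hf.aemeasurable (hmeas (n + 1)), ← ih.map_eq, ← (hw_law n).map_eq,
            ← hind.map_prod_eq_prod_map_map (hmeas n) (hwm n),
            lintegral_map' hg.aemeasurable ((hmeas n).prodMk (hwm n))]
          rfl
      _ = _ := by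
          rw [lintegral_prod _ hg.aemeasurable]
          refine lintegral_congr_ae ?_
          filter_upwards [hnonneg] with σ hσ
          exact lintegral_nextPoint hv hu₀ hτ hσ (hfu.comp measurable_prodMk_left)

end HistoryLaw

/-! ### The explored region -/

section ExploredRegion

/-- The customers (given by position and arrival time) that would have been preferred at one of the
first `n` choices along the history `σ`. -/
def exploredRegion (v : ℝ) (σ : ℕ → ℝ × ℝ) (n : ℕ) : Set (ℝ × ℝ) :=
  {q | ∃ j < n, |q.1 - position σ j| < |(σ j).2 - position σ j| ∧ q.2 < startTime v σ j + (σ j).1}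

variable {v : ℝ} {u₀ : ℝ → ℝ} {σ σ' : ℕ → ℝ × ℝ} {n : ℕ}

theorem exploredRegion_zero : exploredRegion v σ 0 = ∅ :=
  eq_empty_of_forall_notMem fun _ ⟨j, hj, _⟩ => j.not_lt_zero hj

theorem mem_exploredRegion_succ {q : ℝ × ℝ} :
    q ∈ exploredRegion v σ (n + 1) ↔ q ∈ exploredRegion v σ n ∨
      |q.1 - position σ n| < |(σ n).2 - position σ n| ∧ q.2 < startTime v σ n + (σ n).1 := by
  constructor
  · rintro ⟨j, hj, h⟩
    rcases Nat.lt_succ_iff_lt_or_eq.1 hj with hj | rfl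
    exacts [Or.inl ⟨j, hj, h⟩, Or.inr h]
  · rintro (⟨j, hj, h⟩ | h)
    exacts [⟨j, hj.trans n.lt_succ_self, h⟩, ⟨n, n.lt_succ_self, h⟩]

theorem exploredRegion_congr (h : ∀ k < n, σ k = σ' k) :
    exploredRegion v σ n = exploredRegion v σ' n := by
  ext q
  refine exists_congr fun j => and_congr_right fun hj => ?_
  have h' : ∀ k < j, σ k = σ' k := fun k hk => h k (hk.trans hj)
  rw [h j hj, position_congr h', startTime_congr h']

theorem isOpen_setOf_mem_exploredRegion (v : ℝ) (n : ℕ) :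
    IsOpen {p : (ℕ → ℝ × ℝ) × ℝ × ℝ | p.2 ∈ exploredRegion v p.1 n} := by
  have hunion : {p : (ℕ → ℝ × ℝ) × ℝ × ℝ | p.2 ∈ exploredRegion v p.1 n} = ⋃ j, ⋃ (_ : j < n),
      {p | |p.2.1 - position p.1 j| < |(p.1 j).2 - position p.1 j|} ∩
      {p | p.2.2 < startTime v p.1 j + (p.1 j).1} := by
    ext p
    simp only [exploredRegion, mem_ofPred_eq, mem_iUnion, mem_inter_iff, exists_prop]
  rw [hunion]
  refine isOpen_iUnion fun j => isOpen_iUnion fun _ => ?_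
  have hpos := continuous_position j
  have htime := continuous_startTime v j
  exact (isOpen_lt (by fun_prop) (by fun_prop)).inter (isOpen_lt (by fun_prop) (by fun_prop))

theorem measurableSet_exploredRegion (v : ℝ) (σ : ℕ → ℝ × ℝ) (n : ℕ) :
    MeasurableSet (exploredRegion v σ n) :=
  ((isOpen_setOf_mem_exploredRegion v n).preimage
    (by fun_prop : Continuous fun q : ℝ × ℝ => (σ, q))).measurableSet

theorem startTime_add_le_succ (hv : 0 < v) (σ : ℕ → ℝ × ℝ) (n : ℕ) :
    startTime v σ n + (σ n).1 ≤ startTime v σ (n + 1) :=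
  le_add_of_nonneg_right (by positivity)

theorem startTime_add_le (hv : 0 < v) (hσ : σ ∈ nonnegServices n) {j : ℕ} (hj : j < n) :
    startTime v σ j + (σ j).1 ≤ startTime v σ n := by
  induction n with
  | zero => exact absurd hj j.not_lt_zero
  | succ n ih =>
    rw [mem_nonnegServices_succ] at hσ
    rcases Nat.lt_succ_iff_lt_or_eq.1 hj with hj | rfl
    · linarith [ih hσ.1 hj, startTime_add_le_succ hv σ n, hσ.2]
    · exact startTime_add_le_succ hv σ j

theorem startTime_nonneg (hv : 0 < v) (hσ : σ ∈ nonnegServices n) : 0 ≤ startTime v σ n := by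
  induction n with
  | zero => exact le_rfl
  | succ n ih =>
    rw [mem_nonnegServices_succ] at hσ
    linarith [ih hσ.1, startTime_add_le_succ hv σ n, hσ.2]

/-- The potential is the time up to which a position is explored, as long as it has been explored
at all. -/
theorem exploredRegion_fiber (hv : 0 < v) (u₀ : ℝ → ℝ) (hσ : σ ∈ nonnegServices n) {s : ℝ}
    (hs : ∀ k < n, |s - position σ k| ≠ |(σ k).2 - position σ k|) :
    (0 ≤ potentialAlong v u₀ σ n s ∧
        ∀ r, (s, r) ∈ exploredRegion v σ n ↔ r < potentialAlong v u₀ σ n s) ∨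
      potentialAlong v u₀ σ n s = u₀ s ∧ ∀ r, (s, r) ∉ exploredRegion v σ n := by
  induction n with
  | zero => exact Or.inr ⟨rfl, fun r => by simp only [exploredRegion_zero, notMem_empty,
      not_false_eq_true]⟩
  | succ n ih =>
    obtain ⟨hσ', hT⟩ := mem_nonnegServices_succ.1 hσ
    have hsy : s ≠ (σ n).2 := fun h => hs n n.lt_succ_self (by rw [h])
    simp only [mem_exploredRegion_succ, potentialAlong, if_neg hsy]
    rcases lt_or_gt_of_ne (hs n n.lt_succ_self) with hnear | hfar
    · simp only [if_pos hnear.le, hnear, true_and]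
      refine Or.inl ⟨add_nonneg (startTime_nonneg hv hσ') hT, fun r => or_iff_right_of_imp ?_⟩
      rintro ⟨j, hj, -, hr⟩
      exact hr.trans_le ((startTime_add_le hv hσ' hj).trans (le_add_of_nonneg_right hT))
    · simp only [if_neg hfar.not_ge, hfar.not_gt, false_and, or_false]
      exact ih hσ' fun k hk => hs k (hk.trans n.lt_succ_self)

end ExploredRegion

/-! ### The intensity of the unexplored customers -/

section Unexplored

variable {v : ℝ} {u₀ : ℝ → ℝ} {σ : ℕ → ℝ × ℝ} {n : ℕ}

/-- The intensity measure of the customers present at time `0`. -/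
noncomputable def initMeasure (u₀ : ℝ → ℝ) : Measure ℝ :=
  volume.withDensity fun x => ENNReal.ofReal (-u₀ x)

theorem intensity_initMeasure_apply (hu₀ : Measurable u₀) {B : Set (ℝ × ℝ)}
    (hB : MeasurableSet B) : intensity (initMeasure u₀) B = ∫⁻ s,
      (((fun x => (x, (-1 : ℝ))) ⁻¹' B).indicator (fun x => ENNReal.ofReal (-u₀ x)) s +
        volume {r | (s, r) ∈ B ∧ 0 < r}) := by
  have hB' := measurableSet_preimage_prodMk_neg_one hB
  have hdensity : Measurable fun x => ENNReal.ofReal (-u₀ x) := by fun_prop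
  rw [intensity_apply _ hB, initMeasure, withDensity_apply _ hB', ← lintegral_indicator hB',
    Measure.volume_eq_prod, Measure.prod_apply (hB.inter measurableSet_snd_pos),
    lintegral_add_left (hdensity.indicator hB')]
  rfl

theorem IsPeaked.initMeasure_Icc_lt_top {u : ℝ → ℝ} {x M : ℝ} (h : IsPeaked u x M) (a b : ℝ) :
    initMeasure u (Icc a b) < ∞ := by
  rw [initMeasure, withDensity_apply _ measurableSet_Icc]
  rcases le_or_gt a b with hab | hab
  · exact ((intervalIntegrable_iff_integrableOn_Icc_of_le hab).1
      (h.intervalIntegrable a b)).neg.lintegral_lt_top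
  · rw [Icc_eq_empty hab.not_ge, Measure.restrict_empty, lintegral_zero_measure]
    exact ENNReal.zero_lt_top

theorem IsPeaked.isLocallyFiniteMeasure_intensity {x M : ℝ} (h : IsPeaked u₀ x M) :
    IsLocallyFiniteMeasure (intensity (initMeasure u₀)) := by
  refine ⟨fun p => ⟨Icc (p.1 - 1) (p.1 + 1) ×ˢ Icc (p.2 - 1) (p.2 + 1), ?_, ?_⟩⟩
  · exact prod_mem_nhds (Icc_mem_nhds (by linarith) (by linarith))
      (Icc_mem_nhds (by linarith) (by linarith))
  · rw [intensity_apply _ (measurableSet_Icc.prod measurableSet_Icc)]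
    refine ENNReal.add_lt_top.2 ⟨?_, (measure_mono inter_subset_left).trans_lt ?_⟩
    · exact (measure_mono fun s hs => hs.1).trans_lt (h.initMeasure_Icc_lt_top _ _)
    · rw [Measure.volume_eq_prod, Measure.prod_prod]
      exact ENNReal.mul_lt_top measure_Icc_lt_top measure_Icc_lt_top

theorem nullSingletonClass_intensity : NullSingletonClass (intensity (initMeasure u₀)) := by
  refine ⟨fun p => ?_⟩
  rw [intensity_apply _ (measurableSet_singleton p), add_eq_zero]
  refine ⟨measure_mono_null (t := {p.1}) (fun s hs => congrArg Prod.fst hs) ?_,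
    measure_mono_null inter_subset_left (measure_singleton p)⟩
  exact withDensity_absolutelyContinuous _ _ (measure_singleton _)

theorem intensity_setOf_snd_eq {c : ℝ} (hc : 0 ≤ c) :
    intensity (initMeasure u₀) {p | p.2 = c} = 0 := by
  rw [intensity_apply _ (measurableSet_eq_fun measurable_snd measurable_const), add_eq_zero]
  have hpreimage : (fun x : ℝ => (x, (-1 : ℝ))) ⁻¹' {p | p.2 = c} = ∅ :=
    eq_empty_of_forall_notMem fun _ (hx : (-1 : ℝ) = c) => by linarith
  refine ⟨by rw [hpreimage, measure_empty], measure_mono_null inter_subset_left ?_⟩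
  rw [show {p : ℝ × ℝ | p.2 = c} = univ ×ˢ {c} by ext p; simp, Measure.volume_eq_prod,
    Measure.prod_prod, measure_singleton, mul_zero]

theorem ae_abs_sub_position_ne (σ : ℕ → ℝ × ℝ) (n : ℕ) :
    ∀ᵐ s : ℝ, ∀ k < n, |s - position σ k| ≠ |(σ k).2 - position σ k| := by
  refine ae_all_iff.2 fun k => ?_
  filter_upwards [Measure.ae_ne volume (position σ k + |(σ k).2 - position σ k|),
    Measure.ae_ne volume (position σ k - |(σ k).2 - position σ k|)] with s hs hs' _ heq
  rcases abs_choice (s - position σ k) with h | h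
  · exact hs (by linarith)
  · exact hs' (by linarith)

theorem measurableSet_unexplored (v : ℝ) (σ : ℕ → ℝ × ℝ) (n : ℕ) (c : ℝ) :
    MeasurableSet ({p | p.2 ≤ c} \ exploredRegion v σ n) :=
  (measurableSet_le measurable_snd measurable_const).diff (measurableSet_exploredRegion v σ n)

theorem unexplored_fiber_add (hv : 0 < v) (hu₀ : ∀ s, u₀ s ≤ 0) (hσ : σ ∈ nonnegServices n)
    {c s : ℝ} (hc : 0 ≤ c) (hs : ∀ k < n, |s - position σ k| ≠ |(σ k).2 - position σ k|) :
    ((fun x => (x, (-1 : ℝ))) ⁻¹' ({p | p.2 ≤ c} \ exploredRegion v σ n)).indicator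
        (fun x => ENNReal.ofReal (-u₀ x)) s +
      volume {r | (s, r) ∈ {p | p.2 ≤ c} \ exploredRegion v σ n ∧ 0 < r} =
    ENNReal.ofReal (c - potentialAlong v u₀ σ n s) := by
  rcases exploredRegion_fiber hv u₀ hσ hs with ⟨hpot, hmem⟩ | ⟨hpot, hmem⟩
  · rw [indicator_of_notMem fun h => h.2 ((hmem _).2 (by linarith)), zero_add, ← Real.volume_Ioc]
    refine measure_congr ?_
    filter_upwards [Measure.ae_ne volume (potentialAlong v u₀ σ n s)] with r hr
    refine propext ⟨fun h => ⟨?_, h.1.1⟩, fun h => ⟨⟨h.2, ?_⟩, hpot.trans_lt h.1⟩⟩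
    · exact lt_of_le_of_ne (not_lt.1 fun hr' => h.1.2 ((hmem r).2 hr')) hr.symm
    · exact fun hr' => h.1.not_gt ((hmem r).1 hr')
  · have hIoc : {r | (s, r) ∈ {p | p.2 ≤ c} \ exploredRegion v σ n ∧ 0 < r} = Ioc 0 c :=
      ext fun r => ⟨fun h => ⟨h.2, h.1.1⟩, fun h => ⟨⟨h.2, hmem r⟩, h.1⟩⟩
    have hpresent : s ∈ (fun x => (x, (-1 : ℝ))) ⁻¹' ({p | p.2 ≤ c} \ exploredRegion v σ n) :=
      ⟨show (-1 : ℝ) ≤ c by linarith, hmem _⟩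
    rw [hIoc, indicator_of_mem hpresent, Real.volume_Ioc, hpot,
      ← ENNReal.ofReal_add (by linarith [hu₀ s]) (by linarith)]
    congr 1
    ring

theorem map_fst_intensity_unexplored (hv : 0 < v) (hu₀ : IsPeaked u₀ 0 0)
    (hσ : σ ∈ nonnegServices n) {c : ℝ} (hc : 0 ≤ c) :
    ((intensity (initMeasure u₀)).restrict ({p | p.2 ≤ c} \ exploredRegion v σ n)).map Prod.fst =
      volume.withDensity fun s => ENNReal.ofReal (c - potentialAlong v u₀ σ n s) := by
  classical
  have hU := measurableSet_unexplored v σ n c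
  refine Measure.ext fun B hB => ?_
  rw [Measure.map_apply measurable_fst hB, Measure.restrict_apply (measurable_fst hB),
    intensity_initMeasure_apply hu₀.measurable ((measurable_fst hB).inter hU),
    withDensity_apply _ hB, ← lintegral_indicator hB]
  refine lintegral_congr_ae ?_
  filter_upwards [ae_abs_sub_position_ne σ n] with s hs
  by_cases hsB : s ∈ B
  · rw [indicator_of_mem hsB, ← unexplored_fiber_add hv hu₀.le hσ hc hs]
    simp only [indicator_apply, mem_preimage, mem_inter_iff, hsB, true_and]
  · simp only [indicator_apply, mem_preimage, mem_inter_iff, hsB, false_and, if_false, zero_add,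
      ofPred_false, measure_empty]

theorem setLIntegral_unexplored (hv : 0 < v) (hu₀ : IsPeaked u₀ 0 0) (hσ : σ ∈ nonnegServices n)
    {c : ℝ} (hc : 0 ≤ c) {φ : ℝ → ℝ≥0∞} (hφ : Measurable φ) :
    ∫⁻ p in {p | p.2 ≤ c} \ exploredRegion v σ n, φ p.1 ∂(intensity (initMeasure u₀)) =
      ∫⁻ s, ENNReal.ofReal (c - potentialAlong v u₀ σ n s) * φ s := by
  have hpot : Measurable (potentialAlong v u₀ σ n) :=
    (measurable_potentialAlong v hu₀.measurable n).comp measurable_prodMk_left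
  rw [← lintegral_map hφ measurable_fst, map_fst_intensity_unexplored hv hu₀ hσ hc]
  exact lintegral_withDensity_eq_lintegral_mul _ (by fun_prop) hφ

theorem intensity_newlyExplored (hv : 0 < v) (hu₀ : IsPeaked u₀ 0 0) (hσ : σ ∈ nonnegServices n)
    {T z : ℝ} (hT : 0 ≤ T) (hz : 0 ≤ z) :
    intensity (initMeasure u₀)
        ({q | |q.1 - position σ n| < z ∧ q.2 < startTime v σ n + T} \ exploredRegion v σ n) =
      ENNReal.ofReal (area (potentialAlong v u₀ σ n) (position σ n) (startTime v σ n) T z) := by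
  have hpeaked := hu₀.potentialAlong hv hσ
  set x := position σ n
  set c := startTime v σ n + T
  have hc : 0 ≤ c := add_nonneg (startTime_nonneg hv hσ) hT
  let newlyExplored : Set (ℝ × ℝ) := {q | |q.1 - x| < z ∧ q.2 < c} \ exploredRegion v σ n
  let unexplored : Set (ℝ × ℝ) := {p | p.2 ≤ c} \ exploredRegion v σ n
  have hae : newlyExplored =ᵐ[intensity (initMeasure u₀)]
      (Prod.fst ⁻¹' Ioo (x - z) (x + z) ∩ unexplored : Set (ℝ × ℝ)) := by
    filter_upwards [measure_eq_zero_iff_ae_notMem.1 (intensity_setOf_snd_eq hc)] with p hp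
    have hIoo : |p.1 - x| < z ↔ p.1 ∈ Ioo (x - z) (x + z) := by
      rw [← Real.ball_eq_Ioo, Metric.mem_ball, Real.dist_eq]
    exact propext ⟨fun h => ⟨hIoo.1 h.1.1, h.1.2.le, h.2⟩,
      fun h => ⟨⟨hIoo.2 h.1, lt_of_le_of_ne h.2.1 hp⟩, h.2.2⟩⟩
  have hfst : MeasurableSet (Prod.fst ⁻¹' Ioo (x - z) (x + z) : Set (ℝ × ℝ)) :=
    measurable_fst measurableSet_Ioo
  rw [measure_congr hae, ← Measure.restrict_apply hfst,
    ← Measure.map_apply measurable_fst measurableSet_Ioo,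
    map_fst_intensity_unexplored hv hu₀ hσ hc, withDensity_apply _ measurableSet_Ioo,
    setLIntegral_congr Ioo_ae_eq_Ioc, area, intervalIntegral.integral_of_le (by linarith),
    ofReal_integral_eq_lintegral_ofReal (hpeaked.intervalIntegrable_sub T _ _).1
      (Eventually.of_forall fun s => hpeaked.sub_nonneg hT s)]

theorem intensity_exploredRegion_succ (hv : 0 < v) (hu₀ : IsPeaked u₀ 0 0)
    (hσ : σ ∈ nonnegServices (n + 1)) :
    intensity (initMeasure u₀) (exploredRegion v σ (n + 1)) =
      intensity (initMeasure u₀) (exploredRegion v σ n) +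
        ENNReal.ofReal (area (potentialAlong v u₀ σ n) (position σ n) (startTime v σ n) (σ n).1
          |(σ n).2 - position σ n|) := by
  rw [mem_nonnegServices_succ] at hσ
  rw [← intensity_newlyExplored hv hu₀ hσ.1 hσ.2 (abs_nonneg _),
    ← measure_union' disjoint_sdiff_self_right (measurableSet_exploredRegion v σ n),
    union_sdiff_self]
  exact congrArg _ (ext fun _ => mem_exploredRegion_succ)

theorem intensity_exploredRegion_ne_top (hv : 0 < v) (hu₀ : IsPeaked u₀ 0 0)
    (hσ : σ ∈ nonnegServices n) : intensity (initMeasure u₀) (exploredRegion v σ n) ≠ ∞ := by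
  induction n with
  | zero => rw [exploredRegion_zero, measure_empty]; exact ENNReal.zero_ne_top
  | succ n ih =>
    rw [intensity_exploredRegion_succ hv hu₀ hσ]
    exact ENNReal.add_ne_top.2 ⟨ih (mem_nonnegServices_succ.1 hσ).1, ENNReal.ofReal_ne_top⟩

end Unexplored

/-! ### Paths of service times and customers -/

section PathHistory

/-- The history of a finite path of service times and customers (position, arrival time), continued
by zeros. -/
def pathHistory {n : ℕ} (h : Fin n → ℝ × ℝ × ℝ) : ℕ → ℝ × ℝ := fun k =>
  if hk : k < n then ((h ⟨k, hk⟩).1, (h ⟨k, hk⟩).2.1) else 0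

/-- The paths along which every chosen customer arrives before its choice and lies outside the
region explored by the earlier choices. -/
def feasiblePaths (v : ℝ) (n : ℕ) : Set (Fin n → ℝ × ℝ × ℝ) :=
  {h | ∀ k : Fin n, 0 ≤ (h k).1 ∧ (h k).2.2 ≤ startTime v (pathHistory h) k + (h k).1 ∧
    (h k).2 ∉ exploredRegion v (pathHistory h) k}

variable {v : ℝ} {n : ℕ} {h : Fin n → ℝ × ℝ × ℝ}

theorem pathHistory_zero (h : Fin 0 → ℝ × ℝ × ℝ) : pathHistory h = 0 :=
  funext fun k => dif_neg k.not_lt_zero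

theorem pathHistory_apply (h : Fin n → ℝ × ℝ × ℝ) (k : Fin n) :
    pathHistory h k = ((h k).1, (h k).2.1) :=
  dif_pos k.2

theorem pathHistory_snoc (h : Fin n → ℝ × ℝ × ℝ) (x : ℝ × ℝ × ℝ) :
    pathHistory (Fin.snoc h x : Fin (n + 1) → ℝ × ℝ × ℝ) =
      Function.update (pathHistory h) n (x.1, x.2.1) := by
  funext k
  rcases lt_trichotomy k n with hk | rfl | hk
  · rw [Function.update_of_ne hk.ne, pathHistory_apply h ⟨k, hk⟩]
    exact (pathHistory_apply (Fin.snoc h x : Fin (n + 1) → ℝ × ℝ × ℝ) (Fin.castSucc ⟨k, hk⟩)).trans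
      (by rw [Fin.snoc_castSucc])
  · rw [Function.update_self]
    exact (pathHistory_apply (Fin.snoc h x : Fin (k + 1) → ℝ × ℝ × ℝ) (Fin.last k)).trans
      (by rw [Fin.snoc_last])
  · rw [Function.update_of_ne hk.ne', pathHistory, pathHistory, dif_neg (by lia), dif_neg (by lia)]

theorem continuous_pathHistory (n : ℕ) :
    Continuous fun h : Fin n → ℝ × ℝ × ℝ => pathHistory h := by
  refine continuous_pi fun k => ?_
  by_cases hk : k < n
  · simp only [pathHistory, dif_pos hk]
    fun_prop
  · simp only [pathHistory, dif_neg hk]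
    exact continuous_const

theorem isOpen_setOf_mem_exploredRegion_pathHistory (v : ℝ) (n : ℕ) :
    IsOpen {p : (Fin n → ℝ × ℝ × ℝ) × ℝ × ℝ | p.2 ∈ exploredRegion v (pathHistory p.1) n} := by
  have hcont := continuous_pathHistory n
  exact (isOpen_setOf_mem_exploredRegion v n).preimage (by fun_prop :
    Continuous fun p : (Fin n → ℝ × ℝ × ℝ) × ℝ × ℝ => (pathHistory p.1, p.2))

theorem isClosed_feasiblePaths (v : ℝ) (n : ℕ) : IsClosed (feasiblePaths v n) := by
  have hinter : feasiblePaths v n = ⋂ k : Fin n, {h | 0 ≤ (h k).1} ∩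
      ({h | (h k).2.2 ≤ startTime v (pathHistory h) k + (h k).1} ∩
        {h | (h k).2 ∉ exploredRegion v (pathHistory h) k}) := by
    ext h
    simp only [feasiblePaths, mem_ofPred_eq, mem_iInter, mem_inter_iff]
  rw [hinter]
  refine isClosed_iInter fun k => ?_
  have hcont := continuous_pathHistory n
  have htime := (continuous_startTime v k).comp hcont
  refine (isClosed_le (by fun_prop) (by fun_prop)).inter
    ((isClosed_le (by fun_prop) (htime.add (by fun_prop))).inter ?_)
  exact ((isOpen_setOf_mem_exploredRegion v k).preimage (by fun_prop :
    Continuous fun h : Fin n → ℝ × ℝ × ℝ => (pathHistory h, (h k).2))).isClosed_compl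

theorem pathHistory_mem_nonnegServices (hh : h ∈ feasiblePaths v n) :
    pathHistory h ∈ nonnegServices n := by
  intro k hk
  rw [pathHistory_apply h ⟨k, hk⟩]
  exact (hh ⟨k, hk⟩).1

theorem snoc_mem_feasiblePaths {x : ℝ × ℝ × ℝ} :
    (Fin.snoc h x : Fin (n + 1) → ℝ × ℝ × ℝ) ∈ feasiblePaths v (n + 1) ↔
      h ∈ feasiblePaths v n ∧ 0 ≤ x.1 ∧
        x.2 ∈ {p | p.2 ≤ startTime v (pathHistory h) n + x.1} \
          exploredRegion v (pathHistory h) n := by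
  have hagree := update_apply_of_lt (pathHistory h) n (x.1, x.2.1)
  simp only [feasiblePaths, mem_ofPred_eq, Fin.forall_fin_succ', Fin.snoc_castSucc, Fin.snoc_last,
    Fin.val_castSucc, Fin.val_last, pathHistory_snoc, Set.mem_sdiff]
  refine and_congr (forall_congr' fun k => ?_) ?_
  · have hk := fun j (hj : j < (k : ℕ)) => hagree j (hj.trans k.2)
    rw [startTime_congr hk, exploredRegion_congr hk]
  · rw [startTime_congr hagree, exploredRegion_congr hagree]

end PathHistory

theorem measurable_snoc {α : Type*} [MeasurableSpace α] {n : ℕ} (h : Fin n → α) :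
    Measurable fun x : α => (Fin.snoc h x : Fin (n + 1) → α) := by
  refine measurable_pi_lambda _ (Fin.lastCases ?_ fun k => ?_)
  · simp only [Fin.snoc_last]
    exact measurable_id
  · simp only [Fin.snoc_castSucc]
    exact measurable_const

theorem lintegral_pi_snoc {α : Type*} [MeasurableSpace α] (ν : Measure α) [SigmaFinite ν] (n : ℕ)
    {F : (Fin (n + 1) → α) → ℝ≥0∞} (hF : Measurable F) :
    ∫⁻ h, F h ∂(Measure.pi fun _ : Fin (n + 1) => ν) =
      ∫⁻ h, (∫⁻ x, F (Fin.snoc h x) ∂ν) ∂(Measure.pi fun _ : Fin n => ν) := by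
  have hsplit := (measurePreserving_piFinSuccAbove (fun _ : Fin (n + 1) => ν) (Fin.last n)).symm
  rw [← hsplit.lintegral_comp hF]
  refine (lintegral_prod_symm _ (hF.comp hsplit.measurable).aemeasurable).trans ?_
  exact lintegral_congr fun h => lintegral_congr fun x => congrArg F (Fin.insertNth_last' x h)

section PathDensity

/-- The density, with respect to the product of the intensities, with which the greedy server
follows the path `h`: the probability that no customer appears in the region it explores. -/
noncomputable def pathDensity (v : ℝ) (u₀ : ℝ → ℝ) {n : ℕ} (h : Fin n → ℝ × ℝ × ℝ) : ℝ≥0∞ :=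
  (feasiblePaths v n).indicator
    (fun h => expNeg (intensity (initMeasure u₀) (exploredRegion v (pathHistory h) n))) h

variable {v : ℝ} {u₀ : ℝ → ℝ} {n : ℕ} {τ : Measure ℝ}

theorem pathDensity_zero (h : Fin 0 → ℝ × ℝ × ℝ) : pathDensity v u₀ h = 1 := by
  have hfeasible : h ∈ feasiblePaths v 0 := fun k => k.elim0
  rw [pathDensity, indicator_of_mem hfeasible, exploredRegion_zero, measure_empty, expNeg,
    ENNReal.toReal_zero, neg_zero, Real.exp_zero, ENNReal.ofReal_one]

theorem pathDensity_ne_top (h : Fin n → ℝ × ℝ × ℝ) : pathDensity v u₀ h ≠ ∞ :=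
  ne_top_of_le_ne_top ENNReal.one_ne_top
    ((indicator_le_self _ _ h).trans (expNeg_le_one _))

theorem measurable_pathDensity (v : ℝ) (hu₀ : IsPeaked u₀ 0 0) (n : ℕ) :
    Measurable fun h : Fin n → ℝ × ℝ × ℝ => pathDensity v u₀ h := by
  have := hu₀.isLocallyFiniteMeasure_intensity
  refine Measurable.indicator ?_ (isClosed_feasiblePaths v n).measurableSet
  exact measurable_expNeg.comp (measurable_measure_prodMk_left
    (isOpen_setOf_mem_exploredRegion_pathHistory v n).measurableSet)

theorem pathDensity_snoc (hv : 0 < v) (hu₀ : IsPeaked u₀ 0 0) (h : Fin n → ℝ × ℝ × ℝ) {T : ℝ}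
    (hT : 0 ≤ T) (p : ℝ × ℝ) :
    pathDensity v u₀ (Fin.snoc h (T, p) : Fin (n + 1) → ℝ × ℝ × ℝ) = pathDensity v u₀ h *
      ({p : ℝ × ℝ | p.2 ≤ startTime v (pathHistory h) n + T} \
        exploredRegion v (pathHistory h) n).indicator (fun p => ENNReal.ofReal (Real.exp
          (-area (potentialAlong v u₀ (pathHistory h) n) (position (pathHistory h) n)
            (startTime v (pathHistory h) n) T |p.1 - position (pathHistory h) n|))) p := by
  classical
  set σ := pathHistory h with hσ_def
  simp only [pathDensity, indicator_apply, snoc_mem_feasiblePaths, hT, true_and]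
  by_cases hh : h ∈ feasiblePaths v n
  swap
  · simp only [hh, false_and, if_false, zero_mul]
  have hσ : σ ∈ nonnegServices n := pathHistory_mem_nonnegServices hh
  simp only [hh, true_and, if_true, mul_ite, mul_zero, ← hσ_def]
  refine if_congr Iff.rfl ?_ rfl
  have hagree := update_apply_of_lt σ n (T, p.1)
  have hupdate : Function.update σ n (T, p.1) ∈ nonnegServices (n + 1) := by
    rw [mem_nonnegServices_succ, mem_nonnegServices_congr hagree, Function.update_self]
    exact ⟨hσ, hT⟩
  rw [pathHistory_snoc, intensity_exploredRegion_succ hv hu₀ hupdate, exploredRegion_congr hagree,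
    potentialAlong_congr hagree, position_congr hagree, startTime_congr hagree,
    Function.update_self,
    expNeg_add (intensity_exploredRegion_ne_top hv hu₀ hσ) ENNReal.ofReal_ne_top]
  congr 1
  rw [expNeg, ENNReal.toReal_ofReal ((hu₀.potentialAlong hv hσ).area_nonneg hT (abs_nonneg _))]

theorem lintegral_pathDensity_snoc_fiber (hv : 0 < v) (hu₀ : IsPeaked u₀ 0 0)
    {f : (ℕ → ℝ × ℝ) → ℝ≥0∞} (hf : Measurable f) (h : Fin n → ℝ × ℝ × ℝ) {T : ℝ} (hT : 0 ≤ T) :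
    ∫⁻ p, pathDensity v u₀ (Fin.snoc h (T, p) : Fin (n + 1) → ℝ × ℝ × ℝ) *
        f (Function.update (pathHistory h) n (T, p.1)) ∂(intensity (initMeasure u₀)) =
      pathDensity v u₀ h * ∫⁻ y, stepDensity v u₀ n (pathHistory h, T, y) *
        f (Function.update (pathHistory h) n (T, y)) := by
  simp only [pathDensity_snoc hv hu₀ h hT, mul_assoc]
  rw [lintegral_const_mul' _ _ (pathDensity_ne_top h)]
  by_cases hh : h ∈ feasiblePaths v n
  swap
  · rw [pathDensity, indicator_of_notMem hh, zero_mul, zero_mul]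
  set σ := pathHistory h
  have hσ : σ ∈ nonnegServices n := pathHistory_mem_nonnegServices hh
  have harea : Measurable fun y => area (potentialAlong v u₀ σ n) (position σ n)
      (startTime v σ n) T |y - position σ n| :=
    ((hu₀.potentialAlong hv hσ).continuous_area T).measurable.comp (by fun_prop)
  have hupdate : Measurable fun y => f (Function.update σ n (T, y)) :=
    hf.comp ((measurable_update_history n).comp
      (by fun_prop : Measurable fun y : ℝ => (σ, T, y)))
  have hφ : Measurable fun y => ENNReal.ofReal (Real.exp (-area (potentialAlong v u₀ σ n)
      (position σ n) (startTime v σ n) T |y - position σ n|)) * f (Function.update σ n (T, y)) :=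
    (Real.measurable_exp.comp harea.neg).ennreal_ofReal.mul hupdate
  rw [lintegral_congr fun p => (indicator_mul_left _ _ fun p : ℝ × ℝ =>
      f (Function.update σ n (T, p.1))).symm,
    lintegral_indicator (measurableSet_unexplored v σ n _),
    setLIntegral_unexplored hv hu₀ hσ (add_nonneg (startTime_nonneg hv hσ) hT) hφ]
  simp only [stepDensity, mul_assoc]

theorem lintegral_pathDensity_snoc (hv : 0 < v) (hu₀ : IsPeaked u₀ 0 0) (hτ : ∀ᵐ s ∂τ, 0 ≤ s)
    {f : (ℕ → ℝ × ℝ) → ℝ≥0∞} (hf : Measurable f) (h : Fin n → ℝ × ℝ × ℝ) :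
    ∫⁻ x, pathDensity v u₀ (Fin.snoc h x : Fin (n + 1) → ℝ × ℝ × ℝ) *
        f (pathHistory (Fin.snoc h x : Fin (n + 1) → ℝ × ℝ × ℝ))
        ∂(τ.prod (intensity (initMeasure u₀))) =
      pathDensity v u₀ h * ∫⁻ T, (∫⁻ y, stepDensity v u₀ n (pathHistory h, T, y) *
        f (Function.update (pathHistory h) n (T, y))) ∂τ := by
  have := hu₀.isLocallyFiniteMeasure_intensity
  have hmeas : Measurable fun h : Fin (n + 1) → ℝ × ℝ × ℝ =>
      pathDensity v u₀ h * f (pathHistory h) :=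
    (measurable_pathDensity v hu₀ (n + 1)).mul (hf.comp (continuous_pathHistory _).measurable)
  refine (lintegral_prod _ (hmeas.comp (measurable_snoc h)).aemeasurable).trans ?_
  rw [← lintegral_const_mul' _ _ (pathDensity_ne_top h)]
  refine lintegral_congr_ae ?_
  filter_upwards [hτ] with T hT
  simp only [Function.comp_apply, pathHistory_snoc]
  exact lintegral_pathDensity_snoc_fiber hv hu₀ hf h hT

theorem lintegral_pathDensity [SigmaFinite τ] (hv : 0 < v) (hu₀ : IsPeaked u₀ 0 0)
    (hτ : ∀ᵐ s ∂τ, 0 ≤ s) (n : ℕ) {f : (ℕ → ℝ × ℝ) → ℝ≥0∞} (hf : Measurable f) :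
    ∫⁻ h, pathDensity v u₀ h * f (pathHistory h)
        ∂(Measure.pi fun _ : Fin n => τ.prod (intensity (initMeasure u₀))) =
      ∫⁻ σ, f σ ∂(historyLaw v u₀ τ n) := by
  have := hu₀.isLocallyFiniteMeasure_intensity
  induction n generalizing f with
  | zero =>
    simp only [pathDensity_zero, pathHistory_zero, historyLaw, lintegral_dirac' _ hf, one_mul,
      lintegral_const, Measure.pi_univ, Finset.univ_eq_empty, Finset.prod_empty, mul_one]
  | succ n ih =>
    have hmeas : Measurable fun h : Fin (n + 1) → ℝ × ℝ × ℝ =>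
        pathDensity v u₀ h * f (pathHistory h) :=
      (measurable_pathDensity v hu₀ (n + 1)).mul (hf.comp (continuous_pathHistory _).measurable)
    have hstep : Measurable fun q : ((ℕ → ℝ × ℝ) × ℝ) × ℝ =>
        stepDensity v u₀ n (q.1.1, q.1.2, q.2) * f (Function.update q.1.1 n (q.1.2, q.2)) :=
      ((measurable_stepDensity v hu₀.measurable n).mul
        (hf.comp (measurable_update_history n))).comp (by fun_prop :
          Measurable fun q : ((ℕ → ℝ × ℝ) × ℝ) × ℝ => (q.1.1, q.1.2, q.2))
    rw [lintegral_pi_snoc _ n hmeas, lintegral_historyLaw_succ v hu₀.measurable n hf,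
      ← ih hstep.lintegral_prod_right'.lintegral_prod_right']
    exact lintegral_congr fun h => lintegral_pathDensity_snoc hv hu₀ hτ hf h

theorem setLIntegral_expNeg_exploredRegion [SigmaFinite τ] (hv : 0 < v) (hu₀ : IsPeaked u₀ 0 0)
    (hτ : ∀ᵐ s ∂τ, 0 ≤ s) (n : ℕ) {F : Set (ℕ → ℝ × ℝ)} (hF : MeasurableSet F) :
    ∫⁻ h in feasiblePaths v n ∩ pathHistory ⁻¹' F,
        expNeg (intensity (initMeasure u₀) (exploredRegion v (pathHistory h) n))
        ∂(Measure.pi fun _ : Fin n => τ.prod (intensity (initMeasure u₀))) =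
      historyLaw v u₀ τ n F := by
  classical
  rw [← lintegral_indicator_one hF,
    ← lintegral_pathDensity hv hu₀ hτ n (measurable_one.indicator hF),
    ← lintegral_indicator ((isClosed_feasiblePaths v n).measurableSet.inter
      ((continuous_pathHistory n).measurable hF))]
  refine lintegral_congr fun h => ?_
  simp only [pathDensity, indicator_apply, mem_inter_iff, mem_preimage, Pi.one_apply, mul_ite,
    mul_one, mul_zero, ite_and]
  split_ifs <;> rfl

end PathDensity

/- The upper bounds of the path probabilities integrate to the total mass one of `historyLaw`, so
they are attained. -/
theorem hasLaw_pathHistory {Ω : Type*} [MeasurableSpace Ω] {P : Measure Ω}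
    [IsProbabilityMeasure P] {v : ℝ} {u₀ : ℝ → ℝ} {τ : Measure ℝ} [IsLocallyFiniteMeasure τ]
    {n : ℕ} [IsProbabilityMeasure (historyLaw v u₀ τ n)] (hv : 0 < v) (hu₀ : IsPeaked u₀ 0 0)
    (hτ : ∀ᵐ s ∂τ, 0 ≤ s) {A : Ω → Set (ℝ × ℝ)} {T : Fin n → Ω → ℝ}
    (hA : HasHitBound A T τ (intensity (initMeasure u₀)) P) {c : Ω → Fin n → ℝ × ℝ}
    (hc : ∀ᵐ ω ∂P, (∀ k, c ω k ∈ A ω) ∧ Function.Injective (c ω) ∧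
      (fun k => (T k ω, c ω k)) ∈ feasiblePaths v n ∧
      ∀ q ∈ A ω, q ∈ exploredRegion v (pathHistory fun k => (T k ω, c ω k)) n → ∃ k, q = c ω k) :
    HasLaw (fun ω => pathHistory fun k => (T k ω, c ω k)) (historyLaw v u₀ τ n) P := by
  have := hu₀.isLocallyFiniteMeasure_intensity
  have := nullSingletonClass_intensity (u₀ := u₀)
  refine hasLaw_of_forall_isClosed_le fun F hF => ?_
  let K : Set (Fin n → ℝ × ℝ × ℝ) := feasiblePaths v n ∩ pathHistory ⁻¹' F
  have hK : IsClosed K := (isClosed_feasiblePaths v n).inter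
    (hF.preimage (continuous_pathHistory n))
  let R : Set ((Fin n → ℝ × ℝ × ℝ) × ℝ × ℝ) := {p | p.2 ∈ exploredRegion v (pathHistory p.1) n}
  have hsection : ∀ h, {q | (h, q) ∈ R} = exploredRegion v (pathHistory h) n := fun _ => rfl
  have hfin : ∀ h ∈ K, intensity (initMeasure u₀) {q | (h, q) ∈ R} ≠ ∞ := fun h hh => by
    rw [hsection]
    exact intensity_exploredRegion_ne_top hv hu₀ (pathHistory_mem_nonnegServices hh.1)
  have hR : IsOpen R := isOpen_setOf_mem_exploredRegion_pathHistory v n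
  have hbound := hA.measure_pathEvent_le hK hR hfin
  simp only [hsection] at hbound
  rw [setLIntegral_expNeg_exploredRegion hv hu₀ hτ n hF.measurableSet] at hbound
  refine (measure_mono_ae ?_).trans hbound
  filter_upwards [hc] with ω ⟨hmem, hinj, hpath, hexplored⟩ hωF
  exact ⟨c ω, hmem, hinj, ⟨hpath, hωF⟩, hexplored⟩

/-! ### The path of a greedy server -/

section FlagInitial

open Classical in
/-- Replaces the arrival time of a customer present at time `0` by the flag `-1` of
`flaggedCustomers`. -/
noncomputable def flagInitial (q : ℝ × ℝ) : ℝ × ℝ := (q.1, if q.2 ≤ 0 then -1 else q.2)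

variable {init : Set ℝ} {arr : Set (ℝ × ℝ)} {q : ℝ × ℝ}

theorem snd_nonneg_of_mem_customers (harr : ∀ q ∈ arr, 0 < q.2) (hq : q ∈ customers init arr) :
    0 ≤ q.2 := by
  rcases hq with ⟨x, -, rfl⟩ | hq
  exacts [le_rfl, (harr q hq).le]

theorem max_flagInitial_snd (hq : 0 ≤ q.2) : max (flagInitial q).2 0 = q.2 := by
  unfold flagInitial
  split_ifs with h
  · rw [max_eq_right (by norm_num), le_antisymm h hq]
  · exact max_eq_left hq

theorem injOn_flagInitial : InjOn flagInitial {q | 0 ≤ q.2} := fun q hq q' hq' h =>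
  Prod.ext (congrArg Prod.fst h : (flagInitial q).1 = (flagInitial q').1) <| by
    rw [← max_flagInitial_snd hq, ← max_flagInitial_snd hq', h]

theorem image_flagInitial_customers (harr : ∀ q ∈ arr, 0 < q.2) :
    flagInitial '' customers init arr = flaggedCustomers init arr := by
  have hinit : ∀ x, flagInitial (x, 0) = (x, -1) := fun x => by
    rw [flagInitial, if_pos le_rfl]
  have harr' : EqOn flagInitial id arr := fun q hq => by
    rw [flagInitial, if_neg (harr q hq).not_ge, id]
  have hsub : arr ∩ {p | 0 < p.2} = arr := inter_eq_left.2 harr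
  rw [customers, flaggedCustomers, image_union, image_image, harr'.image_eq, image_id, hsub]
  simp only [hinit]

end FlagInitial

/-- The history of a server with service times `T` and chosen customers `c`. -/
def serverHistory (T : ℕ → ℝ) (c : ℕ → ℝ × ℝ) : ℕ → ℝ × ℝ := fun k => (T k, (c k).1)

/-- The path of a server with service times `T` and chosen customers `c` up to service `n`, as a
path of flagged customers. -/
noncomputable def serverPath (T : ℕ → ℝ) (c : ℕ → ℝ × ℝ) (n : ℕ) : Fin n → ℝ × ℝ × ℝ :=
  fun k => (T k, flagInitial (c k))

theorem pathHistory_serverPath (T : ℕ → ℝ) (c : ℕ → ℝ × ℝ) (n : ℕ) :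
    ∀ k < n, pathHistory (serverPath T c n) k = serverHistory T c k :=
  fun k hk => pathHistory_apply (serverPath T c n) ⟨k, hk⟩

namespace IsGreedyServer

variable {v : ℝ} {A : Set (ℝ × ℝ)} {init : Set ℝ} {arr : Set (ℝ × ℝ)} {T t : ℕ → ℝ}
  {c : ℕ → ℝ × ℝ} {𝒮 : ℝ → ℝ} {n : ℕ}

theorem position_time_succ (h : IsGreedyServer v A T t c 𝒮) (hv : 0 < v) (n : ℕ) :
    𝒮 (t (n + 1)) = (c n).1 := by
  have hle : t n + T n ≤ t (n + 1) := by
    rw [h.next_time]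
    exact le_add_of_nonneg_right (by positivity)
  have hdist : v * (t (n + 1) - (t n + T n)) = |(c n).1 - 𝒮 (t n)| := by
    rw [h.next_time, add_sub_cancel_left, mul_div_cancel₀ _ hv.ne']
  rw [h.travel n _ ⟨hle, le_rfl⟩, hdist, sign_mul_abs, add_sub_cancel]

theorem position_serverHistory (h : IsGreedyServer v A T t c 𝒮) (hv : 0 < v) (n : ℕ) :
    position (serverHistory T c) n = 𝒮 (t n) := by
  cases n with
  | zero => rw [h.time_zero, h.pos_zero, position]
  | succ n => rw [h.position_time_succ hv, position, serverHistory]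

theorem startTime_serverHistory (h : IsGreedyServer v A T t c 𝒮) (hv : 0 < v) (n : ℕ) :
    startTime v (serverHistory T c) n = t n := by
  induction n with
  | zero => rw [h.time_zero, startTime]
  | succ n ih => rw [startTime, ih, h.position_serverHistory hv, h.next_time, serverHistory]

theorem injective_chosen (h : IsGreedyServer v A T t c 𝒮) : Function.Injective c :=
  .of_lt_imp_ne fun i j hij => (h.next_waiting j).2.2 i hij

theorem add_serviceTime_nonneg (h : IsGreedyServer v A T t c 𝒮) (hv : 0 < v) (hT : ∀ n, 0 ≤ T n)
    (n : ℕ) : 0 ≤ t n + T n := by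
  have hhist : serverHistory T c ∈ nonnegServices n := fun k _ => hT k
  rw [← h.startTime_serverHistory hv]
  exact add_nonneg (startTime_nonneg hv hhist) (hT n)

theorem exists_eq_of_mem_exploredRegion (h : IsGreedyServer v (customers init arr) T t c 𝒮)
    (hv : 0 < v) (hT : ∀ n, 0 ≤ T n) (harr : ∀ q ∈ arr, 0 < q.2) {q : ℝ × ℝ}
    (hq : q ∈ customers init arr)
    (hexplored : flagInitial q ∈ exploredRegion v (serverHistory T c) n) : ∃ i < n, c i = q := by
  obtain ⟨j, hj, hnear, hearly⟩ := hexplored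
  rw [h.position_serverHistory hv] at hnear
  rw [h.startTime_serverHistory hv] at hearly
  by_contra! hne
  have hpresent : q.2 ≤ t j + T j := by
    rw [← max_flagInitial_snd (snd_nonneg_of_mem_customers harr hq)]
    exact max_le hearly.le (h.add_serviceTime_nonneg hv hT j)
  exact hnear.not_ge (h.next_nearest j q ⟨hq, hpresent, fun k hk => hne k (hk.trans hj)⟩)

theorem serverPath_mem_feasiblePaths (h : IsGreedyServer v (customers init arr) T t c 𝒮)
    (hv : 0 < v) (hT : ∀ n, 0 ≤ T n) (harr : ∀ q ∈ arr, 0 < q.2) (n : ℕ) :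
    serverPath T c n ∈ feasiblePaths v n := by
  intro k
  have hagree := fun j (hj : j < (k : ℕ)) => pathHistory_serverPath T c n j (hj.trans k.2)
  have hck := (h.next_waiting k).1
  rw [startTime_congr hagree, exploredRegion_congr hagree, h.startTime_serverHistory hv]
  refine ⟨hT k, ?_, fun hexplored => ?_⟩
  · calc (flagInitial (c k)).2 ≤ max (flagInitial (c k)).2 0 := le_max_left _ _
      _ = (c k).2 := max_flagInitial_snd (snd_nonneg_of_mem_customers harr hck)
      _ ≤ t k + T k := (h.next_waiting k).2.1
  · obtain ⟨i, hi, hik⟩ := h.exists_eq_of_mem_exploredRegion hv hT harr hck hexplored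
    exact (h.next_waiting k).2.2 i hi hik

theorem flagged_chosen_spec (h : IsGreedyServer v (customers init arr) T t c 𝒮) (hv : 0 < v)
    (hT : ∀ n, 0 ≤ T n) (harr : ∀ q ∈ arr, 0 < q.2) (n : ℕ) :
    (∀ k : Fin n, flagInitial (c k) ∈ flaggedCustomers init arr) ∧
      Function.Injective (fun k : Fin n => flagInitial (c k)) ∧
      serverPath T c n ∈ feasiblePaths v n ∧
      ∀ q ∈ flaggedCustomers init arr, q ∈ exploredRegion v (pathHistory (serverPath T c n)) n →
        ∃ k : Fin n, q = flagInitial (c k) := by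
  rw [← image_flagInitial_customers harr, exploredRegion_congr (pathHistory_serverPath T c n)]
  have hmem : ∀ k, c k ∈ customers init arr := fun k => (h.next_waiting k).1
  refine ⟨fun k => mem_image_of_mem _ (hmem k), fun i j hij => Fin.ext ?_,
    h.serverPath_mem_feasiblePaths hv hT harr n, ?_⟩
  · exact h.injective_chosen (injOn_flagInitial (snd_nonneg_of_mem_customers harr (hmem i))
      (snd_nonneg_of_mem_customers harr (hmem j)) hij)
  · rintro _ ⟨q, hq, rfl⟩ hexplored
    obtain ⟨i, hi, rfl⟩ := h.exists_eq_of_mem_exploredRegion hv hT harr hq hexplored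
    exact ⟨⟨i, hi⟩, rfl⟩

end IsGreedyServer

/-! ### Existence of the greedy server -/

section Trajectory

/-- The position at time `s` of a server that serves at the `n`-th position of the history `σ` until
the end of service `n` and from then on travels, without stopping, in the direction of the next
position. -/
noncomputable def legPosition (v : ℝ) (σ : ℕ → ℝ × ℝ) (n : ℕ) (s : ℝ) : ℝ :=
  position σ n + (SignType.sign ((σ n).2 - position σ n) : ℝ) *
    (v * max 0 (s - (startTime v σ n + (σ n).1)))

variable {v : ℝ} {σ : ℕ → ℝ × ℝ} {n m : ℕ} {s : ℝ}

theorem legPosition_of_le (hs : s ≤ startTime v σ n + (σ n).1) :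
    legPosition v σ n s = position σ n := by
  rw [legPosition, max_eq_left (sub_nonpos.2 hs), mul_zero, mul_zero, add_zero]

theorem legPosition_of_ge (hs : startTime v σ n + (σ n).1 ≤ s) :
    legPosition v σ n s = position σ n +
      (SignType.sign ((σ n).2 - position σ n) : ℝ) * (v * (s - (startTime v σ n + (σ n).1))) := by
  rw [legPosition, max_eq_right (sub_nonneg.2 hs)]

theorem legPosition_startTime_succ (hv : 0 < v) (σ : ℕ → ℝ × ℝ) (n : ℕ) :
    legPosition v σ n (startTime v σ (n + 1)) = position σ (n + 1) := by
  rw [legPosition_of_ge (startTime_add_le_succ hv σ n), startTime, add_sub_cancel_left,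
    mul_div_cancel₀ _ hv.ne', sign_mul_abs, add_sub_cancel, position]

theorem monotone_startTime (hv : 0 < v) (hσ : ∀ n, 0 ≤ (σ n).1) : Monotone (startTime v σ) :=
  monotone_nat_of_le_succ fun n =>
    (le_add_of_nonneg_right (hσ n)).trans (startTime_add_le_succ hv σ n)

theorem position_eq_of_startTime_le (hv : 0 < v) (hσ : ∀ n, 0 ≤ (σ n).1) (hnm : n ≤ m)
    (hle : startTime v σ m ≤ startTime v σ n) : position σ m = position σ n := by
  have hmono := monotone_startTime hv hσ
  induction m, hnm using Nat.le_induction with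
  | base => rfl
  | succ m hnm ih =>
    rw [← ih ((hmono m.le_succ).trans hle), position, ← sub_eq_zero, ← abs_eq_zero]
    have htravel : |(σ m).2 - position σ m| / v ≤ 0 := by
      rw [startTime] at hle
      linarith [hmono hnm, hσ m]
    exact le_antisymm (not_lt.1 fun hpos => htravel.not_gt (div_pos hpos hv)) (abs_nonneg _)

theorem legPosition_eq_legPosition (hv : 0 < v) (hσ : ∀ n, 0 ≤ (σ n).1) (hnm : n < m)
    (hsn : s ≤ startTime v σ (n + 1)) (hsm : startTime v σ m ≤ s) :
    legPosition v σ n s = legPosition v σ m s := by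
  obtain rfl : s = startTime v σ (n + 1) :=
    hsn.antisymm ((monotone_startTime hv hσ hnm).trans hsm)
  have hstart : startTime v σ (n + 1) ≤ startTime v σ m := monotone_startTime hv hσ hnm
  rw [legPosition_startTime_succ hv, legPosition_of_le (hstart.trans (by linarith [hσ m])),
    position_eq_of_startTime_le hv hσ hnm hsm]

theorem exists_forall_eq_legPosition (hv : 0 < v) (hσ : ∀ n, 0 ≤ (σ n).1) :
    ∃ 𝒮 : ℝ → ℝ, ∀ n, ∀ s ∈ Icc (startTime v σ n) (startTime v σ (n + 1)),
      𝒮 s = legPosition v σ n s := by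
  classical
  let 𝒮 : ℝ → ℝ := fun s =>
    if h : ∃ n, s ∈ Icc (startTime v σ n) (startTime v σ (n + 1)) then
      legPosition v σ h.choose s else 0
  refine ⟨𝒮, fun n s hs => ?_⟩
  have hex : ∃ n, s ∈ Icc (startTime v σ n) (startTime v σ (n + 1)) := ⟨n, hs⟩
  have h𝒮 : 𝒮 s = legPosition v σ hex.choose s := dif_pos hex
  rw [h𝒮]
  rcases lt_trichotomy hex.choose n with hlt | heq | hgt
  · exact legPosition_eq_legPosition hv hσ hlt hex.choose_spec.2 hs.1
  · rw [heq]
  · exact (legPosition_eq_legPosition hv hσ hgt hs.2 hex.choose_spec.1).symm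

theorem exists_trajectory (hv : 0 < v) (hσ : ∀ n, 0 ≤ (σ n).1) :
    ∃ 𝒮 : ℝ → ℝ,
      (∀ n, ∀ s ∈ Icc (startTime v σ n) (startTime v σ n + (σ n).1), 𝒮 s = position σ n) ∧
      ∀ n, ∀ s ∈ Icc (startTime v σ n + (σ n).1) (startTime v σ (n + 1)),
        𝒮 s = position σ n + (SignType.sign ((σ n).2 - position σ n) : ℝ) *
          (v * (s - (startTime v σ n + (σ n).1))) := by
  obtain ⟨𝒮, h𝒮⟩ := exists_forall_eq_legPosition hv hσ
  refine ⟨𝒮, fun n s hs => ?_, fun n s hs => ?_⟩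
  · rw [h𝒮 n s ⟨hs.1, hs.2.trans (startTime_add_le_succ hv σ n)⟩, legPosition_of_le hs.2]
  · rw [h𝒮 n s ⟨(le_add_of_nonneg_right (hσ n)).trans hs.1, hs.2⟩, legPosition_of_ge hs.1]

end Trajectory

section GreedyChoice

theorem exists_seq_of_forall_exists {α : Type*} [Nonempty α] {R : ℕ → (ℕ → α) → α → Prop}
    (hR : ∀ n c c', (∀ k < n, c k = c' k) → ∀ x, R n c x → R n c' x)
    (hex : ∀ n c, ∃ x, R n c x) : ∃ c : ℕ → α, ∀ n, R n c (c n) := by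
  classical
  choose f hf using hex
  let extend (n : ℕ) (c : ∀ k < n, α) : ℕ → α := fun k =>
    if h : k < n then c k h else Classical.arbitrary α
  let c : ℕ → α := fun n => n.strongRec fun n ih => f n (extend n ih)
  refine ⟨c, fun n => ?_⟩
  have hc : c n = f n (extend n fun k _ => c k) := Nat.strongRec_eq _ n
  rw [hc]
  exact hR n _ c (fun k hk => dif_pos hk) _ (hf n _)

theorem exists_nearest {W : Set (ℝ × ℝ)} (hne : W.Nonempty)
    (hfin : ∀ r : ℝ, (W ∩ {q | |q.1| ≤ r}).Finite) (x : ℝ) :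
    ∃ q ∈ W, ∀ p ∈ W, |q.1 - x| ≤ |p.1 - x| := by
  obtain ⟨p₀, hp₀⟩ := hne
  have hnear : (W ∩ {q | |q.1 - x| ≤ |p₀.1 - x|}).Finite := by
    refine (hfin (|p₀.1 - x| + |x|)).subset fun q hq => ⟨hq.1, ?_⟩
    calc |q.1| = |q.1 - x + x| := by rw [sub_add_cancel]
      _ ≤ |q.1 - x| + |x| := abs_add_le _ _
      _ ≤ |p₀.1 - x| + |x| := add_le_add hq.2 le_rfl
  obtain ⟨q, hq, hmin⟩ :=
    exists_min_image _ (fun q => |q.1 - x|) hnear ⟨p₀, hp₀, le_refl |p₀.1 - x|⟩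
  refine ⟨q, hq.1, fun p hp => ?_⟩
  rcases le_total |p.1 - x| |p₀.1 - x| with h | h
  · exact hmin p ⟨hp, h⟩
  · exact le_trans hq.2 h

/-- The customer `q` is a nearest waiting one when service `n` of a server with service times `T`
and chosen customers `c` ends. -/
def IsGreedyChoice (v : ℝ) (A : Set (ℝ × ℝ)) (T : ℕ → ℝ) (n : ℕ) (c : ℕ → ℝ × ℝ) (q : ℝ × ℝ) :
    Prop :=
  q ∈ waiting A T (startTime v (serverHistory T c)) c n ∧
    ∀ p ∈ waiting A T (startTime v (serverHistory T c)) c n,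
      |q.1 - position (serverHistory T c) n| ≤ |p.1 - position (serverHistory T c) n|

variable {v : ℝ} {T t t' : ℕ → ℝ} {A : Set (ℝ × ℝ)} {n : ℕ}

theorem waiting_congr {c c' : ℕ → ℝ × ℝ} (ht : t n = t' n) (hc : ∀ k < n, c k = c' k) :
    waiting A T t c n = waiting A T t' c' n := by
  ext p
  rw [waiting, waiting, mem_ofPred_eq, mem_ofPred_eq, ht]
  exact and_congr_right fun _ => and_congr_right fun _ =>
    forall₂_congr fun k hk => by rw [hc k hk]

theorem waiting_nonempty (hinf : (A ∩ {q | q.2 ≤ 0}).Infinite) (ht : 0 ≤ t n + T n)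
    (c : ℕ → ℝ × ℝ) : (waiting A T t c n).Nonempty := by
  obtain ⟨p, hp, hpc⟩ := hinf.exists_notMem_finset ((Finset.range n).image c)
  refine ⟨p, hp.1, le_trans hp.2 ht, fun k hk hck => hpc ?_⟩
  exact Finset.mem_image.2 ⟨k, Finset.mem_range.2 hk, hck⟩

theorem finite_waiting_inter (hfin : ∀ r : ℝ, (A ∩ {q | |q.1| ≤ r ∧ q.2 ≤ r}).Finite)
    (c : ℕ → ℝ × ℝ) (r : ℝ) : (waiting A T t c n ∩ {q | |q.1| ≤ r}).Finite :=
  (hfin (max r (t n + T n))).subset fun _ hq =>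
    ⟨hq.1.1, le_max_of_le_left hq.2, le_max_of_le_right hq.1.2.1⟩

theorem IsGreedyChoice.congr {c c' : ℕ → ℝ × ℝ} {q : ℝ × ℝ} (h : IsGreedyChoice v A T n c q)
    (hc : ∀ k < n, c k = c' k) : IsGreedyChoice v A T n c' q := by
  have hhist : ∀ k < n, serverHistory T c k = serverHistory T c' k := fun k hk => by
    rw [serverHistory, serverHistory, hc k hk]
  rwa [IsGreedyChoice, waiting_congr (startTime_congr hhist) hc, position_congr hhist] at h

theorem exists_isGreedyChoice (hv : 0 < v) (hT : ∀ n, 0 ≤ T n)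
    (hfin : ∀ r : ℝ, (A ∩ {q | |q.1| ≤ r ∧ q.2 ≤ r}).Finite)
    (hinf : (A ∩ {q | q.2 ≤ 0}).Infinite) (c : ℕ → ℝ × ℝ) :
    ∃ q, IsGreedyChoice v A T n c q :=
  have hhist : serverHistory T c ∈ nonnegServices n := fun k _ => hT k
  exists_nearest (waiting_nonempty hinf (add_nonneg (startTime_nonneg hv hhist) (hT n)) c)
    (finite_waiting_inter hfin c) _

theorem exists_isGreedyServer (hv : 0 < v) (hT : ∀ n, 0 ≤ T n)
    (hfin : ∀ r : ℝ, (A ∩ {q | |q.1| ≤ r ∧ q.2 ≤ r}).Finite)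
    (hinf : (A ∩ {q | q.2 ≤ 0}).Infinite) :
    ∃ (t : ℕ → ℝ) (c : ℕ → ℝ × ℝ) (𝒮 : ℝ → ℝ), IsGreedyServer v A T t c 𝒮 := by
  obtain ⟨c, hc⟩ := exists_seq_of_forall_exists (R := IsGreedyChoice v A T)
    (fun _ _ _ hcc' _ h => h.congr hcc') fun _ => exists_isGreedyChoice hv hT hfin hinf
  obtain ⟨𝒮, hserve, htravel⟩ := exists_trajectory hv (σ := serverHistory T c) hT
  have hpos (n : ℕ) : 𝒮 (startTime v (serverHistory T c) n) = position (serverHistory T c) n :=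
    hserve n _ ⟨le_rfl, le_add_of_nonneg_right (hT n)⟩
  exact ⟨startTime v (serverHistory T c), c, 𝒮,
    { time_zero := rfl
      pos_zero := hpos 0
      serve := fun n s hs => (hserve n s hs).trans (hpos n).symm
      next_waiting := fun n => (hc n).1
      next_nearest := fun n => by rw [hpos]; exact (hc n).2
      next_time := fun n => by rw [hpos]; rfl
      travel := fun n => by rw [hpos]; exact htravel n }⟩

end GreedyChoice

section AlmostSure

variable {Ω : Type*} [MeasurableSpace Ω] {P : Measure Ω} {u₀ : ℝ → ℝ} {init : Ω → Set ℝ}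
  {arr : Ω → Set (ℝ × ℝ)}

theorem IsPeaked.initMeasure_Ici_eq_top (hu₀ : IsPeaked u₀ 0 0) {a : ℝ} (ha : 0 < a) :
    initMeasure u₀ (Ici a) = ∞ := by
  have hpos : ENNReal.ofReal (-u₀ a) ≠ 0 :=
    (ENNReal.ofReal_pos.2 (neg_pos.2 (hu₀.lt a ha.ne'))).ne'
  rw [initMeasure, withDensity_apply _ measurableSet_Ici, ← top_le_iff]
  calc ∞ = ∫⁻ _ in Ici a, ENNReal.ofReal (-u₀ a) := by
        rw [setLIntegral_const, Real.volume_Ici, ENNReal.mul_top hpos]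
    _ ≤ ∫⁻ x in Ici a, ENNReal.ofReal (-u₀ x) :=
        setLIntegral_mono' measurableSet_Ici fun x hx =>
          ENNReal.ofReal_le_ofReal (neg_le_neg (hu₀.anti ha (ha.trans_le hx) hx))

theorem ae_infinite_init (hu₀ : IsPeaked u₀ 0 0)
    (h_init : IsPoissonProcess init (initMeasure u₀) P) : ∀ᵐ ω ∂P, (init ω).Infinite := by
  have hsigma : SigmaFinite (initMeasure u₀) :=
    SigmaFinite.withDensity_ofReal _
  have hnonempty (n : ℕ) : ∀ᵐ ω ∂P, (init ω ∩ Ici ((n : ℝ) + 1)).Nonempty :=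
    h_init.ae_inter_nonempty measurableSet_Ici (hu₀.initMeasure_Ici_eq_top n.cast_add_one_pos)
  filter_upwards [ae_all_iff.2 hnonempty] with ω hω
  refine infinite_of_not_bddAbove fun ⟨b, hb⟩ => ?_
  obtain ⟨n, hn⟩ := exists_nat_ge b
  obtain ⟨x, hx, hnx : (n : ℝ) + 1 ≤ x⟩ := hω n
  linarith [hb hx]

theorem ae_arrival_pos [IsProbabilityMeasure P]
    (h_arr : IsPoissonProcess arr ((volume : Measure (ℝ × ℝ)).restrict {p | 0 < p.2}) P) :
    ∀ᵐ ω ∂P, ∀ q ∈ arr ω, 0 < q.2 := by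
  have hnull : (volume : Measure (ℝ × ℝ)).restrict {p | 0 < p.2} {p | 0 < p.2}ᶜ = 0 := by
    rw [Measure.restrict_apply measurableSet_snd_pos.compl, compl_inter_self, measure_empty]
  filter_upwards [h_arr.ae_inter_eq_empty measurableSet_snd_pos.compl hnull] with ω hω q hq
  by_contra hq0
  exact notMem_empty q (hω ▸ ⟨hq, hq0⟩)

theorem ae_finite_customers [IsProbabilityMeasure P] (hu₀ : IsPeaked u₀ 0 0)
    (h_init : IsPoissonProcess init (initMeasure u₀) P)
    (h_arr : IsPoissonProcess arr ((volume : Measure (ℝ × ℝ)).restrict {p | 0 < p.2}) P) :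
    ∀ᵐ ω ∂P, ∀ r : ℝ, (customers (init ω) (arr ω) ∩ {q | |q.1| ≤ r ∧ q.2 ≤ r}).Finite := by
  have hinit (n : ℕ) : ∀ᵐ ω ∂P, (init ω ∩ Icc (-(n : ℝ)) n).Finite :=
    h_init.ae_finite_inter measurableSet_Icc (hu₀.initMeasure_Icc_lt_top _ _).ne
  have harr (n : ℕ) : ∀ᵐ ω ∂P, (arr ω ∩ Icc (-(n : ℝ)) n ×ˢ Icc (0 : ℝ) n).Finite := by
    refine h_arr.ae_finite_inter (measurableSet_Icc.prod measurableSet_Icc) (ne_of_lt ?_)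
    refine (Measure.restrict_apply_le _ _).trans_lt ?_
    rw [Measure.volume_eq_prod, Measure.prod_prod]
    exact ENNReal.mul_lt_top measure_Icc_lt_top measure_Icc_lt_top
  filter_upwards [ae_all_iff.2 hinit, ae_all_iff.2 harr, ae_arrival_pos h_arr]
    with ω hinit harr hpos r
  obtain ⟨n, hn⟩ := exists_nat_ge r
  refine (((hinit n).image fun x => (x, (0 : ℝ))).union (harr n)).subset ?_
  rintro q ⟨⟨x, hx, rfl⟩ | hq, hqr⟩
  · exact Or.inl ⟨x, ⟨hx, abs_le.1 (hqr.1.trans hn)⟩, rfl⟩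
  · exact Or.inr ⟨hq, abs_le.1 (hqr.1.trans hn), (hpos q hq).le, hqr.2.trans hn⟩

theorem infinite_customers_inter {X : Set ℝ} (hX : X.Infinite) (B : Set (ℝ × ℝ)) :
    (customers X B ∩ {q | q.2 ≤ 0}).Infinite := by
  have hinj : InjOn (fun x : ℝ => (x, (0 : ℝ))) X := fun x _ y _ hxy => congrArg Prod.fst hxy
  refine (hX.image hinj).mono ?_
  rintro _ ⟨x, hx, rfl⟩
  exact ⟨Or.inl ⟨x, hx, rfl⟩, le_refl (0 : ℝ)⟩

theorem ae_exists_isGreedyServer [IsProbabilityMeasure P] {v : ℝ} (hv : 0 < v) {T : ℕ → Ω → ℝ}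
    (hT : ∀ᵐ ω ∂P, ∀ n, 0 ≤ T n ω) (hu₀ : IsPeaked u₀ 0 0)
    (h_init : IsPoissonProcess init (initMeasure u₀) P)
    (h_arr : IsPoissonProcess arr ((volume : Measure (ℝ × ℝ)).restrict {p | 0 < p.2}) P) :
    ∀ᵐ ω ∂P, ∃ (t : ℕ → ℝ) (c : ℕ → ℝ × ℝ) (𝒮 : ℝ → ℝ),
      IsGreedyServer v (customers (init ω) (arr ω)) (fun n => T n ω) t c 𝒮 := by
  filter_upwards [hT, ae_infinite_init hu₀ h_init, ae_finite_customers hu₀ h_init h_arr]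
    with ω hT hinf hfin
  exact exists_isGreedyServer hv hT hfin (infinite_customers_inter hinf _)

end AlmostSure

/-! ### Comparison of the two sequences -/

theorem IsPotential.isPeaked {u : ℝ → ℝ} (h : IsPotential u) (hu : IsUnimodal u) :
    IsPeaked u (peak u) (height u) := by
  have hpeak : ∀ y, u y ≤ u (peak u) := Classical.epsilon_spec h.unique_max.exists
  refine ⟨rfl, fun y hy => (hpeak y).lt_of_ne fun hyp => hy ?_, hu.1, hu.2⟩
  exact h.unique_max.unique (fun z => (hpeak z).trans_eq hyp.symm) hpeak

theorem height_peak_potentialSeq {v : ℝ} {u₀ : ℝ → ℝ} {w : ℕ → ℝ × ℝ × ℝ} (hv : 0 < v)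
    (hu₀ : IsPeaked u₀ 0 0) (hw : ∀ k, 0 ≤ (w k).1 ∧ 0 < (w k).2.1) {k n : ℕ} (hkn : k ≤ n) :
    (height (potentialSeq v u₀ w k), peak (potentialSeq v u₀ w k)) =
      (startTime v (history v u₀ w n) k, position (history v u₀ w n) k) := by
  obtain ⟨hmem, heq⟩ := history_mem_and_potentialSeq_eq hv hu₀ hw k
  have hpeaked := hu₀.potentialAlong hv hmem
  have hagree := history_apply_of_lt (v := v) (u₀ := u₀) w hkn
  rw [heq, hpeaked.height_eq, hpeaked.peak_eq, startTime_congr hagree, position_congr hagree]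

theorem IsGreedyServer.time_position {v : ℝ} {A : Set (ℝ × ℝ)} {T t : ℕ → ℝ} {c : ℕ → ℝ × ℝ}
    {𝒮 : ℝ → ℝ} (h : IsGreedyServer v A T t c 𝒮) (hv : 0 < v) {k n : ℕ} (hkn : k ≤ n) :
    (t k, 𝒮 (t k)) = (startTime v (pathHistory (serverPath T c n)) k,
      position (pathHistory (serverPath T c n)) k) := by
  have hagree := fun j (hj : j < k) => pathHistory_serverPath T c n j (hj.trans_le hkn)
  rw [startTime_congr hagree, position_congr hagree, h.startTime_serverHistory hv,
    h.position_serverHistory hv]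

section IdentDistrib

variable {Ω Ω' S H : Type*} [MeasurableSpace Ω] [MeasurableSpace Ω'] [MeasurableSpace S]
  [MeasurableSpace H] {P : Measure Ω} {P' : Measure Ω'} {X : Ω → ℕ → S} {Y : Ω' → ℕ → S}

theorem identDistrib_of_forall_finset_restrict [IsFiniteMeasure P]
    (h : ∀ I : Finset ℕ,
      IdentDistrib (fun ω => I.restrict (X ω)) (fun ω => I.restrict (Y ω)) P P') :
    IdentDistrib X Y P P' := by
  have hX : AEMeasurable X P := aemeasurable_pi_iff.2 fun k =>
    (measurable_pi_apply (⟨k, Finset.mem_singleton_self k⟩ : ({k} : Finset ℕ))).comp_aemeasurable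
      (h {k}).aemeasurable_fst
  have hY : AEMeasurable Y P' := aemeasurable_pi_iff.2 fun k =>
    (measurable_pi_apply (⟨k, Finset.mem_singleton_self k⟩ : ({k} : Finset ℕ))).comp_aemeasurable
      (h {k}).aemeasurable_snd
  refine ⟨hX, hY, ?_⟩
  have hlim := isProjectiveLimit_map hY
  rw [← funext fun I => (h I).map_eq] at hlim
  exact (isProjectiveLimit_map hX).unique hlim

theorem identDistrib_of_hasLaw [IsFiniteMeasure P] {ξ : ℕ → Ω → H} {η : ℕ → Ω' → H}
    {ν : ℕ → Measure H} {g : ℕ → H → S} (hg : ∀ k, Measurable (g k))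
    (hξ : ∀ n, HasLaw (ξ n) (ν n) P) (hη : ∀ n, HasLaw (η n) (ν n) P')
    (hX : ∀ n, ∀ᵐ ω ∂P, ∀ k < n, X ω k = g k (ξ n ω))
    (hY : ∀ n, ∀ᵐ ω ∂P', ∀ k < n, Y ω k = g k (η n ω)) : IdentDistrib X Y P P' := by
  refine identDistrib_of_forall_finset_restrict fun I => ?_
  obtain ⟨n, hn⟩ := I.exists_nat_subset_range
  let G : H → I → S := fun σ k => g k σ
  have hG : Measurable G := measurable_pi_lambda _ fun k => hg k
  have hXG : G ∘ ξ n =ᵐ[P] fun ω => I.restrict (X ω) := by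
    filter_upwards [hX n] with ω hω
    exact funext fun k => (hω k (Finset.mem_range.1 (hn k.2))).symm
  have hYG : G ∘ η n =ᵐ[P'] fun ω => I.restrict (Y ω) := by
    filter_upwards [hY n] with ω hω
    exact funext fun k => (hω k (Finset.mem_range.1 (hn k.2))).symm
  have hξη : IdentDistrib (G ∘ ξ n) (G ∘ η n) P P' := ((hξ n).identDistrib (hη n)).comp hG
  exact (IdentDistrib.of_ae_eq hξη.aemeasurable_fst hXG).symm.trans
    (hξη.trans (IdentDistrib.of_ae_eq hξη.aemeasurable_snd hYG))

end IdentDistrib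

end GreedyServer


theorem lemma2_general {Ω Ω' : Type*} [MeasurableSpace Ω] [MeasurableSpace Ω']
    (P : Measure Ω) [IsProbabilityMeasure P] (P' : Measure Ω') [IsProbabilityMeasure P']
    (v : ℝ) (hv : 0 < v) (u₀ : ℝ → ℝ) (hu₀ : GreedyServer.IsPeaked u₀ 0 0)
    (τ : Measure ℝ) [IsProbabilityMeasure τ] (hτ : ∀ᵐ s ∂τ, 0 ≤ s)
    (init : Ω → Set ℝ)
    (h_init : GreedyServer.IsPoissonProcess init
      (volume.withDensity fun x => ENNReal.ofReal (-u₀ x)) P)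
    (arr : Ω → Set (ℝ × ℝ))
    (h_arr : GreedyServer.IsPoissonProcess arr
      ((volume : Measure (ℝ × ℝ)).restrict {p | 0 < p.2}) P)
    (T : ℕ → Ω → ℝ) (hT_meas : ∀ n, Measurable (T n)) (hT_law : ∀ n, HasLaw (T n) τ P)
    (hT_indep : iIndepFun T P)
    (h_indep : iIndep ![GreedyServer.pointSigma init, GreedyServer.pointSigma arr,
      ⨆ n, MeasurableSpace.comap (T n) inferInstance] P)
    (w : ℕ → Ω' → ℝ × ℝ × ℝ)
    (hw_law : ∀ n, HasLaw (w n)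
      (τ.prod ((expMeasure 1).prod (volume.restrict (Icc (0 : ℝ) 1)))) P')
    (hw_indep : iIndepFun w P') :
    (∀ᵐ ω ∂P, ∃ (t : ℕ → ℝ) (c : ℕ → ℝ × ℝ) (𝒮 : ℝ → ℝ),
      GreedyServer.IsGreedyServer v (GreedyServer.customers (init ω) (arr ω))
        (fun n => T n ω) t c 𝒮) ∧
    ∀ (t : Ω → ℕ → ℝ) (c : Ω → ℕ → ℝ × ℝ) (𝒮 : Ω → ℝ → ℝ),
      (∀ᵐ ω ∂P, GreedyServer.IsGreedyServer v (GreedyServer.customers (init ω) (arr ω))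
        (fun n => T n ω) (t ω) (c ω) (𝒮 ω)) →
      IdentDistrib
        (fun ω' (n : ℕ) =>
          (GreedyServer.height (GreedyServer.potentialSeq v u₀ (fun k => w k ω') (n + 1)),
            GreedyServer.peak (GreedyServer.potentialSeq v u₀ (fun k => w k ω') (n + 1))))
        (fun ω (n : ℕ) => (t ω (n + 1), 𝒮 ω (t ω (n + 1))))
        P' P := by
  have hT : ∀ᵐ ω ∂P, ∀ n, 0 ≤ T n ω := ae_all_iff.2 fun n =>
    ae_of_ae_map (hT_law n).aemeasurable (by rwa [(hT_law n).map_eq])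
  refine ⟨GreedyServer.ae_exists_isGreedyServer hv hT hu₀ h_init h_arr, fun t c 𝒮 hG => ?_⟩
  have hξ := GreedyServer.hasLaw_history hv hu₀ hτ hw_law hw_indep
  have hprob (n : ℕ) : IsProbabilityMeasure (GreedyServer.historyLaw v u₀ τ n) :=
    (hξ n).isProbabilityMeasure_iff.1 inferInstance
  have hη (n : ℕ) : HasLaw (fun ω => GreedyServer.pathHistory
      (GreedyServer.serverPath (fun k => T k ω) (c ω) n)) (GreedyServer.historyLaw v u₀ τ n) P := by
    refine GreedyServer.hasLaw_pathHistory hv hu₀ hτ (GreedyServer.hasHitBound_flaggedCustomers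
      h_init h_arr hT_meas hT_law hT_indep h_indep n)
      (c := fun ω k => GreedyServer.flagInitial (c ω k)) ?_
    filter_upwards [hG, hT, GreedyServer.ae_arrival_pos h_arr] with ω h hT harr
    exact h.flagged_chosen_spec hv hT harr n
  refine GreedyServer.identDistrib_of_hasLaw
    (g := fun k σ => (GreedyServer.startTime v σ (k + 1), GreedyServer.position σ (k + 1)))
    (fun k => ((GreedyServer.continuous_startTime v _).prodMk
      (GreedyServer.continuous_position _)).measurable) hξ hη (fun n => ?_) (fun n => ?_)
  · filter_upwards [GreedyServer.ae_nonneg_and_pos hτ hw_law] with ω hw k hk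
    exact GreedyServer.height_peak_potentialSeq hv hu₀ hw hk
  · filter_upwards [hG] with ω h k hk
    exact h.time_position hv hk


theorem lemma2 {Ω Ω' : Type*} [MeasurableSpace Ω] [MeasurableSpace Ω']
    (P : Measure Ω) [IsProbabilityMeasure P] (P' : Measure Ω') [IsProbabilityMeasure P']
    -- the speed, the initial potential, and the law of a service time
    (v : ℝ) (hv : 0 < v)
    (u₀ : ℝ → ℝ) (hu₀ : GreedyServer.IsPotential u₀) (hu₀_uni : GreedyServer.IsUnimodal u₀)
    (hu₀_cen : GreedyServer.IsCentered u₀)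
    (τ : Measure ℝ) [IsProbabilityMeasure τ] (hτ : ∀ᵐ s ∂τ, 0 ≤ s)
    -- customers waiting at time 0, later arrivals, and service times of the queueing system
    (init : Ω → Set ℝ)
    (h_init : GreedyServer.IsPoissonProcess init
      (volume.withDensity fun x => ENNReal.ofReal (-u₀ x)) P)
    (arr : Ω → Set (ℝ × ℝ))
    (h_arr : GreedyServer.IsPoissonProcess arr
      ((volume : Measure (ℝ × ℝ)).restrict {p | 0 < p.2}) P)
    (T : ℕ → Ω → ℝ) (hT_meas : ∀ n, Measurable (T n)) (hT_law : ∀ n, HasLaw (T n) τ P)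
    (hT_indep : iIndepFun T P)
    (h_indep : iIndep ![GreedyServer.pointSigma init, GreedyServer.pointSigma arr,
      ⨆ n, MeasurableSpace.comap (T n) inferInstance] P)
    -- the i.i.d. triples (service time, standard exponential, uniform), independent coordinates
    (w : ℕ → Ω' → ℝ × ℝ × ℝ)
    (hw_law : ∀ n, HasLaw (w n)
      (τ.prod ((expMeasure 1).prod (volume.restrict (Icc (0 : ℝ) 1)))) P')
    (hw_indep : iIndepFun w P') :
    -- almost surely the greedy server exists
    (∀ᵐ ω ∂P, ∃ (t : ℕ → ℝ) (c : ℕ → ℝ × ℝ) (𝒮 : ℝ → ℝ),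
      GreedyServer.IsGreedyServer v (GreedyServer.customers (init ω) (arr ω))
        (fun n => T n ω) t c 𝒮) ∧
    -- and its service start times and positions have the same law as the sequence of potentials
    ∀ (t : Ω → ℕ → ℝ) (c : Ω → ℕ → ℝ × ℝ) (𝒮 : Ω → ℝ → ℝ),
      (∀ᵐ ω ∂P, GreedyServer.IsGreedyServer v (GreedyServer.customers (init ω) (arr ω))
        (fun n => T n ω) (t ω) (c ω) (𝒮 ω)) →
      IdentDistrib
        (fun ω' (n : ℕ) =>
          (GreedyServer.height (GreedyServer.potentialSeq v u₀ (fun k => w k ω') (n + 1)),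
            GreedyServer.peak (GreedyServer.potentialSeq v u₀ (fun k => w k ω') (n + 1))))
        (fun ω (n : ℕ) => (t ω (n + 1), 𝒮 ω (t ω (n + 1))))
        P' P := by
  have hpeaked : GreedyServer.IsPeaked u₀ 0 0 := by
    simpa only [hu₀_cen.1, hu₀_cen.2] using hu₀.isPeaked hu₀_uni
  exact lemma2_general P P' v hv u₀ hpeaked τ hτ init h_init arr h_arr T hT_meas hT_law hT_indep
    h_indep w hw_law hw_indep
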